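/- Let $\mathbb T=\{u\in\mathbb C:|u|=1\}$ and $\theta>0$. For each $n$ let $\sigma=\sigma_n$ be a random permutation in $S_n$ with the Ewens distribution $\mathbb P[\sigma=s]=\theta^{\ell(s)}/\bigl(\theta(\theta+1)\cdots(\theta+n-1)\bigr)$, where $\ell(s)$ is the total number of cycles of $s$, and let $C_m$ be the number of cycles of length $m$ of $\sigma$. Let $f:\mathbb T\to\mathbb C$ be real analytic and not identically zero, let $x\in\mathbb T$ not be a root of unity (i.e. $x^m\ne1$ for all $m\in\mathbb Z\setminus\{0\}$), and let $z$ be a $\mathbb T$-valued random variable. Let $(T_{m,k})_{m,k\ge1}$ be a family of independent random variables, independent of $\sigma$, such that $T_{m,k}$ is distributed as the product of $m$ independent copies of $z$. With the principal branch of the logarithm ($\arg\in(-\pi,\pi]$), set $$w^{2,n}(f)=\sum_{m=1}^n\sum_{k=1}^{C_m}\log f\bigl(x^mT_{m,k}\bigr).$$ Suppose that one of the following conditions is satisfied. 1. $z$ is uniformly distributed on $\mathbb T$. 2. $z=e^{2\pi i\phi}$ where $\phi$ has a density $g:[0,1]\to\mathbb R_+$ with $g(\phi)=\sum_{j\in\mathbb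 Z}c_je^{2\pi ij\phi}$, $|c_j|<1$ for $j\neq0$, and $\sum_{j\in\mathbb Z}|c_j|<\infty$. 3. There is an integer $\rho>0$ with $z^\rho=1$ almost surely and, for each $1\le k\le\rho$, $$\mathbb P\bigl[z=e^{2\pi ik/\rho}\bigr]=\frac1\rho\sum_{j=0}^{\rho-1}c_je^{2\pi ijk/\rho}\quad\text{with } |c_j|<1\text{ for }j\ne0;$$ all zeros of $f$ are roots of unity; and $x=e^{2\pi i\varphi}$ with $\varphi\in[0,1]$ of finite type, i.e. there are $K>0$ and $\gamma\ge1$ with $\min_{p\in\mathbb Z}|q\varphi-p|\ge K/|q|^\gamma$ for all $q\in\mathbb Z\setminus\{0\}$. Define $$m_R(f)=\Re\int_0^1\log f(e^{2\pi i\phi})\,d\phi,\qquad m_I(f)=\Im\int_0^1\log f(e^{2\pi i\phi})\,d\phi,$$ $$V_R(f)=\int_0^1\log^2\bigl|f(e^{2\pi i\phi})\bigr|\,d\phi,\qquad V_I(f)=\int_0^1\arg^2\bigl(f(e^{2\pi i\phi})\bigr)\,d\phi.$$ Then these integrals converge absolutely and, as $n\to\infty$, $$\frac{\Re\,w^{2,n}(f)}{\sqrt{\log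 n}}-\theta\,m_R(f)\sqrt{\log n}\ \xrightarrow{d}\ \mathcal N\bigl(0,\theta V_R(f)\bigr),\qquad \frac{\Im\,w^{2,n}(f)}{\sqrt{\log n}}-\theta\,m_I(f)\sqrt{\log n}\ \xrightarrow{d}\ \mathcal N\bigl(0,\theta V_I(f)\bigr),$$ where $\mathcal N(0,0)$ denotes the point mass at $0$. -/

import Mathlib

open MeasureTheory ProbabilityTheory Filter Topology

/-- The unit circle carries its Borel σ-algebra. -/
noncomputable instance circleMeasurableSpace : MeasurableSpace Circle := borel Circle

instance circleBorelSpace : BorelSpace Circle := ⟨rfl⟩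

/-- The (finite) symmetric group carries the discrete σ-algebra. -/
instance permMeasurableSpace (n : ℕ) : MeasurableSpace (Equiv.Perm (Fin n)) := ⊤

namespace EwensCLT

noncomputable section

/-- The parametrization `φ ↦ e^{2πiφ}` of the unit circle. -/
def e (φ : ℝ) : Circle := Circle.exp (2 * Real.pi * φ)

/-- Number of cycles of length `m` of a permutation (fixed points are the cycles of length `1`). -/
def cycleCount {n : ℕ} (s : Equiv.Perm (Fin n)) (m : ℕ) : ℕ := s.partition.parts.count m

/-- Total number of cycles of a permutation, fixed points included. -/
def numCycles {n : ℕ} (s : Equiv.Perm (Fin n)) : ℕ := s.partition.parts.card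

/-- The Ewens distribution with parameter `θ` on the symmetric group `S_n`:
the point `s` has mass `θ^{numCycles s} / (θ (θ + 1) ⋯ (θ + n - 1))`. -/
def ewensMeasure (θ : ℝ) (n : ℕ) : Measure (Equiv.Perm (Fin n)) :=
  ∑ s : Equiv.Perm (Fin n),
    ENNReal.ofReal (θ ^ numCycles s / ∏ i ∈ Finset.range n, (θ + (i : ℝ))) • Measure.dirac s

/-- The law of `z_1 z_2 ⋯ z_m` for `z_1, …, z_m` i.i.d. with law `ζ`. -/
def prodLaw (ζ : Measure Circle) (m : ℕ) : Measure Circle :=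
  (Measure.pi (fun _ : Fin m => ζ)).map (fun u => ∏ j, u j)

/-- Real analyticity of a function on the unit circle: it is real analytic in the angle. -/
def IsRealAnalytic (f : Circle → ℂ) : Prop :=
  AnalyticOnNhd ℝ (fun t : ℝ => f (Circle.exp t)) Set.univ

/-- `φ ∈ [0,1]` is of finite type: there are `K > 0` and `γ ≥ 1` such that the distance of `q φ`
to the nearest integer is at least `K / |q|^γ` for all nonzero integers `q`. -/
def IsFiniteType (φ : ℝ) : Prop :=
  φ ∈ Set.Icc (0 : ℝ) 1 ∧ ∃ K > (0 : ℝ), ∃ γ ≥ (1 : ℝ), ∀ q : ℤ, q ≠ 0 →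
    K / |(q : ℝ)| ^ γ ≤ |(q : ℝ) * φ - (round ((q : ℝ) * φ) : ℝ)|

/-- The uniform distribution on the unit circle. -/
def uniformLaw : Measure Circle := (volume.restrict (Set.Icc (0 : ℝ) 1)).map e

/-- `ζ` has, in the coordinate `φ ∈ [0,1]`, a density `g(φ) = ∑_{j ∈ ℤ} c_j e^{2πijφ}` with
`∑ |c_j| < ∞` and `|c_j| < 1` for `j ≠ 0`. -/
def HasSummableFourierDensity (ζ : Measure Circle) : Prop :=
  ∃ (g : ℝ → ℝ) (c : ℤ → ℂ),
    (∀ φ ∈ Set.Icc (0 : ℝ) 1, 0 ≤ g φ) ∧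
    ζ = ((volume.restrict (Set.Icc (0 : ℝ) 1)).withDensity
      (fun φ => ENNReal.ofReal (g φ))).map e ∧
    (∀ φ ∈ Set.Icc (0 : ℝ) 1,
      HasSum (fun j : ℤ => c j * Complex.exp (2 * Real.pi * Complex.I * j * φ)) (g φ : ℂ)) ∧
    (∀ j : ℤ, j ≠ 0 → ‖c j‖ < 1) ∧
    Summable (fun j : ℤ => ‖c j‖)

/-- `ζ` is carried by the `ρ`-th roots of unity and
`ζ {e^{2πik/ρ}} = (1/ρ) ∑_{j<ρ} c_j e^{2πijk/ρ}` for `1 ≤ k ≤ ρ`,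
with `|c_j| < 1` for `j ≠ 0`. -/
def IsDiscreteWithFourier (ζ : Measure Circle) (ρ : ℕ) : Prop :=
  (∀ᵐ u ∂ζ, u ^ ρ = 1) ∧
  ∃ c : ℕ → ℂ,
    (∀ k ∈ Finset.Icc 1 ρ,
      (ζ.real {e ((k : ℝ) / (ρ : ℝ))} : ℂ) = 1 / (ρ : ℂ) *
        ∑ j ∈ Finset.range ρ, c j * Complex.exp (2 * Real.pi * Complex.I * j * k / ρ)) ∧
    (∀ j ∈ Finset.range ρ, j ≠ 0 → ‖c j‖ < 1)

/-- The logarithm of the second multiplicative class function,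
`∑_{m=1}^n ∑_{k=1}^{C_m(s)} log f(x^m T_{m,k})`, with the principal branch (`arg ∈ (-π, π]`).
The second index of `T` starts at `0`. -/
def w2 (f : Circle → ℂ) (x : Circle) {n : ℕ} (s : Equiv.Perm (Fin n)) (T : ℕ → ℕ → Circle) : ℂ :=
  ∑ m ∈ Finset.Icc 1 n, ∑ k ∈ Finset.range (cycleCount s m), Complex.log (f (x ^ m * T m k))

/-- `∫_0^1 log f(e^{2πiφ}) dφ`; its real and imaginary part are `m_R(f)` and `m_I(f)`. -/
def logMean (f : Circle → ℂ) : ℂ := ∫ φ in (0 : ℝ)..1, Complex.log (f (e φ))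

def mR (f : Circle → ℂ) : ℝ := (logMean f).re

def mI (f : Circle → ℂ) : ℝ := (logMean f).im

def VR (f : Circle → ℂ) : ℝ := ∫ φ in (0 : ℝ)..1, (Real.log ‖f (e φ)‖) ^ 2

def VI (f : Circle → ℂ) : ℝ := ∫ φ in (0 : ℝ)..1, (Complex.arg (f (e φ))) ^ 2

end

end EwensCLT

namespace EwensCLT

/-! ### The cycle index of the symmetric group -/

/-! Let `h` be `log |f|` or `arg f`, and let `a_m` be the characteristic function at `t` of `h (x^m
T_{m,k})`. Given `σ`, the sum of these values over the cycles is a sum of independent variables.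
Averaging over the Ewens law, its characteristic function at `t` is a quotient of coefficients of
`z^n`: that of `exp (∑ θ a_m z^m / m)` over that of `(1 - z)^(-θ)` (`charFun_cycleSum`). If the
cycle counts were independent Poisson variables of means `θ / m`, it would be `exp (θ ∑_{m ≤ n} (a_m
- 1) / m)`. The difference of the two is at most `∑ |a_m - 1| w_n(m)` with explicit weights
(`norm_cycleIndex_sub_exp_le`), which is an analytic form of the Feller coupling.

At `t / √(log n)` each `a_m` is expanded to second order. Let `M₁` and `M₂` be the integrals of `h`
and `h²` over the circle. If the first two moments of `h (x^m T_{m,k})`, summed against `1 / m`,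
differ from those of the constants `M₁` and `M₂` by `O(1)`, the Poisson exponent is `i t θ M₁ √(log
n) - θ M₂ t² / 2 + o(1)` (`tendsto_cycleIndex_charFun`). The second moment appears rather than the
variance because the number of cycles is itself random. By summation by parts everything reduces to
a power saving in the equidistribution of `h`, `h²`, `|h|`, `|h|³` along `x^m T_{m,k}`, together
with `E |h (x^m T_{m,k})| = O(1 + log m)`; the latter controls the comparison weights when `θ ≤ 1`,
where they concentrate near `m = n` (`exists_sum_mul_compWeight_le`).

In the first two cases the density of a product of `m` copies of `z` is exponentially close to `1`
(`HasFourierDensity.abs_prodDensity_sub_one_le`), so nothing is needed from `x`. In the third case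
the product is exponentially close to uniform on the `ρ`-th roots of unity
(`exists_abs_prodLaw_sub_inv_le`), and sums of `h` along `m φ + k / ρ` remain. For Lipschitz
functions Dirichlet approximation and the finite type condition give a power saving
(`exists_equidistribution_lipschitz`). The singularities of `log |f|` and the jumps of `arg f` are
cut out at a scale that is a power of `M` (`IsTame.exists_equidistribution`). What is lost there is
controlled because the zeros of `f` are roots of unity: the orbit stays polynomially far from them
(`exists_le_norm_orbit`), and `log |f|` grows at most logarithmically on it. -/

/-- The weight `∏_m (b_m / m)^{c_m} / c_m!` of a multiset in which `m` has multiplicity `c_m`. -/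
noncomputable def multisetWeight (b : ℕ → ℂ) (l : Multiset ℕ) : ℂ :=
  ∏ m ∈ l.toFinset, (b m / m) ^ l.count m / (l.count m).factorial

/-- The coefficient of `z^n` in `exp (∑_m b_m z^m / m)`. -/
noncomputable def cycleIndex (b : ℕ → ℂ) (n : ℕ) : ℂ :=
  ∑ p : n.Partition, multisetWeight b p.parts

theorem multisetWeight_eq_prod (b : ℕ → ℂ) (l : Multiset ℕ) {s : Finset ℕ} (h : l.toFinset ⊆ s) :
    multisetWeight b l = ∏ m ∈ s, (b m / m) ^ l.count m / (l.count m).factorial := by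
  refine Finset.prod_subset h fun m _ hm => ?_
  have : l.count m = 0 := by simpa using hm
  simp [this]

/-- Only the factor of index `m` changes: its exponent and its factorial both go up by one. This is
the local step behind the recursion `mul_cycleIndex`. -/
theorem multisetWeight_cons (b : ℕ → ℂ) (l : Multiset ℕ) {m : ℕ} (hm : m ≠ 0) :
    (m : ℂ) * ((m ::ₘ l).count m) * multisetWeight b (m ::ₘ l) = b m * multisetWeight b l := by
  -- Both products are written over one index set in which `m` is split off, whether or not `m`
  -- occurs in `l`.
  have h1 := multisetWeight_eq_prod b (m ::ₘ l) (s := insert m (l.toFinset.erase m))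
    (by intro i; simp; tauto)
  have h2 := multisetWeight_eq_prod b l (s := insert m (l.toFinset.erase m)) (by
    intro i; simp; tauto)
  rw [h1, h2, Finset.prod_insert (by simp), Finset.prod_insert (by simp)]
  have h3 : ∏ i ∈ l.toFinset.erase m,
      (b i / i) ^ (m ::ₘ l).count i / ((m ::ₘ l).count i).factorial =
      ∏ i ∈ l.toFinset.erase m, (b i / i) ^ l.count i / (l.count i).factorial := by
    refine Finset.prod_congr rfl fun i hi => ?_
    rw [Multiset.count_cons_of_ne (Finset.ne_of_mem_erase hi)]
  rw [h3, Multiset.count_cons_self, Nat.factorial_succ, pow_succ]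
  have hm' : (m : ℂ) ≠ 0 := by exact_mod_cast hm
  have h4 : ((l.count m).factorial : ℂ) ≠ 0 := by exact_mod_cast Nat.factorial_ne_zero _
  have h5 : ((l.count m + 1 : ℕ) : ℂ) ≠ 0 := by exact_mod_cast Nat.succ_ne_zero (l.count m)
  push_cast at h5 ⊢
  field_simp

/-- Cauchy's formula for the size of a conjugacy class. Mathlib counts permutations by `cycleType`,
which leaves out fixed points, so the parts equal to `1` have to be put back. -/
theorem card_perm_partition_eq (α : Type) [Fintype α] [DecidableEq α]
    (p : (Fintype.card α).Partition) :
    (Finset.univ.filter fun s : Equiv.Perm α => s.partition = p).card *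
      ∏ m ∈ p.parts.toFinset, (m ^ p.parts.count m * (p.parts.count m).factorial) =
      (Fintype.card α).factorial := by
  set l := p.parts.filter (fun n => 2 ≤ n) with hl
  have hset : (Finset.univ.filter fun s : Equiv.Perm α => s.partition = p) =
      Finset.univ.filter fun s : Equiv.Perm α => s.cycleType = l := by
    refine Finset.filter_congr fun s _ => ?_
    constructor
    · rintro rfl
      rw [hl, Equiv.Perm.filter_parts_partition_eq_cycleType]
    · intro h
      -- The parts below `2` all equal `1`, and their number is forced by the total sum. Hence the
      -- cycle type determines the partition.
      have hp : p.parts.filter (fun n => ¬ 2 ≤ n) =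
          Multiset.replicate (p.parts.filter (fun n => ¬ 2 ≤ n)).card 1 := by
        refine Multiset.eq_replicate_card.2 fun i hi => ?_
        have h1 := Multiset.of_mem_filter hi
        have h2 := p.parts_pos (Multiset.mem_of_mem_filter hi)
        omega
      have hsum : l.sum + (p.parts.filter (fun n => ¬ 2 ≤ n)).card = Fintype.card α := by
        have h1 := congrArg Multiset.sum (Multiset.filter_add_not (fun n => 2 ≤ n) p.parts)
        rw [p.parts_sum, Multiset.sum_add, hp] at h1
        simpa using h1
      have hsub : Fintype.card α - l.sum = (p.parts.filter (fun n => ¬ 2 ≤ n)).card := by omega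
      ext1
      rw [Equiv.Perm.parts_partition, h, ← Multiset.filter_add_not (fun n => 2 ≤ n) p.parts, hp,
        ← Equiv.Perm.sum_cycleType, h, hsub]
  have hp1 : p.parts = l + Multiset.replicate (p.parts.count 1) 1 := by
    ext i
    rw [Multiset.count_add, hl, Multiset.count_filter, Multiset.count_replicate]
    rcases lt_trichotomy i 1 with h | rfl | h
    · have h0 : i = 0 := by omega
      subst h0
      have : (0 : ℕ) ∉ p.parts := fun h => absurd (p.parts_pos h) (by simp)
      simp [Multiset.count_eq_zero_of_notMem this]
    · simp
    · simp [show 2 ≤ i by omega, show ¬ 1 = i by omega]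
  have hsum : l.sum + p.parts.count 1 = Fintype.card α := by
    have := congrArg Multiset.sum hp1
    rw [p.parts_sum] at this
    simpa using this.symm
  have key := Equiv.Perm.card_of_cycleType_mul_eq α l
  rw [if_pos ⟨by omega, fun a ha => Multiset.of_mem_filter ha⟩] at key
  rw [hset, ← key]
  congr 1
  have h1 : l.toFinset ⊆ p.parts.toFinset := by
    intro i hi
    simp only [Multiset.mem_toFinset] at hi ⊢
    exact Multiset.mem_of_mem_filter hi
  have hprod : l.prod = ∏ m ∈ p.parts.toFinset, m ^ p.parts.count m := by
    rw [← Finset.prod_multiset_count]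
    conv_rhs => rw [hp1]
    simp
  have hl1 : (1 : ℕ) ∉ l := fun h => absurd (Multiset.of_mem_filter h) (by norm_num)
  have hfac : (Fintype.card α - l.sum).factorial * ∏ n ∈ l.toFinset, (l.count n).factorial =
      ∏ m ∈ p.parts.toFinset, (p.parts.count m).factorial := by
    have e1 : ∏ m ∈ p.parts.toFinset, (p.parts.count m).factorial =
        ∏ m ∈ insert 1 l.toFinset, (p.parts.count m).factorial := by
      refine Finset.prod_subset_one_on_sdiff (fun i hi => ?_) (fun i hi => ?_) (fun _ _ => rfl)
      · rw [Multiset.mem_toFinset, hp1, Multiset.mem_add] at hi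
        rcases hi with hi | hi
        · simp [hi]
        · simp [Multiset.eq_of_mem_replicate hi]
      · have : i ∉ p.parts := by simpa using (Finset.mem_sdiff.1 hi).2
        simp [Multiset.count_eq_zero_of_notMem this]
    rw [e1, Finset.prod_insert (by simpa using hl1)]
    congr 1
    · rw [show Fintype.card α - l.sum = p.parts.count 1 by omega]
    · refine Finset.prod_congr rfl fun i hi => ?_
      have : 2 ≤ i := Multiset.of_mem_filter (Multiset.mem_toFinset.1 hi)
      rw [hl, Multiset.count_filter, if_pos this]
  rw [Finset.prod_mul_distrib, ← hprod, ← hfac]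
  ring

/-- Grouping permutations by cycle structure turns Cauchy's formula into the cycle index. A general
finite type is used because `s.partition` partitions `Fintype.card α`, which for `Fin n` is `n` only
after rewriting. -/
theorem sum_perm_prod_eq_card (b : ℕ → ℂ) (α : Type) [Fintype α] [DecidableEq α] :
    ∑ s : Equiv.Perm α, (s.partition.parts.map b).prod =
      (Fintype.card α).factorial * cycleIndex b (Fintype.card α) := by
  rw [cycleIndex, Finset.mul_sum,
    ← Finset.sum_fiberwise_of_maps_to (s := Finset.univ) (t := Finset.univ)
      (g := fun s : Equiv.Perm α => s.partition) (fun _ _ => Finset.mem_univ _)]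
  refine Finset.sum_congr rfl fun p _ => ?_
  rw [Finset.sum_congr rfl (g := fun _ => (p.parts.map b).prod)
    (fun s hs => by rw [(Finset.mem_filter.1 hs).2]), Finset.sum_const, nsmul_eq_mul,
    ← card_perm_partition_eq α p, multisetWeight, Finset.prod_multiset_map_count]
  push_cast
  rw [mul_assoc, ← Finset.prod_mul_distrib]
  congr 1
  refine Finset.prod_congr rfl fun m hm => ?_
  have h0 : (m : ℂ) ≠ 0 := by
    have := p.parts_pos (Multiset.mem_toFinset.1 hm)
    exact_mod_cast this.ne'
  have h4 : ((p.parts.count m).factorial : ℂ) ≠ 0 := by exact_mod_cast Nat.factorial_ne_zero _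
  rw [div_pow]
  field_simp

theorem sum_perm_prod_eq (b : ℕ → ℂ) (n : ℕ) :
    ∑ s : Equiv.Perm (Fin n), (s.partition.parts.map b).prod = n.factorial * cycleIndex b n := by
  have := sum_perm_prod_eq_card b (Fin n)
  simpa only [Fintype.card_fin] using this

@[simp]
theorem cycleIndex_zero (b : ℕ → ℂ) : cycleIndex b 0 = 1 := by
  simp [cycleIndex, multisetWeight]

/-- Writing `n = ∑ m c_m` in each partition marks a part, and deleting a marked part `m` leaves a
partition of `n - m`. In terms of the generating function `F` this is `z F' = (∑ b_m z^m) F`; it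
determines the sequence once the value at `0` is known. -/
theorem mul_cycleIndex (b : ℕ → ℂ) (n : ℕ) :
    (n : ℂ) * cycleIndex b n = ∑ m ∈ Finset.Icc 1 n, b m * cycleIndex b (n - m) := by
  have h1 : ∀ p : n.Partition, (n : ℂ) * multisetWeight b p.parts =
      ∑ m ∈ Finset.Icc 1 n, if m ∈ p.parts then
        (m : ℂ) * p.parts.count m * multisetWeight b p.parts else 0 := by
    intro p
    have h2 : (n : ℂ) = ∑ m ∈ p.parts.toFinset, (m : ℂ) * p.parts.count m := by
      conv_lhs => rw [← p.parts_sum, Finset.sum_multiset_count]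
      rw [Nat.cast_sum]
      exact Finset.sum_congr rfl fun m _ => by simp [mul_comm]
    conv_lhs => rw [h2, Finset.sum_mul]
    rw [← Finset.sum_filter]
    refine Finset.sum_congr ?_ fun _ _ => rfl
    ext m
    simp only [Multiset.mem_toFinset, Finset.mem_filter, Finset.mem_Icc]
    exact ⟨fun h => ⟨⟨p.parts_pos h, p.le_of_mem_parts h⟩, h⟩, fun h => h.2⟩
  rw [cycleIndex, Finset.mul_sum, Finset.sum_congr rfl (fun p _ => h1 p), Finset.sum_comm]
  refine Finset.sum_congr rfl fun m hm => ?_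
  obtain ⟨hm1, hmn⟩ := Finset.mem_Icc.1 hm
  rw [← Finset.sum_filter, cycleIndex, Finset.mul_sum, Finset.sum_subtype (p := fun p => m ∈ p.parts)
    _ (by simp)]
  refine Fintype.sum_equiv (Nat.Partition.partitionWithPartEquiv hm1 hmn) _ _ fun p => ?_
  rw [Nat.Partition.partitionWithPartEquiv_apply_parts, ← multisetWeight_cons b _ (by omega),
    Multiset.cons_erase p.2]

/-- A sequence satisfying the recursion of the cycle index is the cycle index. -/
theorem eq_cycleIndex (b : ℕ → ℂ) (G : ℕ → ℂ) (h0 : G 0 = 1)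
    (h : ∀ n : ℕ, (n : ℂ) * G n = ∑ m ∈ Finset.Icc 1 n, b m * G (n - m)) (n : ℕ) :
    G n = cycleIndex b n := by
  induction n using Nat.strong_induction_on with
  | _ n ih =>
    rcases Nat.eq_zero_or_pos n with rfl | hn
    · simp [h0]
    · have hn' : (n : ℂ) ≠ 0 := by exact_mod_cast hn.ne'
      apply mul_left_cancel₀ hn'
      rw [h, mul_cycleIndex]
      refine Finset.sum_congr rfl fun m hm => ?_
      obtain ⟨hm1, hmn⟩ := Finset.mem_Icc.1 hm
      rw [ih (n - m) (by omega)]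

theorem cycleIndex_congr {b b' : ℕ → ℂ} {n : ℕ} (h : ∀ m ∈ Finset.Icc 1 n, b m = b' m) :
    cycleIndex b n = cycleIndex b' n := by
  refine Finset.sum_congr rfl fun p _ => Finset.prod_congr rfl fun m hm => ?_
  have hm' := Multiset.mem_toFinset.1 hm
  rw [h m (Finset.mem_Icc.2 ⟨p.parts_pos hm', p.le_of_mem_parts hm'⟩)]

/-! ### The normalizing constants of the Ewens distribution -/

/-- `θ (θ + 1) ⋯ (θ + n - 1) / n!`. -/
noncomputable def ewensNorm (θ : ℝ) (n : ℕ) : ℝ := ∏ i ∈ Finset.range n, (θ + i) / (i + 1)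

@[simp]
theorem ewensNorm_zero (θ : ℝ) : ewensNorm θ 0 = 1 := by simp [ewensNorm]

theorem ewensNorm_succ (θ : ℝ) (n : ℕ) :
    ewensNorm θ (n + 1) = ewensNorm θ n * ((θ + n) / (n + 1)) := by
  rw [ewensNorm, Finset.prod_range_succ, ← ewensNorm]

theorem succ_mul_ewensNorm_succ (θ : ℝ) (n : ℕ) :
    (n + 1 : ℝ) * ewensNorm θ (n + 1) = (θ + n) * ewensNorm θ n := by
  have : (n + 1 : ℝ) ≠ 0 := by positivity
  rw [ewensNorm_succ]
  field_simp

theorem ewensNorm_pos {θ : ℝ} (hθ : 0 < θ) (n : ℕ) : 0 < ewensNorm θ n :=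
  Finset.prod_pos fun _ _ => by positivity

theorem ewensNorm_eq (θ : ℝ) (n : ℕ) :
    ewensNorm θ n = (∏ i ∈ Finset.range n, (θ + (i : ℝ))) / n.factorial := by
  rw [ewensNorm, Finset.prod_div_distrib, ← Finset.prod_range_add_one_eq_factorial]
  push_cast
  rfl

theorem mul_sum_ewensNorm (θ : ℝ) (n : ℕ) :
    θ * ∑ k ∈ Finset.range n, ewensNorm θ k = n * ewensNorm θ n := by
  induction n with
  | zero => simp
  | succ n ih =>
    rw [Finset.sum_range_succ, mul_add, ih]
    push_cast
    rw [succ_mul_ewensNorm_succ]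
    ring

theorem sum_Icc_sub {M : Type*} [AddCommMonoid M] (c : ℕ → M) (n : ℕ) :
    ∑ m ∈ Finset.Icc 1 n, c (n - m) = ∑ k ∈ Finset.range n, c k := by
  refine Finset.sum_nbij' (fun m => n - m) (fun k => n - k) ?_ ?_ ?_ ?_ ?_ <;>
    simp only [Finset.mem_Icc, Finset.mem_range] <;> intros <;> first | omega | trivial

theorem cycleIndex_const (θ : ℝ) (n : ℕ) :
    cycleIndex (fun _ => (θ : ℂ)) n = ewensNorm θ n := by
  refine (eq_cycleIndex _ (fun n => (ewensNorm θ n : ℂ)) (by simp) (fun n => ?_) n).symm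
  rw [← Finset.mul_sum, sum_Icc_sub (fun k => (ewensNorm θ k : ℂ))]
  exact_mod_cast (mul_sum_ewensNorm θ n).symm

/-- By induction, the recursion is dominated term by term by the one for the constant weight `θ`,
whose solution is `ewensNorm θ`. -/
theorem norm_cycleIndex_le {θ : ℝ} (b : ℕ → ℂ) (hb : ∀ m, ‖b m‖ ≤ θ) (n : ℕ) :
    ‖cycleIndex b n‖ ≤ ewensNorm θ n := by
  induction n using Nat.strong_induction_on with
  | _ n ih =>
    rcases Nat.eq_zero_or_pos n with rfl | hn
    · simp
    · have hn' : (0 : ℝ) < n := by exact_mod_cast hn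
      refine le_of_mul_le_mul_left ?_ hn'
      rw [← mul_sum_ewensNorm, ← sum_Icc_sub, Finset.mul_sum]
      calc (n : ℝ) * ‖cycleIndex b n‖ = ‖(n : ℂ) * cycleIndex b n‖ := by simp
        _ ≤ _ := by
          rw [mul_cycleIndex]
          refine (norm_sum_le _ _).trans (Finset.sum_le_sum fun m hm => ?_)
          obtain ⟨hm1, hmn⟩ := Finset.mem_Icc.1 hm
          rw [norm_mul]
          exact mul_le_mul (hb m) (ih _ (by omega)) (norm_nonneg _) ((norm_nonneg _).trans (hb m))

theorem tendsto_ewensNorm_sub_div {θ : ℝ} (hθ : 0 < θ) (m : ℕ) :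
    Tendsto (fun N => ewensNorm θ (N - m) / ewensNorm θ N) atTop (𝓝 1) := by
  induction m with
  | zero =>
    refine tendsto_const_nhds.congr fun N => ?_
    rw [Nat.sub_zero, div_self (ewensNorm_pos hθ N).ne']
  | succ m ih =>
    have h1 : Tendsto (fun k : ℕ => ewensNorm θ k / ewensNorm θ (k + 1)) atTop (𝓝 1) := by
      have h2 : Tendsto (fun k : ℕ => ((k : ℝ) + 1) / ((k : ℝ) + θ)) atTop (𝓝 1) := by
        have h3 : Tendsto (fun k : ℕ => 1 + (1 - θ) / ((k : ℝ) + θ)) atTop (𝓝 (1 + 0)) :=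
          tendsto_const_nhds.add (tendsto_const_nhds.div_atTop
            (tendsto_atTop_add_const_right _ _ tendsto_natCast_atTop_atTop))
        rw [add_zero] at h3
        refine h3.congr fun k => ?_
        have : (k : ℝ) + θ ≠ 0 := by positivity
        field_simp
        ring
      refine h2.congr fun k => ?_
      have h3 := ewensNorm_pos hθ k
      rw [ewensNorm_succ]
      field_simp
      ring
    have h2 := (h1.comp (tendsto_sub_atTop_nat (m + 1))).mul ih
    rw [mul_one] at h2
    refine h2.congr' ?_
    filter_upwards [eventually_ge_atTop (m + 1)] with N hN
    have h3 := ewensNorm_pos hθ (N - m)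
    simp only [Function.comp]
    rw [show N - (m + 1) + 1 = N - m by omega, div_mul_div_cancel₀ h3.ne']

theorem ewensNorm_le_succ {θ : ℝ} (hθ : 0 < θ) (n : ℕ) :
    ewensNorm θ n ≤ (1 + θ⁻¹) * ewensNorm θ (n + 1) := by
  have h := ewensNorm_pos hθ n
  rw [ewensNorm_succ, mul_left_comm]
  refine le_mul_of_one_le_right h.le ?_
  have h1 : (0 : ℝ) < n + 1 := by positivity
  rw [mul_div_assoc', le_div_iff₀ h1]
  have : (1 + θ⁻¹) * (θ + n) = θ + n + 1 + θ⁻¹ * n := by field_simp; ring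
  rw [this]
  have : 0 ≤ θ⁻¹ * n := by positivity
  linarith

/-- A crude geometric bound, valid for every `θ > 0`. It is enough as a dominating sequence because
it is multiplied by the coefficients of an entire function. -/
theorem ewensNorm_sub_le {θ : ℝ} (hθ : 0 < θ) {j n : ℕ} (hj : j ≤ n) :
    ewensNorm θ (n - j) ≤ (1 + θ⁻¹) ^ j * ewensNorm θ n := by
  induction j with
  | zero => simp
  | succ j ih =>
    refine (ewensNorm_le_succ hθ _).trans ?_
    rw [show n - (j + 1) + 1 = n - j by omega, pow_succ', mul_assoc]
    have : 0 ≤ 1 + θ⁻¹ := by positivity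
    exact mul_le_mul_of_nonneg_left (ih (by omega)) this

/-! ### The cycle index when finitely many weights differ from a constant -/

/-- The coefficients of `exp (δ z^j / j)`. -/
noncomputable def expCoeff (j : ℕ) (δ : ℂ) (n : ℕ) : ℂ :=
  if j ∣ n then (δ / j) ^ (n / j) / (n / j).factorial else 0

theorem expCoeff_mul {j : ℕ} (hj : j ≠ 0) (δ : ℂ) (k : ℕ) :
    expCoeff j δ (j * k) = (δ / j) ^ k / k.factorial := by
  rw [expCoeff, if_pos (dvd_mul_right _ _), Nat.mul_div_cancel_left _ (Nat.pos_of_ne_zero hj)]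

/-- The value `M = 1` identifies the limit in `tendsto_cycleIndex_update`; the value `M = 1 + θ⁻¹`
gives its domination. -/
theorem hasSum_expCoeff_mul_pow {j : ℕ} (hj : j ≠ 0) (δ : ℂ) (M : ℂ) :
    HasSum (fun n => expCoeff j δ n * M ^ n) (Complex.exp (δ / j * M ^ j)) := by
  have hinj : Function.Injective fun k : ℕ => j * k := fun a b h =>
    Nat.eq_of_mul_eq_mul_left (Nat.pos_of_ne_zero hj) h
  rw [← hinj.hasSum_iff]
  · have h := NormedSpace.expSeries_div_hasSum_exp (𝔸 := ℂ) (δ / j * M ^ j)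
    rw [← Complex.exp_eq_exp_ℂ] at h
    refine h.congr_fun fun k => ?_
    simp only [Function.comp]
    rw [expCoeff_mul hj, mul_pow, pow_mul]
    ring
  · intro n hn
    have : ¬ j ∣ n := fun ⟨k, hk⟩ => hn ⟨k, hk.symm⟩
    simp [expCoeff, this]

theorem norm_expCoeff (j : ℕ) (δ : ℂ) (n : ℕ) :
    ‖expCoeff j δ n‖ = ‖expCoeff j (‖δ‖ : ℂ) n‖ := by
  unfold expCoeff
  split_ifs <;> simp

theorem succ_mul_expCoeff {j : ℕ} (hj : j ≠ 0) (δ : ℂ) (n : ℕ) :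
    expCoeff j δ (n + 1) * (n + 1) = δ * if j ≤ n + 1 then expCoeff j δ (n + 1 - j) else 0 := by
  by_cases h : j ∣ n + 1
  · obtain ⟨k, hk⟩ := h
    have hk0 : k ≠ 0 := by rintro rfl; simp at hk
    obtain ⟨k, rfl⟩ := Nat.exists_eq_succ_of_ne_zero hk0
    have h1 : n + 1 - j = j * k := by rw [hk, Nat.succ_eq_add_one, mul_add]; omega
    have h2 : j ≤ n + 1 := by rw [hk]; exact Nat.le_mul_of_pos_right _ (by omega)
    have h3 : ((n : ℂ) + 1) = j * (k + 1) := by exact_mod_cast hk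
    rw [if_pos h2, h1, hk, expCoeff_mul hj, expCoeff_mul hj, h3, Nat.succ_eq_add_one,
      Nat.factorial_succ, pow_succ]
    have hj' : (j : ℂ) ≠ 0 := by exact_mod_cast hj
    have h4 : (k.factorial : ℂ) ≠ 0 := by exact_mod_cast Nat.factorial_ne_zero _
    have h5 : ((k : ℂ) + 1) ≠ 0 := by exact_mod_cast Nat.succ_ne_zero k
    push_cast
    field_simp
  · rw [expCoeff, if_neg h, zero_mul]
    split_ifs with h1
    · have : ¬ j ∣ n + 1 - j := fun h2 => h ((Nat.dvd_sub_iff_left h1 dvd_rfl).1 h2)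
      simp [expCoeff, this]
    · simp

theorem derivative_mk_cycleIndex (b : ℕ → ℂ) :
    PowerSeries.derivative ℂ (PowerSeries.mk (cycleIndex b)) =
      PowerSeries.mk (fun m => b (m + 1)) * PowerSeries.mk (cycleIndex b) := by
  ext n
  rw [PowerSeries.coeff_derivative, PowerSeries.coeff_mk, PowerSeries.coeff_mul, mul_comm]
  have := mul_cycleIndex b (n + 1)
  push_cast at this
  rw [this, Finset.Nat.sum_antidiagonal_eq_sum_range_succ_mk]
  simp only [PowerSeries.coeff_mk]
  refine Finset.sum_nbij' (fun m => m - 1) (fun k => k + 1) ?_ ?_ ?_ ?_ ?_ <;>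
    simp only [Finset.mem_Icc, Finset.mem_range]
  · intros; omega
  · intros; omega
  · intros; omega
  · intros; omega
  · intro m hm
    rw [show m - 1 + 1 = m by omega, show n - (m - 1) = n + 1 - m by omega]

theorem derivative_mk_expCoeff {j : ℕ} (hj : j ≠ 0) (δ : ℂ) :
    PowerSeries.derivative ℂ (PowerSeries.mk (expCoeff j δ)) =
      PowerSeries.C δ * PowerSeries.X ^ (j - 1) * PowerSeries.mk (expCoeff j δ) := by
  ext n
  rw [PowerSeries.coeff_derivative, PowerSeries.coeff_mk, succ_mul_expCoeff hj, mul_assoc,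
    PowerSeries.coeff_C_mul, PowerSeries.coeff_X_pow_mul']
  congr 1
  have : j - 1 ≤ n ↔ j ≤ n + 1 := by omega
  simp only [this, PowerSeries.coeff_mk]
  split_ifs
  · congr 1; omega
  · rfl

/-- Changing `b_j` by `δ` multiplies the generating function by `exp (δ z^j / j)`. The product of
the two series solves the differential equation of the new weights, and the recursion has only one
solution. -/
theorem cycleIndex_update {b b' : ℕ → ℂ} {j : ℕ} (hj : j ≠ 0) {δ : ℂ} (hbj : b' j = b j + δ)
    (hb : ∀ m, m ≠ j → b' m = b m) (n : ℕ) :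
    cycleIndex b' n = ∑ i ∈ Finset.range (n + 1), expCoeff j δ i * cycleIndex b (n - i) := by
  set F := PowerSeries.mk (expCoeff j δ) * PowerSeries.mk (cycleIndex b) with hF
  have hcoeff : ∀ n, PowerSeries.coeff n F =
      ∑ i ∈ Finset.range (n + 1), expCoeff j δ i * cycleIndex b (n - i) := by
    intro n
    rw [hF, PowerSeries.coeff_mul, Finset.Nat.sum_antidiagonal_eq_sum_range_succ_mk]
    simp
  have hB : PowerSeries.mk (fun m => b' (m + 1)) =
      PowerSeries.C δ * PowerSeries.X ^ (j - 1) + PowerSeries.mk (fun m => b (m + 1)) := by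
    ext m
    rw [map_add, PowerSeries.coeff_C_mul, PowerSeries.coeff_X_pow, PowerSeries.coeff_mk,
      PowerSeries.coeff_mk]
    by_cases h : m = j - 1
    · have : m + 1 = j := by omega
      rw [this, hbj, if_pos h]; ring
    · rw [hb _ (by omega), if_neg h]; ring
  have hder : PowerSeries.derivative ℂ F = PowerSeries.mk (fun m => b' (m + 1)) * F := by
    rw [hF, Derivation.leibniz, derivative_mk_cycleIndex, derivative_mk_expCoeff hj, hB]
    simp only [smul_eq_mul]
    ring
  clear_value F
  rw [← hcoeff]
  refine (eq_cycleIndex b' (fun n => PowerSeries.coeff n F) ?_ (fun n => ?_) n).symm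
  · simp [hcoeff, expCoeff]
  · cases n with
    | zero => simp
    | succ n =>
      have h1 := congrArg (PowerSeries.coeff n) hder
      rw [PowerSeries.coeff_derivative, PowerSeries.coeff_mul,
        Finset.Nat.sum_antidiagonal_eq_sum_range_succ_mk] at h1
      simp only [PowerSeries.coeff_mk] at h1
      push_cast
      rw [mul_comm, h1]
      refine Finset.sum_nbij' (fun k => k + 1) (fun m => m - 1) ?_ ?_ ?_ ?_ ?_ <;>
        simp only [Finset.mem_Icc, Finset.mem_range]
      · intros; omega
      · intros; omega
      · intros; omega
      · intros; omega
      · intro m hm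
        rw [show n + 1 - (m + 1) = n - m by omega]

/-- Dominated convergence in the convolution of `cycleIndex_update`: for fixed `i` the ratio
`ewensNorm θ (N - i) / ewensNorm θ N` tends to `1`, so the limit is `L` times the sum of the
coefficients of `exp (δ z^j / j)`. -/
theorem tendsto_cycleIndex_update {θ : ℝ} (hθ : 0 < θ) {b b' : ℕ → ℂ} (hb : ∀ m, ‖b m‖ ≤ θ)
    {j : ℕ} (hj : j ≠ 0) {δ : ℂ} (hbj : b' j = b j + δ) (hne : ∀ m, m ≠ j → b' m = b m) {L : ℂ}
    (hL : Tendsto (fun N => cycleIndex b N / ewensNorm θ N) atTop (𝓝 L)) :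
    Tendsto (fun N => cycleIndex b' N / ewensNorm θ N) atTop (𝓝 (Complex.exp (δ / j) * L)) := by
  set f : ℕ → ℕ → ℂ := fun N i =>
    if i ≤ N then expCoeff j δ i * (cycleIndex b (N - i) / ewensNorm θ N) else 0 with hf
  have h1 : ∀ N, ∑' i, f N i = cycleIndex b' N / ewensNorm θ N := by
    intro N
    rw [cycleIndex_update hj hbj hne, Finset.sum_div, tsum_eq_sum (s := Finset.range (N + 1))]
    · refine Finset.sum_congr rfl fun i hi => ?_
      have : i ≤ N := by simpa [Nat.lt_succ_iff] using hi
      simp [hf, this, mul_div_assoc]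
    · intro i hi
      have : ¬ i ≤ N := by simpa [Nat.lt_succ_iff] using hi
      simp [hf, this]
  have h2 : ∑' i, expCoeff j δ i * L = Complex.exp (δ / j) * L := by
    have := (hasSum_expCoeff_mul_pow hj δ 1).mul_right L
    simpa using this.tsum_eq
  rw [← h2]
  simp_rw [← h1]
  -- The norms of the coefficients are those for the weight `‖δ‖`, so the power series converges
  -- absolutely at `1 + θ⁻¹`.
  have hsum : Summable fun i => ‖expCoeff j δ i‖ * (1 + θ⁻¹) ^ i := by
    have := (hasSum_expCoeff_mul_pow hj (‖δ‖ : ℂ) ((1 + θ⁻¹ : ℝ) : ℂ)).summable.norm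
    refine this.congr fun i => ?_
    rw [norm_mul, ← norm_expCoeff, norm_pow, Complex.norm_real, Real.norm_of_nonneg]
    positivity
  refine tendsto_tsum_of_dominated_convergence hsum (fun i => ?_) (Eventually.of_forall fun N i => ?_)
  · have h3 : Tendsto (fun N => expCoeff j δ i * ((cycleIndex b (N - i) / ewensNorm θ (N - i)) *
        ((ewensNorm θ (N - i) / ewensNorm θ N : ℝ) : ℂ))) atTop (𝓝 (expCoeff j δ i * (L * (1 : ℝ)))) :=
      ((hL.comp (tendsto_sub_atTop_nat i)).mul
        ((Complex.continuous_ofReal.tendsto _).comp (tendsto_ewensNorm_sub_div hθ i))).const_mul _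
    rw [Complex.ofReal_one, mul_one] at h3
    refine h3.congr' ?_
    filter_upwards [eventually_ge_atTop i] with N hN
    simp only [hf, if_pos hN]
    have := ewensNorm_pos hθ (N - i)
    push_cast
    rw [div_mul_div_cancel₀ (by exact_mod_cast this.ne')]
  · simp only [hf]
    split_ifs with hi
    · rw [norm_mul, norm_div, Complex.norm_real, Real.norm_of_nonneg (ewensNorm_pos hθ N).le]
      refine mul_le_mul_of_nonneg_left ?_ (norm_nonneg _)
      rw [div_le_iff₀ (ewensNorm_pos hθ N)]
      exact (norm_cycleIndex_le b hb _).trans (ewensNorm_sub_le hθ hi)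
    · rw [norm_zero]; positivity

/-- The Poisson limit for finitely many cycle lengths, obtained by switching on the weights one at a
time. -/
theorem tendsto_cycleIndex_div {θ : ℝ} (hθ : 0 < θ) (n : ℕ) (a : ℕ → ℂ) (ha : ∀ m, ‖a m‖ ≤ 1)
    (han : ∀ m, n < m → a m = 1) :
    Tendsto (fun N => cycleIndex (fun m => θ * a m) N / ewensNorm θ N) atTop
      (𝓝 (Complex.exp (θ * ∑ m ∈ Finset.Icc 1 n, (a m - 1) / m))) := by
  induction n generalizing a with
  | zero =>
    have : ∀ N, cycleIndex (fun m => θ * a m) N = ewensNorm θ N := by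
      intro N
      rw [← cycleIndex_const]
      refine cycleIndex_congr fun m hm => ?_
      rw [han m (by have := (Finset.mem_Icc.1 hm).1; omega), mul_one]
    simp only [this]
    simp only [Finset.Icc_eq_empty_of_lt zero_lt_one, Finset.sum_empty, mul_zero, Complex.exp_zero]
    refine tendsto_const_nhds.congr fun N => ?_
    rw [div_self]
    exact_mod_cast (ewensNorm_pos hθ N).ne'
  | succ n ih =>
    -- Resetting the weight `n + 1` to `1` returns to the induction hypothesis.
    set a' := Function.update a (n + 1) 1 with ha'
    have h1 : ∀ m, ‖a' m‖ ≤ 1 := by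
      intro m
      by_cases h : m = n + 1
      · simp [ha', h]
      · simpa [ha', h] using ha m
    have h2 := ih a' h1 fun m hm => by
      by_cases h : m = n + 1
      · simp [ha', h]
      · simpa [ha', h] using han m (by omega)
    have h3 := tendsto_cycleIndex_update (b' := fun m => θ * a m) hθ (j := n + 1)
      (δ := θ * (a (n + 1) - 1)) (fun m => ?_) (by omega)
      (by simp [ha']; ring) (fun m hm => by simp [ha', hm]) h2
    · convert h3 using 2
      rw [← Complex.exp_add, Finset.sum_Icc_succ_top (by omega)]
      congr 1
      rw [mul_add, add_comm]
      congr 1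
      · ring
      · congr 1
        refine Finset.sum_congr rfl fun m hm => ?_
        have : m ≠ n + 1 := by have := (Finset.mem_Icc.1 hm).2; omega
        simp [ha', this]
    · rw [norm_mul, Complex.norm_real, Real.norm_of_nonneg hθ.le]
      exact mul_le_of_le_one_right hθ.le (h1 m)

/-! ### Comparison of the Ewens cycle index with its Poisson limit -/

/-- The probability that the cycle containing a given element of an Ewens permutation of `N`
elements has length `m`. -/
noncomputable def cycleProb (θ : ℝ) (N m : ℕ) : ℝ := θ / N * (ewensNorm θ (N - m) / ewensNorm θ N)

/-- The expected number of complete `m`-spacings in the Feller coupling at time `N`. -/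
noncomputable def fellerMean (θ : ℝ) (N m : ℕ) : ℝ :=
  θ * (ewensNorm θ (N - m) / ewensNorm θ N) * (1 / m - 1 / N)

/-- The weight of the length `m` in the comparison of an Ewens permutation of `n` elements with
its Poisson limit. -/
noncomputable def compWeight (θ : ℝ) (n m : ℕ) : ℝ :=
  cycleProb θ n m + (θ / m - fellerMean θ n m)

theorem cycleProb_nonneg {θ : ℝ} (hθ : 0 < θ) (N m : ℕ) : 0 ≤ cycleProb θ N m := by
  have h1 := ewensNorm_pos hθ N
  have h2 := ewensNorm_pos hθ (N - m)
  unfold cycleProb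
  positivity

theorem sum_cycleProb {θ : ℝ} (hθ : 0 < θ) {n : ℕ} (hn : n ≠ 0) :
    ∑ m ∈ Finset.Icc 1 n, cycleProb θ n m = 1 := by
  have h1 := ewensNorm_pos hθ n
  have h2 : (n : ℝ) ≠ 0 := by exact_mod_cast hn
  unfold cycleProb
  rw [← Finset.mul_sum, ← Finset.sum_div, sum_Icc_sub (fun k => ewensNorm θ k)]
  have := mul_sum_ewensNorm θ n
  field_simp
  linarith

/-- The increments of `fellerMean` are exactly the bounds obtained for the increments of `u` in
`norm_cycleIndex_sub_exp_le`, so those bounds telescope. -/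
theorem fellerMean_succ_sub {θ : ℝ} (hθ : 0 < θ) {N m : ℕ} (hm : 1 ≤ m) (hmN : m ≤ N) :
    fellerMean θ (N + 1) m - fellerMean θ N m = θ / (θ + N) * cycleProb θ N m := by
  have h1 := ewensNorm_pos hθ N
  have h2 := ewensNorm_pos hθ (N - m)
  obtain ⟨k, rfl⟩ := Nat.exists_eq_add_of_le hmN
  unfold fellerMean cycleProb
  rw [show m + k + 1 - m = k + 1 by omega, show m + k - m = k by omega, ewensNorm_succ,
    ewensNorm_succ]
  have h3 := ewensNorm_pos hθ k
  have h5 : (0 : ℝ) < m := by exact_mod_cast hm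
  have h4 : (0 : ℝ) < θ + ((m + k : ℕ) : ℝ) := by positivity
  push_cast at h4 ⊢
  have h6 : (0 : ℝ) < m + k := by positivity
  have h7 : (0 : ℝ) < (m : ℝ) + k + 1 := by positivity
  have h8 : (0 : ℝ) < (k : ℝ) + 1 := by positivity
  field_simp
  ring

theorem tendsto_cycleProb {θ : ℝ} (hθ : 0 < θ) (m : ℕ) :
    Tendsto (fun N => cycleProb θ N m) atTop (𝓝 0) := by
  have h1 : Tendsto (fun N : ℕ => θ / (N : ℝ)) atTop (𝓝 0) :=
    tendsto_const_nhds.div_atTop tendsto_natCast_atTop_atTop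
  have h2 := h1.mul (tendsto_ewensNorm_sub_div hθ m)
  rwa [zero_mul] at h2

theorem tendsto_fellerMean {θ : ℝ} (hθ : 0 < θ) (m : ℕ) :
    Tendsto (fun N => fellerMean θ N m) atTop (𝓝 (θ / m)) := by
  have h1 : Tendsto (fun N : ℕ => (1 : ℝ) / m - 1 / (N : ℝ)) atTop (𝓝 (1 / m - 0)) :=
    tendsto_const_nhds.sub (tendsto_const_nhds.div_atTop tendsto_natCast_atTop_atTop)
  have h2 := ((tendsto_ewensNorm_sub_div hθ m).const_mul θ).mul h1
  simpa [fellerMean, div_eq_mul_inv] using h2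

/-- The exponential is the limit, as `N` grows, of the normalized cycle index with the weights
truncated at `n`. The distance from time `n` to infinity is followed through an auxiliary sequence
`u`, in which the cycle through a marked element carries no factor `a_m`. The step from `g` to `u`
costs `cycleProb θ n m`, and the total variation of `u` after time `n` costs `θ / m - fellerMean θ n
m`. -/
theorem norm_cycleIndex_sub_exp_le {θ : ℝ} (hθ : 0 < θ) {n : ℕ} (hn : n ≠ 0) (a : ℕ → ℂ)
    (ha : ∀ m, ‖a m‖ ≤ 1) :
    ‖cycleIndex (fun m => θ * a m) n / ewensNorm θ n -
      Complex.exp (θ * ∑ m ∈ Finset.Icc 1 n, (a m - 1) / m)‖ ≤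
      ∑ m ∈ Finset.Icc 1 n, ‖a m - 1‖ * compWeight θ n m := by
  -- The truncation does not affect the cycle index at `n`, and it leaves only finitely many
  -- nontrivial weights, so that `tendsto_cycleIndex_div` applies.
  set a' : ℕ → ℂ := fun m => if m ≤ n then a m else 1 with ha'
  have ha1 : ∀ m, ‖a' m‖ ≤ 1 := fun m => by
    simp only [ha']; split_ifs
    · exact ha m
    · simp
  have ha2 : ∀ m ∈ Finset.Icc 1 n, a' m = a m := fun m hm => by
    simp [ha', (Finset.mem_Icc.1 hm).2]
  have ha3 : ∀ m, n < m → a' m = 1 := fun m hm => by simp [ha', hm]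
  set G : ℕ → ℂ := cycleIndex (fun m => θ * a' m) with hG
  set g : ℕ → ℂ := fun N => G N / ewensNorm θ N with hg
  -- This is the recursion for `g N` with each `a' m` replaced by `1`.
  set u : ℕ → ℂ := fun N => θ * (∑ k ∈ Finset.range N, G k) / (N * ewensNorm θ N) with hu
  set L : ℂ := Complex.exp (θ * ∑ m ∈ Finset.Icc 1 n, (a m - 1) / m) with hL
  have hGle : ∀ N, ‖G N‖ ≤ ewensNorm θ N := fun N =>
    norm_cycleIndex_le _ (fun m => by
      rw [norm_mul, Complex.norm_real, Real.norm_of_nonneg hθ.le]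
      exact mul_le_of_le_one_right hθ.le (ha1 m)) N
  have hgL : Tendsto g atTop (𝓝 L) := by
    have := tendsto_cycleIndex_div hθ n a' ha1 ha3
    rwa [Finset.sum_congr rfl fun m hm => by rw [ha2 m hm]] at this
  have hgn : g n = cycleIndex (fun m => θ * a m) n / ewensNorm θ n := by
    simp only [hg, hG]
    rw [cycleIndex_congr fun m hm => by rw [ha2 m hm]]
  have hgu : ∀ N, n ≤ N → ‖g N - u N‖ ≤ ∑ m ∈ Finset.Icc 1 n, ‖a m - 1‖ * cycleProb θ N m := by
    intro N hN
    have hN0 : (N : ℂ) ≠ 0 := by exact_mod_cast (by omega : N ≠ 0)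
    have hω := ewensNorm_pos hθ N
    have hω' : (ewensNorm θ N : ℂ) ≠ 0 := by exact_mod_cast hω.ne'
    have h1 : g N - u N = ∑ m ∈ Finset.Icc 1 N,
        (a' m - 1) * (θ / N * (G (N - m) / ewensNorm θ N)) := by
      have h2 := mul_cycleIndex (fun m => θ * a' m) N
      rw [← hG] at h2
      have h3 : g N = (N * G N) / (N * ewensNorm θ N) := by
        simp only [hg]; field_simp
      rw [h3, h2]
      simp only [hu]
      rw [← sum_Icc_sub G, ← sub_div, Finset.mul_sum, ← Finset.sum_sub_distrib, Finset.sum_div]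
      refine Finset.sum_congr rfl fun m _ => ?_
      field_simp
    have h4 : ∑ m ∈ Finset.Icc 1 n, (a' m - 1) * (θ / N * (G (N - m) / ewensNorm θ N)) =
        ∑ m ∈ Finset.Icc 1 N, (a' m - 1) * (θ / N * (G (N - m) / ewensNorm θ N)) := by
      refine Finset.sum_subset (Finset.Icc_subset_Icc_right hN) fun m hm hm' => ?_
      rw [ha3 m (by simp only [Finset.mem_Icc] at hm hm'; omega)]
      simp
    rw [h1, ← h4]
    refine (norm_sum_le _ _).trans (Finset.sum_le_sum fun m hm => ?_)
    rw [norm_mul, ha2 m hm]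
    refine mul_le_mul_of_nonneg_left ?_ (norm_nonneg _)
    rw [norm_mul, norm_div, norm_div, Complex.norm_real, Complex.norm_real,
      Real.norm_of_nonneg hθ.le, Real.norm_of_nonneg hω.le, Complex.norm_natCast, cycleProb]
    gcongr
    exact hGle _
  have husucc : ∀ N, n ≤ N → u (N + 1) - u N = θ / (θ + N) * (g N - u N) := by
    intro N hN
    have hN0 : (N : ℂ) ≠ 0 := by exact_mod_cast (by omega : N ≠ 0)
    have hω := ewensNorm_pos hθ N
    have hω' : (ewensNorm θ N : ℂ) ≠ 0 := by exact_mod_cast hω.ne'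
    have h5 : (θ + N : ℂ) ≠ 0 := by
      have : (0 : ℝ) < θ + N := by positivity
      exact_mod_cast this.ne'
    have h6 : (((N + 1 : ℕ) : ℂ) * (ewensNorm θ (N + 1) : ℂ)) = (θ + N) * ewensNorm θ N := by
      exact_mod_cast succ_mul_ewensNorm_succ θ N
    simp only [hu, hg]
    rw [h6, Finset.sum_range_succ]
    field_simp
    ring
  have hcoef : ∀ N : ℕ, ‖(θ / (θ + N) : ℂ)‖ = θ / (θ + N) := by
    intro N
    have : (θ / (θ + N) : ℂ) = ((θ / (θ + N) : ℝ) : ℂ) := by push_cast; rfl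
    rw [this, Complex.norm_real, Real.norm_of_nonneg (by positivity)]
  have hdist : ∀ N, n ≤ N → ‖u N - u n‖ ≤
      ∑ m ∈ Finset.Icc 1 n, ‖a m - 1‖ * (fellerMean θ N m - fellerMean θ n m) := by
    intro N hN
    induction N, hN using Nat.le_induction with
    | base => simp
    | succ N hN ih =>
      have h1 : u (N + 1) - u n = (u (N + 1) - u N) + (u N - u n) := by ring
      rw [h1]
      refine (norm_add_le _ _).trans ?_
      have h2 : ‖u (N + 1) - u N‖ ≤ ∑ m ∈ Finset.Icc 1 n,
          ‖a m - 1‖ * (fellerMean θ (N + 1) m - fellerMean θ N m) := by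
        rw [husucc N hN, norm_mul, hcoef]
        calc θ / (θ + N) * ‖g N - u N‖
            ≤ θ / (θ + N) * ∑ m ∈ Finset.Icc 1 n, ‖a m - 1‖ * cycleProb θ N m :=
              mul_le_mul_of_nonneg_left (hgu N hN) (by positivity)
          _ = _ := by
              rw [Finset.mul_sum]
              refine Finset.sum_congr rfl fun m hm => ?_
              obtain ⟨hm1, hm2⟩ := Finset.mem_Icc.1 hm
              rw [fellerMean_succ_sub hθ hm1 (hm2.trans hN)]
              ring
      refine (add_le_add h2 ih).trans (le_of_eq ?_)
      rw [← Finset.sum_add_distrib]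
      exact Finset.sum_congr rfl fun m _ => by ring
  have hguz : Tendsto (fun N => g N - u N) atTop (𝓝 0) := by
    have h1 : Tendsto (fun N => ∑ m ∈ Finset.Icc 1 n, ‖a m - 1‖ * cycleProb θ N m) atTop
        (𝓝 (∑ m ∈ Finset.Icc 1 n, ‖a m - 1‖ * 0)) :=
      tendsto_finsetSum _ fun m _ => (tendsto_cycleProb hθ m).const_mul _
    simp only [mul_zero, Finset.sum_const_zero] at h1
    refine squeeze_zero_norm' ?_ h1
    filter_upwards [eventually_ge_atTop n] with N hN using hgu N hN
  have huL : Tendsto u atTop (𝓝 L) := by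
    have := hgL.sub hguz
    simpa using this
  have hfin : ‖L - u n‖ ≤ ∑ m ∈ Finset.Icc 1 n, ‖a m - 1‖ * (θ / m - fellerMean θ n m) := by
    refine le_of_tendsto_of_tendsto (huL.sub_const (u n)).norm
      (tendsto_finsetSum _ fun m _ => (((tendsto_fellerMean hθ m).sub_const _).const_mul _)) ?_
    filter_upwards [eventually_ge_atTop n] with N hN using hdist N hN
  rw [← hgn]
  have h1 : g n - L = (g n - u n) - (L - u n) := by ring
  rw [h1]
  refine (norm_sub_le _ _).trans ((add_le_add (hgu n le_rfl) hfin).trans (le_of_eq ?_))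
  rw [← Finset.sum_add_distrib]
  exact Finset.sum_congr rfl fun m _ => by rw [compWeight]; ring

theorem compWeight_eq {θ : ℝ} (n m : ℕ) :
    compWeight θ n m =
      θ / m * (1 - ewensNorm θ (n - m) / ewensNorm θ n) + 2 * cycleProb θ n m := by
  unfold compWeight fellerMean cycleProb
  ring

theorem antitone_ewensNorm {θ : ℝ} (hθ : 0 < θ) (h1 : θ ≤ 1) : Antitone (ewensNorm θ) := by
  refine antitone_nat_of_succ_le fun n => ?_
  rw [ewensNorm_succ]
  have : (θ + n) / (n + 1 : ℝ) ≤ 1 := by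
    rw [div_le_one (by positivity)]; linarith
  exact mul_le_of_le_one_right (ewensNorm_pos hθ n).le this

theorem monotone_ewensNorm {θ : ℝ} (h1 : 1 ≤ θ) : Monotone (ewensNorm θ) := by
  refine monotone_nat_of_le_succ fun n => ?_
  rw [ewensNorm_succ]
  have : 1 ≤ (θ + n) / (n + 1 : ℝ) := by
    rw [le_div_iff₀ (by positivity)]; linarith
  exact le_mul_of_one_le_right (ewensNorm_pos (by linarith) n).le this

/-- For `θ ≤ 1` the norm is decreasing, so the first term in `compWeight_eq` is not positive. -/
theorem compWeight_le_of_le_one {θ : ℝ} (hθ : 0 < θ) (h1 : θ ≤ 1) (n m : ℕ) :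
    compWeight θ n m ≤ 2 * cycleProb θ n m := by
  rw [compWeight_eq]
  have h2 : 1 ≤ ewensNorm θ (n - m) / ewensNorm θ n := by
    rw [le_div_iff₀ (ewensNorm_pos hθ n), one_mul]
    exact antitone_ewensNorm hθ h1 (Nat.sub_le _ _)
  have h3 : 0 ≤ θ / m := by positivity
  nlinarith

/-- Each of the `j` factors `1 - (θ - 1) / (θ + i)`, with `i ≥ k + 1`, loses at most `(θ - 1) / (k +
1)`. -/
theorem one_sub_ewensNorm_div_le {θ : ℝ} (h1 : 1 ≤ θ) (j k : ℕ) :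
    1 - ewensNorm θ (k + 1) / ewensNorm θ (k + 1 + j) ≤ j * (θ - 1) / (k + 1) := by
  have hθ : 0 < θ := by linarith
  induction j with
  | zero => simp [(ewensNorm_pos hθ (k + 1)).ne']
  | succ j ih =>
    have h2 : ewensNorm θ (k + 1) / ewensNorm θ (k + 1 + j) ≤ 1 := by
      rw [div_le_one (ewensNorm_pos hθ _)]
      exact monotone_ewensNorm h1 (by omega)
    have h3 : ewensNorm θ (k + 1) / ewensNorm θ (k + 1 + (j + 1)) =
        ewensNorm θ (k + 1) / ewensNorm θ (k + 1 + j) * (1 - (θ - 1) / (θ + (k + 1 + j : ℕ))) := by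
      rw [← add_assoc, ewensNorm_succ θ (k + 1 + j)]
      have := ewensNorm_pos hθ (k + 1 + j)
      have h4 : 0 < θ + (k + 1 + j : ℕ) := by positivity
      field_simp
      push_cast
      ring
    have h4 : (θ - 1) / (θ + (k + 1 + j : ℕ)) ≤ (θ - 1) / (k + 1) := by
      apply div_le_div_of_nonneg_left (by linarith) (by positivity)
      push_cast
      have : (0 : ℝ) ≤ j := by positivity
      linarith
    have h5 : 0 ≤ (θ - 1) / (θ + (k + 1 + j : ℕ)) := div_nonneg (by linarith) (by positivity)
    rw [h3]
    push_cast at h4 h5 ⊢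
    rw [show ((j : ℝ) + 1) * (θ - 1) / (k + 1) = j * (θ - 1) / (k + 1) + (θ - 1) / (k + 1) by ring]
    nlinarith

theorem compWeight_le_of_one_le {θ : ℝ} (h1 : 1 ≤ θ) {n m : ℕ} (hm : 1 ≤ m) (hmn : m ≤ n) :
    compWeight θ n m ≤ 4 * θ ^ 2 / n := by
  have hθ : 0 < θ := by linarith
  have hn : (0 : ℝ) < n := by exact_mod_cast (by omega : 0 < n)
  have hm' : (0 : ℝ) < m := by exact_mod_cast hm
  rw [compWeight_eq]
  have h2 : ewensNorm θ (n - m) / ewensNorm θ n ≤ 1 := by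
    rw [div_le_one (ewensNorm_pos hθ _)]
    exact monotone_ewensNorm h1 (by omega)
  have h0 : 0 ≤ ewensNorm θ (n - m) / ewensNorm θ n :=
    div_nonneg (ewensNorm_pos hθ _).le (ewensNorm_pos hθ _).le
  have h3 : cycleProb θ n m ≤ θ / n := by
    unfold cycleProb
    exact mul_le_of_le_one_right (by positivity) h2
  have h4 : 1 - ewensNorm θ (n - m) / ewensNorm θ n ≤ 2 * θ * m / n := by
    -- For `n ≤ 2m` the right side is at least `1`. Otherwise `k + 1 = n - m` exceeds `n / 2` and
    -- the linear bound applies.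
    rcases le_or_gt n (2 * m) with h | h
    · have h5 : (n : ℝ) ≤ 2 * m := by exact_mod_cast h
      have : 1 ≤ 2 * θ * m / n := by
        rw [le_div_iff₀ hn]; nlinarith
      linarith
    · obtain ⟨k, rfl⟩ : ∃ k, n = k + 1 + m := ⟨n - m - 1, by omega⟩
      rw [Nat.add_sub_cancel]
      refine (one_sub_ewensNorm_div_le h1 m k).trans ?_
      rw [div_le_div_iff₀ (by positivity) hn]
      have h6 : (m : ℝ) ≤ k + 1 := by exact_mod_cast (by omega : m ≤ k + 1)
      push_cast
      nlinarith [mul_nonneg hm'.le hθ.le, mul_nonneg hm'.le (sub_nonneg.2 h6),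
        mul_nonneg (mul_nonneg hm'.le hθ.le) (sub_nonneg.2 h6)]
  have h5 : θ / m * (1 - ewensNorm θ (n - m) / ewensNorm θ n) ≤ θ / m * (2 * θ * m / n) :=
    mul_le_mul_of_nonneg_left h4 (by positivity)
  have h6 : θ / m * (2 * θ * m / n) = 2 * θ ^ 2 / n := by field_simp
  have h7 : θ / n ≤ θ ^ 2 / n := by gcongr; nlinarith
  calc _ ≤ 2 * θ ^ 2 / n + 2 * (θ ^ 2 / n) := by linarith
    _ = _ := by ring

/-! ### Summation by parts -/

/-- Abel summation: the increments of `p` are nonnegative and telescope, each multiplied by a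
partial sum of size at most `D`. -/
theorem abs_sum_mul_sub_le_of_monotone {p b : ℕ → ℝ} (hp : Monotone p) {D : ℝ} {R : ℕ}
    (hD : ∀ M ≤ R, |∑ m ∈ Finset.Icc 1 M, b m| ≤ D) :
    |∑ m ∈ Finset.Icc 1 R, p m * b m - p R * ∑ m ∈ Finset.Icc 1 R, b m| ≤ (p R - p 0) * D := by
  induction R with
  | zero => simp
  | succ R ih =>
    have h1 := ih fun M hM => hD M (by omega)
    have h2 := hD R (by omega)
    have h3 : 0 ≤ p (R + 1) - p R := sub_nonneg.2 (hp (Nat.le_succ R))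
    rw [Finset.sum_Icc_succ_top (by omega), Finset.sum_Icc_succ_top (by omega)]
    have h4 : ∑ m ∈ Finset.Icc 1 R, p m * b m + p (R + 1) * b (R + 1) -
        p (R + 1) * (∑ m ∈ Finset.Icc 1 R, b m + b (R + 1)) =
        (∑ m ∈ Finset.Icc 1 R, p m * b m - p R * ∑ m ∈ Finset.Icc 1 R, b m) -
          (p (R + 1) - p R) * ∑ m ∈ Finset.Icc 1 R, b m := by ring
    rw [h4]
    refine (abs_sub _ _).trans ?_
    rw [abs_mul, abs_of_nonneg h3]
    nlinarith [mul_le_mul_of_nonneg_left h2 h3]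

theorem abs_sum_mul_le_of_monotone {p b : ℕ → ℝ} (hp : Monotone p) (hp0 : 0 ≤ p 0) {D : ℝ} {R : ℕ}
    (hD : ∀ M ≤ R, |∑ m ∈ Finset.Icc 1 M, b m| ≤ D) :
    |∑ m ∈ Finset.Icc 1 R, p m * b m| ≤ 2 * p R * D := by
  have h1 := abs_sum_mul_sub_le_of_monotone hp hD
  have h2 := hD R le_rfl
  have hpR : 0 ≤ p R := hp0.trans (hp (Nat.zero_le R))
  have h3 : |p R * ∑ m ∈ Finset.Icc 1 R, b m| ≤ p R * D := by
    rw [abs_mul, abs_of_nonneg hpR]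
    exact mul_le_mul_of_nonneg_left h2 hpR
  have h4 := abs_sub_abs_le_abs_sub (∑ m ∈ Finset.Icc 1 R, p m * b m)
    (p R * ∑ m ∈ Finset.Icc 1 R, b m)
  have hD0 : 0 ≤ D := (abs_nonneg _).trans h2
  nlinarith [mul_nonneg hp0 hD0]

theorem sum_div_eq (b : ℕ → ℝ) (n : ℕ) :
    ∑ m ∈ Finset.Icc 1 n, b m / m = (∑ m ∈ Finset.Icc 1 n, b m) / (n + 1) +
      ∑ m ∈ Finset.Icc 1 n, (∑ k ∈ Finset.Icc 1 m, b k) / (m * (m + 1)) := by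
  induction n with
  | zero => simp
  | succ n ih =>
    rw [Finset.sum_Icc_succ_top (by omega), ih, Finset.sum_Icc_succ_top (by omega),
      Finset.sum_Icc_succ_top (b := n) (f := fun m : ℕ => (∑ k ∈ Finset.Icc 1 m, b k) / (m * (m + 1)))
        (by omega), Finset.sum_Icc_succ_top (by omega)]
    push_cast
    have : (n : ℝ) + 1 ≠ 0 := by positivity
    have : (n : ℝ) + 1 + 1 ≠ 0 := by positivity
    field_simp
    ring

/-- Abel summation against `1 / m`: the partial sums enter divided by `m (m + 1)`, and `∑ m ^ (-1 -
δ)` converges. -/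
theorem exists_abs_sum_div_le {b : ℕ → ℝ} {C δ : ℝ} (hδ : 0 < δ)
    (hb : ∀ M : ℕ, 1 ≤ M → |∑ m ∈ Finset.Icc 1 M, b m| ≤ C * (M : ℝ) ^ (1 - δ)) :
    ∃ K, ∀ n : ℕ, |∑ m ∈ Finset.Icc 1 n, b m / m| ≤ K := by
  have hC : 0 ≤ C := by
    have := hb 1 le_rfl
    simp only [Nat.cast_one, Real.one_rpow, mul_one] at this
    exact (abs_nonneg _).trans this
  have hsum : Summable fun m : ℕ => C * (m : ℝ) ^ (-1 - δ) :=
    (Real.summable_nat_rpow.2 (by linarith)).mul_left C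
  refine ⟨C + ∑' m : ℕ, C * (m : ℝ) ^ (-1 - δ), fun n => ?_⟩
  have hpos : ∀ m : ℕ, 0 ≤ C * (m : ℝ) ^ (-1 - δ) := fun m =>
    mul_nonneg hC (Real.rpow_nonneg (Nat.cast_nonneg _) _)
  rw [sum_div_eq]
  refine (abs_add_le _ _).trans (add_le_add ?_ ?_)
  · rcases Nat.eq_zero_or_pos n with rfl | hn
    · simpa using hC
    · have hn' : (1 : ℝ) ≤ n := by exact_mod_cast hn
      rw [abs_div, abs_of_nonneg (by positivity : (0 : ℝ) ≤ n + 1), div_le_iff₀ (by positivity)]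
      refine (hb n hn).trans (mul_le_mul_of_nonneg_left ?_ hC)
      calc (n : ℝ) ^ (1 - δ) ≤ (n : ℝ) ^ (1 : ℝ) :=
            Real.rpow_le_rpow_of_exponent_le hn' (by linarith)
        _ ≤ n + 1 := by rw [Real.rpow_one]; linarith
  · refine (Finset.abs_sum_le_sum_abs _ _).trans ?_
    refine (Finset.sum_le_sum fun m hm => ?_).trans (hsum.sum_le_tsum _ fun m _ => hpos m)
    have hm1 := (Finset.mem_Icc.1 hm).1
    have hm' : (0 : ℝ) < m := by exact_mod_cast hm1
    rw [abs_div, abs_of_nonneg (by positivity : (0 : ℝ) ≤ m * (m + 1)), div_le_iff₀ (by positivity)]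
    refine (hb m hm1).trans ?_
    rw [mul_assoc]
    refine mul_le_mul_of_nonneg_left ?_ hC
    calc (m : ℝ) ^ (1 - δ) = (m : ℝ) ^ (-1 - δ) * (m : ℝ) ^ (2 : ℝ) := by
          rw [← Real.rpow_add hm']; congr 1; ring
      _ ≤ (m : ℝ) ^ (-1 - δ) * (m * (m + 1)) := by
          refine mul_le_mul_of_nonneg_left ?_ (Real.rpow_nonneg hm'.le _)
          rw [Real.rpow_two]; nlinarith

/-! ### Weighted sums over cycle lengths -/

/-- In other words `k ^ (1 - θ) * ewensNorm θ k` is nondecreasing in `k ≥ 1`. The step is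
Bernoulli's inequality `(1 + 1 / n) ^ θ ≤ 1 + θ / n`, which requires `θ ≤ 1`. -/
theorem mul_ewensNorm_mul_rpow_le {θ : ℝ} (hθ : 0 < θ) (h1 : θ ≤ 1) {k n : ℕ} (hk : 1 ≤ k)
    (hkn : k ≤ n) :
    k * ewensNorm θ k * (n : ℝ) ^ θ ≤ n * ewensNorm θ n * (k : ℝ) ^ θ := by
  induction n, hkn using Nat.le_induction with
  | base => exact le_rfl
  | succ n hn ih =>
    have hn' : (0 : ℝ) < n := by exact_mod_cast (by omega : 0 < n)
    have h2 : ((n + 1 : ℕ) : ℝ) ^ θ ≤ (n : ℝ) ^ θ * (1 + θ / n) := by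
      have h3 : ((n + 1 : ℕ) : ℝ) = n * (1 + 1 / n) := by push_cast; field_simp
      rw [h3, Real.mul_rpow hn'.le (by positivity)]
      refine mul_le_mul_of_nonneg_left ?_ (by positivity)
      have := rpow_one_add_le_one_add_mul_self (s := 1 / (n : ℝ)) (by
        have : (0 : ℝ) ≤ 1 / n := by positivity
        linarith) hθ.le h1
      simpa [div_eq_mul_inv] using this
    have h3 := succ_mul_ewensNorm_succ θ n
    have hk0 : 0 ≤ k * ewensNorm θ k := mul_nonneg (Nat.cast_nonneg _) (ewensNorm_pos hθ k).le
    calc k * ewensNorm θ k * ((n + 1 : ℕ) : ℝ) ^ θ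
        ≤ k * ewensNorm θ k * ((n : ℝ) ^ θ * (1 + θ / n)) := mul_le_mul_of_nonneg_left h2 hk0
      _ = k * ewensNorm θ k * (n : ℝ) ^ θ * (1 + θ / n) := by ring
      _ ≤ n * ewensNorm θ n * (k : ℝ) ^ θ * (1 + θ / n) :=
          mul_le_mul_of_nonneg_right ih (by positivity)
      _ = ((n + 1 : ℕ) : ℝ) * ewensNorm θ (n + 1) * (k : ℝ) ^ θ := by
          push_cast
          rw [h3]
          field_simp
          ring

theorem sum_cycleProb_Ioc {θ : ℝ} {n B : ℕ} (hB : B ≤ n) :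
    ∑ m ∈ Finset.Ioc (n - B) n, cycleProb θ n m =
      B * ewensNorm θ B / (n * ewensNorm θ n) := by
  rw [← mul_sum_ewensNorm, Finset.mul_sum, Finset.sum_div]
  refine Finset.sum_nbij' (fun m => n - m) (fun k => n - k) ?_ ?_ ?_ ?_ ?_ <;>
    simp only [Finset.mem_Ioc, Finset.mem_range]
  · intros; omega
  · intros; omega
  · intros; omega
  · intros; omega
  · intros
    rw [cycleProb, div_mul_div_comm]

theorem monotone_cycleProb {θ : ℝ} (hθ : 0 < θ) (h1 : θ ≤ 1) (n : ℕ) :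
    Monotone (cycleProb θ n) := fun a b hab => by
  have := ewensNorm_pos hθ n
  unfold cycleProb
  gcongr
  exact antitone_ewensNorm hθ h1 (by omega)

/-- For `θ ≥ 1` the weights are `O(1 / n)`, and bounded averages of `H` are enough. For `θ ≤ 1` they
increase towards `m = n`. Away from the end, Abel summation uses the power saving; in the last
stretch the total weight is a negative power of `n`, which absorbs the logarithmic bound on `H`. -/
theorem exists_sum_mul_compWeight_le {θ : ℝ} (hθ : 0 < θ) {H : ℕ → ℝ} {A C δ : ℝ} (hδ : 0 < δ)
    (hδ1 : δ < 1)
    (hH0 : ∀ m, 0 ≤ H m) (hH : ∀ m : ℕ, 1 ≤ m → H m ≤ C * (1 + Real.log m))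
    (hA : ∀ M : ℕ, 1 ≤ M → |∑ m ∈ Finset.Icc 1 M, (H m - A)| ≤ C * (M : ℝ) ^ (1 - δ)) :
    ∃ K, ∀ n : ℕ, 1 ≤ n → ∑ m ∈ Finset.Icc 1 n, H m * compWeight θ n m ≤ K := by
  have hC : 0 ≤ C := by
    have := (hH0 1).trans (hH 1 le_rfl)
    simpa using this
  rcases le_total 1 θ with h1 | h1
  · refine ⟨4 * θ ^ 2 * (|A| + C), fun n hn => ?_⟩
    have hn' : (1 : ℝ) ≤ n := by exact_mod_cast hn
    have h2 : ∑ m ∈ Finset.Icc 1 n, H m ≤ (|A| + C) * n := by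
      have h3 := (le_abs_self _).trans (hA n hn)
      rw [Finset.sum_sub_distrib, Finset.sum_const, Nat.card_Icc, nsmul_eq_mul] at h3
      have h4 : (n : ℝ) ^ (1 - δ) ≤ n := by
        conv_rhs => rw [← Real.rpow_one (n : ℝ)]
        exact Real.rpow_le_rpow_of_exponent_le hn' (by linarith)
      have h5 := mul_le_mul_of_nonneg_left h4 hC
      have h6 : (n : ℝ) * A ≤ n * |A| := mul_le_mul_of_nonneg_left (le_abs_self A) (by linarith)
      simp only [Nat.add_sub_cancel] at h3
      linarith
    calc ∑ m ∈ Finset.Icc 1 n, H m * compWeight θ n m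
        ≤ ∑ m ∈ Finset.Icc 1 n, H m * (4 * θ ^ 2 / n) := Finset.sum_le_sum fun m hm => by
          obtain ⟨hm1, hm2⟩ := Finset.mem_Icc.1 hm
          exact mul_le_mul_of_nonneg_left (compWeight_le_of_one_le h1 hm1 hm2) (hH0 m)
      _ = (4 * θ ^ 2 / n) * ∑ m ∈ Finset.Icc 1 n, H m := by rw [← Finset.sum_mul, mul_comm]
      _ ≤ (4 * θ ^ 2 / n) * ((|A| + C) * n) := mul_le_mul_of_nonneg_left h2 (by positivity)
      _ = _ := by field_simp
  -- The last stretch will have weight at most `(2 n ^ (-δ)) ^ θ`, and this power beats the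
  -- logarithm.
  · obtain ⟨D, hD⟩ : ∃ D, ∀ n : ℕ, 1 ≤ n → (1 + Real.log n) * (2 * (n : ℝ) ^ (-δ)) ^ θ ≤ D := by
      have hδθ : 0 < δ * θ := mul_pos hδ hθ
      refine ⟨2 ^ θ * (1 + 1 / (δ * θ)), fun n hn => ?_⟩
      have hn' : (1 : ℝ) ≤ n := by exact_mod_cast hn
      have hn0 : (0 : ℝ) < n := by linarith
      rw [Real.mul_rpow (by norm_num) (by positivity), ← Real.rpow_mul hn0.le, mul_left_comm]
      refine mul_le_mul_of_nonneg_left ?_ (by positivity)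
      rw [neg_mul, Real.rpow_neg hn0.le, ← div_eq_mul_inv, div_le_iff₀ (by positivity)]
      have h2 := Real.log_le_rpow_div hn0.le hδθ
      have h3 : 1 ≤ (n : ℝ) ^ (δ * θ) := Real.one_le_rpow hn' hδθ.le
      rw [add_mul, one_mul, one_div, mul_comm _ ((n : ℝ) ^ (δ * θ)), ← div_eq_mul_inv]
      linarith
    refine ⟨2 * (|A| + 2 * C + C * D), fun n hn => ?_⟩
    have hn' : (1 : ℝ) ≤ n := by exact_mod_cast hn
    have hn0 : (0 : ℝ) < n := by linarith
    -- The length of the last stretch equals, up to rounding, the size `n ^ (1 - δ)` of the error in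
    -- the partial sums.
    set B := ⌈(n : ℝ) ^ (1 - δ)⌉₊ with hBdef
    have hpow1 : 1 ≤ (n : ℝ) ^ (1 - δ) := Real.one_le_rpow hn' (by linarith)
    have hBge : (n : ℝ) ^ (1 - δ) ≤ B := Nat.le_ceil _
    have hB1 : 1 ≤ B := by
      have : (1 : ℝ) ≤ B := hpow1.trans hBge
      exact_mod_cast this
    have hBn : B ≤ n := by
      refine Nat.ceil_le.2 ?_
      conv_rhs => rw [← Real.rpow_one (n : ℝ)]
      exact Real.rpow_le_rpow_of_exponent_le hn' (by linarith)
    have hBle : (B : ℝ) ≤ 2 * (n : ℝ) ^ (1 - δ) := by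
      have := Nat.ceil_lt_add_one (by positivity : 0 ≤ (n : ℝ) ^ (1 - δ))
      linarith
    have hB0 : (0 : ℝ) < B := by linarith
    have hω := ewensNorm_pos hθ n
    have hratio : B * ewensNorm θ B / (n * ewensNorm θ n) ≤ (2 * (n : ℝ) ^ (-δ)) ^ θ := by
      calc B * ewensNorm θ B / (n * ewensNorm θ n) ≤ (B : ℝ) ^ θ / (n : ℝ) ^ θ := by
            rw [div_le_div_iff₀ (by positivity) (by positivity)]
            have := mul_ewensNorm_mul_rpow_le hθ h1 hB1 hBn
            linarith
        _ = ((B : ℝ) / n) ^ θ := (Real.div_rpow hB0.le hn0.le _).symm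
        _ ≤ _ := by
            refine Real.rpow_le_rpow (by positivity) ?_ hθ.le
            rw [div_le_iff₀ hn0]
            refine hBle.trans (le_of_eq ?_)
            rw [mul_assoc]
            congr 1
            rw [show (1 : ℝ) - δ = -δ + 1 by ring, Real.rpow_add_one hn0.ne']
    have hratio1 : B * ewensNorm θ B / (n * ewensNorm θ n) ≤ 1 := by
      have h3 := mul_ewensNorm_mul_rpow_le hθ h1 hB1 hBn
      have h4 : (B : ℝ) ^ θ ≤ (n : ℝ) ^ θ :=
        Real.rpow_le_rpow hB0.le (by exact_mod_cast hBn) hθ.le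
      rw [div_le_one (by positivity)]
      have h5 : 0 < (n : ℝ) ^ θ := by positivity
      refine le_of_mul_le_mul_right (h3.trans ?_) h5
      exact mul_le_mul_of_nonneg_left h4 (by positivity)
    have hsplit : ∑ m ∈ Finset.Icc 1 n, H m * cycleProb θ n m =
        ∑ m ∈ Finset.Icc 1 (n - B), H m * cycleProb θ n m +
          ∑ m ∈ Finset.Ioc (n - B) n, H m * cycleProb θ n m := by
      rw [← Finset.sum_union]
      · congr 1
        ext m
        simp only [Finset.mem_Icc, Finset.mem_union, Finset.mem_Ioc]
        omega
      · rw [Finset.disjoint_left]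
        intro m hm hm'
        simp only [Finset.mem_Icc, Finset.mem_Ioc] at hm hm'
        omega
    have hfirst : ∑ m ∈ Finset.Icc 1 (n - B), H m * cycleProb θ n m ≤ |A| + 2 * C := by
      have h2 : ∑ m ∈ Finset.Icc 1 (n - B), H m * cycleProb θ n m =
          A * ∑ m ∈ Finset.Icc 1 (n - B), cycleProb θ n m +
            ∑ m ∈ Finset.Icc 1 (n - B), cycleProb θ n m * (H m - A) := by
        rw [Finset.mul_sum, ← Finset.sum_add_distrib]
        exact Finset.sum_congr rfl fun m _ => by ring
      rw [h2]
      refine add_le_add ?_ ?_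
      · have h3 : ∑ m ∈ Finset.Icc 1 (n - B), cycleProb θ n m ≤ 1 := by
          rw [← sum_cycleProb hθ (n := n) (by omega)]
          exact Finset.sum_le_sum_of_subset_of_nonneg (Finset.Icc_subset_Icc_right (Nat.sub_le _ _))
            fun m _ _ => cycleProb_nonneg hθ n m
        have h4 : 0 ≤ ∑ m ∈ Finset.Icc 1 (n - B), cycleProb θ n m :=
          Finset.sum_nonneg fun m _ => cycleProb_nonneg hθ n m
        calc A * _ ≤ |A| * ∑ m ∈ Finset.Icc 1 (n - B), cycleProb θ n m :=
              mul_le_mul_of_nonneg_right (le_abs_self A) h4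
          _ ≤ |A| * 1 := mul_le_mul_of_nonneg_left h3 (abs_nonneg A)
          _ = |A| := mul_one _
      · have h3 := abs_sum_mul_le_of_monotone (monotone_cycleProb hθ h1 n)
          (cycleProb_nonneg hθ n 0) (R := n - B) (b := fun m => H m - A)
          (D := C * (n : ℝ) ^ (1 - δ)) (fun M hM => by
            rcases Nat.eq_zero_or_pos M with rfl | hM0
            · simp only [Finset.Icc_eq_empty_of_lt zero_lt_one, Finset.sum_empty, abs_zero]
              positivity
            · refine (hA M hM0).trans (mul_le_mul_of_nonneg_left ?_ hC)
              exact Real.rpow_le_rpow (by positivity) (by exact_mod_cast (by omega : M ≤ n))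
                (by linarith))
        refine (le_abs_self _).trans (h3.trans ?_)
        -- The largest weight in the first range times the error in the partial sums is at most the
        -- total weight of the last stretch, hence at most `1`.
        have h4 : cycleProb θ n (n - B) * (n : ℝ) ^ (1 - δ) ≤ 1 := by
          refine (mul_le_mul_of_nonneg_left hBge (cycleProb_nonneg hθ _ _)).trans ?_
          refine le_trans ?_ hratio1
          rw [cycleProb, show n - (n - B) = B by omega, div_mul_div_comm, div_mul_eq_mul_div]
          have := ewensNorm_pos hθ B
          have h5 : 0 ≤ ewensNorm θ B * B := by positivity
          refine div_le_div_of_nonneg_right ?_ (by positivity)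
          nlinarith [mul_le_mul_of_nonneg_right h1 h5]
        calc _ = 2 * C * (cycleProb θ n (n - B) * (n : ℝ) ^ (1 - δ)) := by ring
          _ ≤ 2 * C * 1 := mul_le_mul_of_nonneg_left h4 (by positivity)
          _ = 2 * C := mul_one _
    have hlog : 0 ≤ Real.log n := Real.log_nonneg hn'
    have hsecond : ∑ m ∈ Finset.Ioc (n - B) n, H m * cycleProb θ n m ≤ C * D := by
      calc ∑ m ∈ Finset.Ioc (n - B) n, H m * cycleProb θ n m
          ≤ ∑ m ∈ Finset.Ioc (n - B) n, C * (1 + Real.log n) * cycleProb θ n m := by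
            refine Finset.sum_le_sum fun m hm => ?_
            obtain ⟨hm1, hm2⟩ := Finset.mem_Ioc.1 hm
            refine mul_le_mul_of_nonneg_right ?_ (cycleProb_nonneg hθ _ _)
            refine (hH m (by omega)).trans (mul_le_mul_of_nonneg_left ?_ hC)
            have : (0 : ℝ) < m := by exact_mod_cast (by omega : 0 < m)
            have := Real.log_le_log this (by exact_mod_cast hm2 : (m : ℝ) ≤ n)
            linarith
        _ = C * (1 + Real.log n) * (B * ewensNorm θ B / (n * ewensNorm θ n)) := by
            rw [← Finset.mul_sum, sum_cycleProb_Ioc hBn]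
        _ ≤ C * (1 + Real.log n) * (2 * (n : ℝ) ^ (-δ)) ^ θ :=
            mul_le_mul_of_nonneg_left hratio (by positivity)
        _ = C * ((1 + Real.log n) * (2 * (n : ℝ) ^ (-δ)) ^ θ) := by ring
        _ ≤ C * D := mul_le_mul_of_nonneg_left (hD n hn) hC
    calc ∑ m ∈ Finset.Icc 1 n, H m * compWeight θ n m
        ≤ ∑ m ∈ Finset.Icc 1 n, H m * (2 * cycleProb θ n m) := Finset.sum_le_sum fun m _ =>
          mul_le_mul_of_nonneg_left (compWeight_le_of_le_one hθ h1 n m) (hH0 m)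
      _ = 2 * ∑ m ∈ Finset.Icc 1 n, H m * cycleProb θ n m := by
          rw [Finset.mul_sum]
          exact Finset.sum_congr rfl fun m _ => by ring
      _ ≤ _ := by rw [hsplit]; linarith

/-! ### Asymptotics of characteristic functions -/

/-- For `|y| ≤ 1` this is the remainder of the exponential series; for `|y| > 1` every term is at
most a multiple of `|y|^3`. -/
theorem norm_exp_mul_I_sub_le (y : ℝ) :
    ‖Complex.exp (y * Complex.I) - 1 - y * Complex.I + (y : ℂ) ^ 2 / 2‖ ≤ 4 * |y| ^ 3 := by
  rcases le_or_gt |y| 1 with h | h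
  · have h1 : ‖(y * Complex.I : ℂ)‖ = |y| := by simp
    have h2 := Complex.exp_bound (x := y * Complex.I) (by rwa [h1]) (n := 3) (by norm_num)
    rw [h1] at h2
    simp only [Finset.sum_range_succ, Finset.sum_range_zero, Nat.factorial, pow_zero, pow_one] at h2
    have h3 : Complex.exp (y * Complex.I) - 1 - y * Complex.I + (y : ℂ) ^ 2 / 2 =
        Complex.exp (y * Complex.I) - (0 + 1 / ((1 : ℕ) : ℂ) + y * Complex.I /
          (((0 + 1) * 1 : ℕ) : ℂ) + (y * Complex.I) ^ 2 / (((1 + 1) * ((0 + 1) * 1) : ℕ) : ℂ)) := by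
      rw [mul_pow, Complex.I_sq]
      push_cast
      ring
    rw [h3]
    refine h2.trans ?_
    rw [mul_comm]
    refine mul_le_mul_of_nonneg_right ?_ (by positivity)
    norm_num
  · have h1 : ‖Complex.exp (y * Complex.I)‖ = 1 := Complex.norm_exp_ofReal_mul_I y
    have h2 : ‖Complex.exp (y * Complex.I) - 1 - y * Complex.I + (y : ℂ) ^ 2 / 2‖ ≤
        1 + 1 + |y| + |y| ^ 2 / 2 := by
      refine (norm_add_le _ _).trans (add_le_add ((norm_sub_le _ _).trans (add_le_add
        ((norm_sub_le _ _).trans ?_) ?_)) ?_)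
      · rw [h1, norm_one]
      · simp
      · simp
    refine h2.trans ?_
    have h3 : 1 ≤ |y| ^ 3 := one_le_pow₀ h.le
    have h4 : |y| ≤ |y| ^ 3 := le_self_pow₀ h.le (by norm_num)
    have h5 : |y| ^ 2 ≤ |y| ^ 3 := pow_le_pow_right₀ h.le (by norm_num)
    linarith

theorem integrable_pow_of_abs_cube {ν : Measure ℝ} [IsProbabilityMeasure ν]
    (h : Integrable (fun y : ℝ => |y| ^ 3) ν) {k : ℕ} (hk : k ≤ 3) :
    Integrable (fun y : ℝ => y ^ k) ν := by
  refine ((integrable_const (1 : ℝ)).add h).mono' (by fun_prop) (Eventually.of_forall fun y => ?_)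
  rw [norm_pow, Real.norm_eq_abs]
  simp only [Pi.add_apply]
  rcases le_total |y| 1 with h1 | h1
  · have := pow_le_one₀ (n := k) (abs_nonneg y) h1
    have : 0 ≤ |y| ^ 3 := by positivity
    linarith
  · have := pow_le_pow_right₀ h1 hk
    linarith

theorem charFun_sub_one {ν : Measure ℝ} [IsProbabilityMeasure ν] (s : ℝ) :
    charFun ν s - 1 = ∫ y, (Complex.exp ((s * y : ℝ) * Complex.I) - 1) ∂ν := by
  rw [integral_sub, charFun_apply_real]
  · simp
  · refine Integrable.of_bound (by fun_prop) 1 (Eventually.of_forall fun y => ?_)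
    rw [Complex.norm_exp_ofReal_mul_I]
  · exact integrable_const _

theorem norm_charFun_sub_one_le {ν : Measure ℝ} [IsProbabilityMeasure ν]
    (h : Integrable (fun y : ℝ => |y| ^ 3) ν) (s : ℝ) :
    ‖charFun ν s - 1‖ ≤ |s| * ∫ y, |y| ∂ν := by
  rw [charFun_sub_one, ← integral_const_mul]
  have hint : Integrable (fun y : ℝ => |s| * |y|) ν := by
    have := (integrable_pow_of_abs_cube h (k := 1) (by norm_num)).abs.const_mul |s|
    simpa using this
  refine norm_integral_le_of_norm_le hint (Eventually.of_forall fun y => ?_)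
  have := Real.norm_exp_I_mul_ofReal_sub_one_le (x := s * y)
  rw [mul_comm Complex.I] at this
  simpa only [abs_mul, Real.norm_eq_abs] using this

theorem norm_charFun_sub_taylor_le {ν : Measure ℝ} [IsProbabilityMeasure ν]
    (h : Integrable (fun y : ℝ => |y| ^ 3) ν) (s : ℝ) :
    ‖charFun ν s - 1 - (s * ∫ y, y ∂ν : ℝ) * Complex.I + ((s ^ 2 / 2 * ∫ y, y ^ 2 ∂ν : ℝ) : ℂ)‖ ≤
      4 * |s| ^ 3 * ∫ y, |y| ^ 3 ∂ν := by
  have i1 : Integrable (fun y : ℝ => y) ν := by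
    simpa using integrable_pow_of_abs_cube h (k := 1) (by norm_num)
  have i2 : Integrable (fun y : ℝ => y ^ 2) ν := integrable_pow_of_abs_cube h (by norm_num)
  have h1 : ((s * ∫ y, y ∂ν : ℝ) : ℂ) * Complex.I = ∫ y, ((s * y : ℝ) : ℂ) * Complex.I ∂ν := by
    rw [integral_mul_const, integral_complex_ofReal, integral_const_mul]
  have h2 : ((s ^ 2 / 2 * ∫ y, y ^ 2 ∂ν : ℝ) : ℂ) = ∫ y, (((s * y : ℝ) : ℂ) ^ 2 / 2) ∂ν := by
    rw [← integral_const_mul, ← integral_complex_ofReal]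
    refine integral_congr_ae (Eventually.of_forall fun y => ?_)
    push_cast
    ring
  have j1 : Integrable (fun y : ℝ => ((s * y : ℝ) : ℂ) * Complex.I) ν :=
    ((i1.const_mul s).ofReal).mul_const _
  have j2 : Integrable (fun y : ℝ => (((s * y : ℝ) : ℂ) ^ 2 / 2)) ν := by
    have := (i2.const_mul (s ^ 2 / 2)).ofReal (𝕜 := ℂ)
    refine this.congr (Eventually.of_forall fun y => ?_)
    simp only [Complex.coe_algebraMap]
    push_cast
    ring
  have j0 : Integrable (fun y : ℝ => Complex.exp ((s * y : ℝ) * Complex.I) - 1) ν := by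
    refine Integrable.of_bound (by fun_prop) 2 (Eventually.of_forall fun y => ?_)
    refine (norm_sub_le _ _).trans ?_
    rw [Complex.norm_exp_ofReal_mul_I, norm_one]
    norm_num
  have j3 : Integrable (fun y : ℝ => 4 * |s| ^ 3 * |y| ^ 3) ν := h.const_mul _
  rw [charFun_sub_one, h1, h2, ← integral_sub j0 j1,
    ← integral_add (f := fun y : ℝ => Complex.exp ((s * y : ℝ) * Complex.I) - 1 -
      ((s * y : ℝ) : ℂ) * Complex.I) (j0.sub j1) j2, ← integral_const_mul]
  refine norm_integral_le_of_norm_le j3 (Eventually.of_forall fun y => ?_)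
  refine (norm_exp_mul_I_sub_le (s * y)).trans (le_of_eq ?_)
  rw [abs_mul, mul_pow, mul_assoc]

theorem compWeight_nonneg {θ : ℝ} (hθ : 0 < θ) {n m : ℕ} (hm : 1 ≤ m) (hmn : m ≤ n) :
    0 ≤ compWeight θ n m := by
  refine add_nonneg (cycleProb_nonneg hθ n m) (sub_nonneg.2 ?_)
  refine ge_of_tendsto (tendsto_fellerMean hθ m) ?_
  filter_upwards [eventually_ge_atTop n] with N hN
  induction N, hN using Nat.le_induction with
  | base => exact le_rfl
  | succ N hN ih =>
    have h1 := fellerMean_succ_sub hθ hm (hmn.trans hN)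
    have h2 := mul_nonneg (by positivity : 0 ≤ θ / (θ + N)) (cycleProb_nonneg hθ N m)
    linarith

theorem abs_sum_inv_sub_log_le {n : ℕ} (hn : 1 ≤ n) :
    |∑ m ∈ Finset.Icc 1 n, (1 : ℝ) / m - Real.log n| ≤ 1 := by
  have h1 : ∑ m ∈ Finset.Icc 1 n, (1 : ℝ) / m = (harmonic n : ℝ) := by
    rw [harmonic_eq_sum_Icc]
    push_cast
    exact Finset.sum_congr rfl fun m _ => one_div _
  have h2 := log_add_one_le_harmonic n
  have h3 := harmonic_le_one_add_log n
  have hn' : (0 : ℝ) < n := by exact_mod_cast hn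
  have h4 : Real.log n ≤ Real.log ((n : ℝ) + 1) := Real.log_le_log hn' (by linarith)
  push_cast at h2
  rw [h1, abs_le]
  constructor <;> linarith

/-- With `s = t / √(log n)`, the Poisson exponent is `i s` times the first moments minus `s² / 2`
times the second, summed against `1 / m`. The bounded errors in `h1` and `h2` are killed by `s`. The
cubic remainder is `O(|s|³ (1 + log n)) = o(1)`, and the passage from the cycle index to the
exponential costs `O(|s|)` by `h4`. -/
theorem tendsto_cycleIndex_charFun {θ : ℝ} (hθ : 0 < θ) (ν : ℕ → Measure ℝ)
    [∀ m, IsProbabilityMeasure (ν m)] (hint : ∀ m, Integrable (fun y : ℝ => |y| ^ 3) (ν m))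
    {M₁ M₂ C : ℝ}
    (h1 : ∀ n : ℕ, |∑ m ∈ Finset.Icc 1 n, (∫ y, y ∂(ν m) - M₁) / m| ≤ C)
    (h2 : ∀ n : ℕ, |∑ m ∈ Finset.Icc 1 n, (∫ y, y ^ 2 ∂(ν m) - M₂) / m| ≤ C)
    (h3 : ∀ n : ℕ, 1 ≤ n → ∑ m ∈ Finset.Icc 1 n, (∫ y, |y| ^ 3 ∂(ν m)) / m ≤ C * (1 + Real.log n))
    (h4 : ∀ n : ℕ, 1 ≤ n → ∑ m ∈ Finset.Icc 1 n, (∫ y, |y| ∂(ν m)) * compWeight θ n m ≤ C)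
    (t : ℝ) :
    Tendsto (fun n : ℕ => Complex.exp (-(t * (θ * M₁ * √(Real.log n)) : ℝ) * Complex.I) *
        (cycleIndex (fun m => θ * charFun (ν m) (t / √(Real.log n))) n / ewensNorm θ n))
      atTop (𝓝 (Complex.exp (-(θ * M₂ * t ^ 2 / 2 : ℝ)))) := by
  have hC : 0 ≤ C := (abs_nonneg _).trans (h1 0)
  set L : ℕ → ℝ := fun n => Real.log n with hL
  have hLt : Tendsto L atTop atTop := Real.tendsto_log_atTop.comp tendsto_natCast_atTop_atTop
  have hs : Tendsto (fun n => t / √(L n)) atTop (𝓝 0) :=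
    tendsto_const_nhds.div_atTop (Real.tendsto_sqrt_atTop.comp hLt)
  have hsabs : Tendsto (fun n => |t / √(L n)|) atTop (𝓝 0) := by simpa using hs.abs
  set S : ℕ → ℂ := fun n => ∑ m ∈ Finset.Icc 1 n, (charFun (ν m) (t / √(L n)) - 1) / m with hS
  -- The centering phase and the Poisson exponent together; the cycle index is replaced by its
  -- exponential approximation only at the end.
  set Z : ℕ → ℂ := fun n => -(t * (θ * M₁ * √(L n)) : ℝ) * Complex.I + θ * S n with hZ
  have hZlim : Tendsto Z atTop (𝓝 (-(θ * M₂ * t ^ 2 / 2 : ℝ))) := by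
    rw [tendsto_iff_norm_sub_tendsto_zero]
    have hbound : Tendsto (fun n => θ * (|t / √(L n)| * (|M₁| + C) +
        |t / √(L n)| ^ 2 * (|M₂| + C) + 4 * C * (|t / √(L n)| ^ 3 + |t / √(L n)| * t ^ 2))) atTop
        (𝓝 (θ * (0 * (|M₁| + C) + 0 ^ 2 * (|M₂| + C) + 4 * C * (0 ^ 3 + 0 * t ^ 2)))) :=
      (((hsabs.mul_const _).add ((hsabs.pow 2).mul_const _)).add
        (((hsabs.pow 3).add (hsabs.mul_const _)).const_mul _)).const_mul _
    simp only [ne_eq, OfNat.ofNat_ne_zero, not_false_eq_true, zero_pow, zero_mul, add_zero,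
      mul_zero] at hbound
    refine squeeze_zero' (Eventually.of_forall fun _ => norm_nonneg _) ?_ hbound
    filter_upwards [eventually_ge_atTop 2] with n hn
    have hn1 : 1 ≤ n := by omega
    have hLpos : 0 < L n := Real.log_pos (by exact_mod_cast hn)
    set s := t / √(L n) with hsdef
    have hsq : √(L n) ≠ 0 := (Real.sqrt_pos.2 hLpos).ne'
    -- These two identities turn a factor `log n` into the centering and the limiting variance.
    have hsL : s * L n = t * √(L n) := by
      rw [hsdef, div_mul_eq_mul_div, div_eq_iff hsq, mul_assoc, Real.mul_self_sqrt hLpos.le]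
    have hs2L : s ^ 2 * L n = t ^ 2 := by
      rw [hsdef, div_pow, Real.sq_sqrt hLpos.le, div_mul_cancel₀ _ hLpos.ne']
    set E1 := ∑ m ∈ Finset.Icc 1 n, (∫ y, y ∂(ν m) - M₁) / m with hE1
    set E2 := ∑ m ∈ Finset.Icc 1 n, (∫ y, y ^ 2 ∂(ν m) - M₂) / m with hE2
    set Hn := ∑ m ∈ Finset.Icc 1 n, (1 : ℝ) / m with hHn
    set r : ℕ → ℂ := fun m => charFun (ν m) s - 1 - (s * ∫ y, y ∂(ν m) : ℝ) * Complex.I +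
      ((s ^ 2 / 2 * ∫ y, y ^ 2 ∂(ν m) : ℝ) : ℂ) with hr
    set E3 := ∑ m ∈ Finset.Icc 1 n, r m / m with hE3
    have hSn : S n = ((s * (M₁ * Hn + E1) : ℝ) : ℂ) * Complex.I -
        ((s ^ 2 / 2 * (M₂ * Hn + E2) : ℝ) : ℂ) + E3 := by
      have e1 : M₁ * Hn + E1 = ∑ m ∈ Finset.Icc 1 n, (∫ y, y ∂(ν m)) / m := by
        rw [hHn, hE1, Finset.mul_sum, ← Finset.sum_add_distrib]
        exact Finset.sum_congr rfl fun m _ => by ring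
      have e2 : M₂ * Hn + E2 = ∑ m ∈ Finset.Icc 1 n, (∫ y, y ^ 2 ∂(ν m)) / m := by
        rw [hHn, hE2, Finset.mul_sum, ← Finset.sum_add_distrib]
        exact Finset.sum_congr rfl fun m _ => by ring
      rw [e1, e2, Finset.mul_sum, Finset.mul_sum, Complex.ofReal_sum, Complex.ofReal_sum,
        Finset.sum_mul, ← Finset.sum_sub_distrib, hE3, ← Finset.sum_add_distrib]
      refine Finset.sum_congr rfl fun m _ => ?_
      simp only [hr]
      push_cast
      ring
    have hdiff : Z n - (-(θ * M₂ * t ^ 2 / 2 : ℝ) : ℂ) =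
        θ * (((s * (M₁ * (Hn - L n) + E1) : ℝ) : ℂ) * Complex.I -
          ((s ^ 2 / 2 * (M₂ * (Hn - L n) + E2) : ℝ) : ℂ) + E3) := by
      have e3 : s * (M₁ * (Hn - L n) + E1) = s * (M₁ * Hn + E1) - M₁ * (t * √(L n)) := by
        rw [← hsL]; ring
      have e4 : s ^ 2 / 2 * (M₂ * (Hn - L n) + E2) = s ^ 2 / 2 * (M₂ * Hn + E2) - M₂ * t ^ 2 / 2 := by
        rw [← hs2L]; ring
      simp only [hZ]
      rw [hSn, e3, e4]
      push_cast
      ring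
    have hH := abs_sum_inv_sub_log_le hn1
    rw [← hHn] at hH
    have b1 : |M₁ * (Hn - L n) + E1| ≤ |M₁| + C := by
      refine (abs_add_le _ _).trans (add_le_add ?_ (h1 n))
      rw [abs_mul]
      exact mul_le_of_le_one_right (abs_nonneg _) hH
    have b2 : |M₂ * (Hn - L n) + E2| ≤ |M₂| + C := by
      refine (abs_add_le _ _).trans (add_le_add ?_ (h2 n))
      rw [abs_mul]
      exact mul_le_of_le_one_right (abs_nonneg _) hH
    have b3 : ‖E3‖ ≤ 4 * C * (|s| ^ 3 + |s| * t ^ 2) := by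
      calc ‖E3‖ ≤ ∑ m ∈ Finset.Icc 1 n, 4 * |s| ^ 3 * ((∫ y, |y| ^ 3 ∂(ν m)) / m) := by
            refine (norm_sum_le _ _).trans (Finset.sum_le_sum fun m _ => ?_)
            rw [norm_div, Complex.norm_natCast, ← mul_div_assoc]
            exact div_le_div_of_nonneg_right (norm_charFun_sub_taylor_le (hint m) s)
              (Nat.cast_nonneg _)
        _ ≤ 4 * |s| ^ 3 * (C * (1 + L n)) := by
            rw [← Finset.mul_sum]
            exact mul_le_mul_of_nonneg_left (h3 n hn1) (by positivity)
        _ = 4 * C * (|s| ^ 3 + |s| * (s ^ 2 * L n)) := by rw [← sq_abs s]; ring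
        _ = _ := by rw [hs2L]
    rw [hdiff, norm_mul, Complex.norm_real, Real.norm_of_nonneg hθ.le]
    refine mul_le_mul_of_nonneg_left ?_ hθ.le
    refine (norm_add_le _ _).trans (add_le_add ((norm_sub_le _ _).trans (add_le_add ?_ ?_)) b3)
    · rw [norm_mul, Complex.norm_I, mul_one, Complex.norm_real, Real.norm_eq_abs, abs_mul]
      exact mul_le_mul_of_nonneg_left b1 (abs_nonneg _)
    · rw [Complex.norm_real, Real.norm_eq_abs, abs_mul, abs_of_nonneg (by positivity), sq_abs]
      refine mul_le_mul (by nlinarith [sq_nonneg s]) b2 (abs_nonneg _) (by positivity)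
  have hmain : Tendsto (fun n => Complex.exp (Z n)) atTop
      (𝓝 (Complex.exp (-(θ * M₂ * t ^ 2 / 2 : ℝ)))) :=
    (Complex.continuous_exp.tendsto _).comp hZlim
  -- The phase has modulus `1`, so the comparison bound carries over unchanged.
  refine hmain.congr_dist ?_
  have hb : Tendsto (fun n => |t / √(L n)| * C) atTop (𝓝 (0 * C)) := hsabs.mul_const _
  rw [zero_mul] at hb
  refine squeeze_zero' (Eventually.of_forall fun _ => dist_nonneg) ?_ hb
  filter_upwards [eventually_ge_atTop 1] with n hn
  have hcmp := norm_cycleIndex_sub_exp_le hθ (n := n) (by omega)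
    (fun m => charFun (ν m) (t / √(L n))) (fun m => norm_charFun_le_one _)
  rw [dist_comm, dist_eq_norm]
  simp only [hZ]
  rw [Complex.exp_add, ← mul_sub, norm_mul]
  have hn1 : ‖Complex.exp (-(t * (θ * M₁ * √(L n)) : ℝ) * Complex.I)‖ = 1 := by
    rw [← Complex.ofReal_neg]
    exact Complex.norm_exp_ofReal_mul_I _
  rw [hn1, one_mul]
  refine hcmp.trans ?_
  refine (Finset.sum_le_sum fun m hm => ?_).trans
    ((Finset.mul_sum _ _ _).symm.le.trans (mul_le_mul_of_nonneg_left (h4 n hn) (abs_nonneg _)))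
  obtain ⟨hm1, hm2⟩ := Finset.mem_Icc.1 hm
  rw [← mul_assoc]
  exact mul_le_mul_of_nonneg_right (norm_charFun_sub_one_le (hint m) _)
    (compWeight_nonneg hθ hm1 hm2)

/-! ### The characteristic function of a randomized class function -/

/-- The law of `h (x^m T)` when `T` is a product of `m` independent variables with law `ζ`. -/
noncomputable def valueLaw (ζ : Measure Circle) (h : Circle → ℝ) (x : Circle) (m : ℕ) : Measure ℝ :=
  (prodLaw ζ m).map (fun u => h (x ^ m * u))

instance isProbabilityMeasure_prodLaw (ζ : Measure Circle) [IsProbabilityMeasure ζ] (m : ℕ) :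
    IsProbabilityMeasure (prodLaw ζ m) :=
  Measure.isProbabilityMeasure_map (by fun_prop)

theorem isProbabilityMeasure_valueLaw (ζ : Measure Circle) [IsProbabilityMeasure ζ]
    {h : Circle → ℝ} (hh : Measurable h) (x : Circle) (m : ℕ) :
    IsProbabilityMeasure (valueLaw ζ h x m) :=
  Measure.isProbabilityMeasure_map (by fun_prop)

/-- The sum of `h (x^m T_{m,k})` over the cycles of a permutation. -/
noncomputable def cycleSum (h : Circle → ℝ) (x : Circle) {n : ℕ} (s : Equiv.Perm (Fin n))
    (T : ℕ → ℕ → Circle) : ℝ :=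
  ∑ m ∈ Finset.Icc 1 n, ∑ k ∈ Finset.range (cycleCount s m), h (x ^ m * T m k)

theorem prod_cycleCount {n : ℕ} (s : Equiv.Perm (Fin n)) (φ : ℕ → ℂ) :
    ∏ m ∈ Finset.Icc 1 n, φ m ^ cycleCount s m = (s.partition.parts.map φ).prod := by
  rw [Finset.prod_multiset_map_count]
  symm
  refine Finset.prod_subset (fun m hm => ?_) (fun m _ hm => ?_)
  · have hm' := Multiset.mem_toFinset.1 hm
    refine Finset.mem_Icc.2 ⟨s.partition.parts_pos hm', ?_⟩
    simpa using s.partition.le_of_mem_parts hm'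
  · have : s.partition.parts.count m = 0 := by simpa using hm
    rw [this, pow_zero]

theorem ewensMeasure_singleton (θ : ℝ) (n : ℕ) (s : Equiv.Perm (Fin n)) :
    ewensMeasure θ n {s} =
      ENNReal.ofReal (θ ^ numCycles s / ∏ i ∈ Finset.range n, (θ + (i : ℝ))) := by
  classical
  rw [ewensMeasure, Measure.finsetSum_apply]
  simp [Set.indicator_apply, Finset.sum_ite_eq']

section

variable {Ω : Type*} [MeasurableSpace Ω] {P : Measure Ω} {n : ℕ}
  {σ : Ω → Equiv.Perm (Fin n)} {T : ℕ → ℕ → Ω → Circle} {h : Circle → ℝ} {x : Circle}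

theorem measurable_cycleSum_const (hh : Measurable h) (hT : ∀ m k, Measurable (T m k))
    (s : Equiv.Perm (Fin n)) : Measurable fun ω => cycleSum h x s (fun m k => T m k ω) := by
  unfold cycleSum
  fun_prop

theorem measurable_cycleSum (hh : Measurable h) (hσ : Measurable σ)
    (hT : ∀ m k, Measurable (T m k)) :
    Measurable fun ω => cycleSum h x (σ ω) (fun m k => T m k ω) := by
  have : MeasurableSingletonClass (Equiv.Perm (Fin n)) := ⟨fun _ => trivial⟩
  have : Countable (Equiv.Perm (Fin n)) := Finite.to_countable
  set F : Equiv.Perm (Fin n) × Ω → ℝ := fun q => cycleSum h x q.1 (fun m k => T m k q.2) with hF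
  have h1 : Measurable F := by
    refine measurable_from_prod_countable_right fun s => ?_
    exact measurable_cycleSum_const hh hT s
  have h2 : Measurable fun ω => (σ ω, ω) := hσ.prodMk measurable_id
  have h3 : Measurable fun ω => F (σ ω, ω) := by
    clear_value F
    exact h1.comp h2
  exact h3

/-- For a fixed permutation the summands are independent and there is one factor for each cycle,
depending only on its length. -/
theorem charFun_cycleSum_const (hh : Measurable h) (hT : ∀ m k, Measurable (T m k))
    {ζ : Measure Circle} (hT_law : ∀ m k, P.map (T m k) = prodLaw ζ m)
    (hT_indep : iIndepFun (fun p : ℕ × ℕ => T p.1 p.2) P) (s : Equiv.Perm (Fin n)) (t : ℝ) :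
    charFun (P.map fun ω => cycleSum h x s (fun m k => T m k ω)) t =
      (s.partition.parts.map fun m => charFun (valueLaw ζ h x m) t).prod := by
  set J := (Finset.Icc 1 n).sigma fun m => Finset.range (cycleCount s m) with hJ
  set X : (Σ _ : ℕ, ℕ) → Ω → ℝ := fun p ω => h (x ^ p.1 * T p.1 p.2 ω) with hX
  have h1 : (fun ω => cycleSum h x s (fun m k => T m k ω)) = fun ω => ∑ p ∈ J, X p ω := by
    funext ω
    rw [cycleSum, hJ, Finset.sum_sigma]
  have h2 : iIndepFun (J.restrict X) P := by
    have h3 := hT_indep.comp (fun p u => h (x ^ p.1 * u)) (fun p => by fun_prop)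
    exact h3.precomp (g := fun p : J => (p.1.1, p.1.2)) (by
      rintro ⟨⟨a, b⟩, _⟩ ⟨⟨c, d⟩, _⟩ h
      simpa using h)
  have hXm : ∀ p, Measurable (X p) := fun p => by fun_prop
  rw [h1, h2.charFun_map_fun_finsetSum_eq_prod (fun p _ => (hXm p).aemeasurable),
    Finset.prod_apply, hJ, Finset.prod_sigma, ← prod_cycleCount]
  refine Finset.prod_congr rfl fun m _ => ?_
  have h3 : ∀ k, P.map (X ⟨m, k⟩) = valueLaw ζ h x m := fun k => by
    rw [valueLaw, ← hT_law m k, Measure.map_map (by fun_prop) (hT m k)]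
    rfl
  simp only [h3, Finset.prod_const, Finset.card_range]

/-- Splitting over the value of `σ` and using its independence of `T` gives an Ewens average of
products over cycles. The factor `θ` for each cycle is absorbed into the weights of the cycle index,
and the factorials cancel. -/
theorem charFun_cycleSum [IsProbabilityMeasure P] {θ : ℝ} (hθ : 0 < θ) (hh : Measurable h) (hσ : Measurable σ)
    (hσ_law : P.map σ = ewensMeasure θ n) (hT : ∀ m k, Measurable (T m k))
    {ζ : Measure Circle} (hT_law : ∀ m k, P.map (T m k) = prodLaw ζ m)
    (hT_indep : iIndepFun (fun p : ℕ × ℕ => T p.1 p.2) P)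
    (hσT_indep : IndepFun σ (fun ω (p : ℕ × ℕ) => T p.1 p.2 ω) P) (t : ℝ) :
    charFun (P.map fun ω => cycleSum h x (σ ω) (fun m k => T m k ω)) t =
      cycleIndex (fun m => θ * charFun (valueLaw ζ h x m) t) n / ewensNorm θ n := by
  have hW := measurable_cycleSum (x := x) hh hσ hT
  have hWs : ∀ s : Equiv.Perm (Fin n), Measurable fun ω => cycleSum h x s (fun m k => T m k ω) :=
    measurable_cycleSum_const hh hT
  have hexp : ∀ {W : Ω → ℝ}, Measurable W →
      charFun (P.map W) t = ∫ ω, Complex.exp (t * W ω * Complex.I) ∂P := by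
    intro W hW
    rw [charFun_apply_real, integral_map hW.aemeasurable (by fun_prop)]
  have hsingle : ∀ s : Equiv.Perm (Fin n), MeasurableSet {s} := fun s => trivial
  have hprob : ∀ s : Equiv.Perm (Fin n), P.real (σ ⁻¹' {s}) =
      θ ^ numCycles s / ∏ i ∈ Finset.range n, (θ + (i : ℝ)) := by
    intro s
    rw [measureReal_def, ← Measure.map_apply hσ (hsingle s), hσ_law, ewensMeasure_singleton,
      ENNReal.toReal_ofReal]
    exact div_nonneg (by positivity) (Finset.prod_nonneg fun i _ => by positivity)
  have hterm : ∀ s : Equiv.Perm (Fin n),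
      ∫ ω, (σ ⁻¹' {s}).indicator (fun _ => (1 : ℂ)) ω *
        Complex.exp (t * cycleSum h x s (fun m k => T m k ω) * Complex.I) ∂P =
      (P.real (σ ⁻¹' {s}) : ℂ) *
        (s.partition.parts.map fun m => charFun (valueLaw ζ h x m) t).prod := by
    intro s
    -- The independence is used for the whole family `T` at once, through a functional of it.
    have h1 := hσT_indep.integral_fun_comp_mul_comp (𝕜 := ℂ)
      (f := ({s} : Set _).indicator fun _ => (1 : ℂ))
      (g := fun T : ℕ × ℕ → Circle =>
        Complex.exp (t * cycleSum h x s (fun m k => T (m, k)) * Complex.I))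
      hσ.aemeasurable (by fun_prop)
      ((measurable_const.indicator (hsingle s)).aestronglyMeasurable) (by
        unfold cycleSum
        exact Measurable.aestronglyMeasurable (by fun_prop))
    rw [← charFun_cycleSum_const hh hT hT_law hT_indep, hexp (hWs s)]
    refine Eq.trans ?_ (h1.trans ?_)
    · rfl
    · congr 1
      have : (fun ω => ({s} : Set _).indicator (fun _ => (1 : ℂ)) (σ ω)) =
          (σ ⁻¹' {s}).indicator (fun _ => (1 : ℂ)) := rfl
      rw [this, integral_indicator (hσ (hsingle s))]
      simp [measureReal_def]
  have hsplit : ∀ ω, Complex.exp (t * cycleSum h x (σ ω) (fun m k => T m k ω) * Complex.I) =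
      ∑ s : Equiv.Perm (Fin n), (σ ⁻¹' {s}).indicator (fun _ => (1 : ℂ)) ω *
        Complex.exp (t * cycleSum h x s (fun m k => T m k ω) * Complex.I) := by
    intro ω
    rw [Finset.sum_eq_single (σ ω)]
    · simp
    · intro s _ hs
      rw [Set.indicator_of_notMem (by simpa using hs.symm), zero_mul]
    · simp
  rw [hexp hW]
  simp only [hsplit]
  rw [integral_finsetSum]
  · simp only [hterm, hprob]
    have hω := ewensNorm_pos hθ n
    have hfac : ((n.factorial : ℕ) : ℂ) ≠ 0 := by exact_mod_cast Nat.factorial_ne_zero n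
    have hω' : (ewensNorm θ n : ℂ) ≠ 0 := by exact_mod_cast hω.ne'
    have hprod : ∏ i ∈ Finset.range n, (θ + (i : ℝ)) = n.factorial * ewensNorm θ n := by
      rw [ewensNorm_eq, mul_div_cancel₀]
      exact_mod_cast Nat.factorial_ne_zero n
    have h2 := sum_perm_prod_eq (fun m => θ * charFun (valueLaw ζ h x m) t) n
    rw [eq_div_iff hω', hprod, Finset.sum_mul]
    apply mul_left_cancel₀ hfac
    rw [← h2, Finset.mul_sum]
    refine Finset.sum_congr rfl fun s _ => ?_
    rw [Multiset.prod_map_mul, Multiset.map_const', Multiset.prod_replicate, numCycles]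
    push_cast
    field_simp
  · intro s _
    refine Integrable.of_bound (Measurable.aestronglyMeasurable ?_) 1
      (Eventually.of_forall fun ω => ?_)
    · have := hWs s
      refine Measurable.mul (measurable_const.indicator (hσ (hsingle s))) (by fun_prop)
    · rw [norm_mul]
      have h1 : (t * cycleSum h x s (fun m k => T m k ω) : ℂ) =
          ((t * cycleSum h x s (fun m k => T m k ω) : ℝ) : ℂ) := by push_cast; rfl
      rw [h1, Complex.norm_exp_ofReal_mul_I, mul_one]
      refine (norm_indicator_le_norm_self _ _).trans (by simp)

end

/-- The central limit theorem for `∑_m ∑_k h (x^m T_{m,k})` under averaged moment bounds. -/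
theorem tendstoInDistribution_cycleSum {θ : ℝ} (hθ : 0 < θ) {h : Circle → ℝ} (hh : Measurable h)
    {x : Circle} {ζ : Measure Circle} [IsProbabilityMeasure ζ]
    {Ω : ℕ → Type*} [∀ n, MeasurableSpace (Ω n)]
    (P : (n : ℕ) → Measure (Ω n)) [∀ n, IsProbabilityMeasure (P n)]
    (σ : (n : ℕ) → Ω n → Equiv.Perm (Fin n)) (hσ : ∀ n, Measurable (σ n))
    (hσ_law : ∀ n, (P n).map (σ n) = ewensMeasure θ n)
    (T : (n : ℕ) → ℕ → ℕ → Ω n → Circle) (hT : ∀ n m k, Measurable (T n m k))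
    (hT_law : ∀ n m k, (P n).map (T n m k) = prodLaw ζ m)
    (hT_indep : ∀ n, iIndepFun (fun (p : ℕ × ℕ) => T n p.1 p.2) (P n))
    (hσT_indep : ∀ n, IndepFun (σ n) (fun ω (p : ℕ × ℕ) => T n p.1 p.2 ω) (P n))
    {M₁ M₂ C : ℝ} (hM₂ : 0 ≤ M₂)
    (hint : ∀ m, Integrable (fun u => |h (x ^ m * u)| ^ 3) (prodLaw ζ m))
    (h1 : ∀ n : ℕ, |∑ m ∈ Finset.Icc 1 n, (∫ u, h (x ^ m * u) ∂(prodLaw ζ m) - M₁) / m| ≤ C)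
    (h2 : ∀ n : ℕ, |∑ m ∈ Finset.Icc 1 n, (∫ u, h (x ^ m * u) ^ 2 ∂(prodLaw ζ m) - M₂) / m| ≤ C)
    (h3 : ∀ n : ℕ, 1 ≤ n →
      ∑ m ∈ Finset.Icc 1 n, (∫ u, |h (x ^ m * u)| ^ 3 ∂(prodLaw ζ m)) / m ≤ C * (1 + Real.log n))
    (h4 : ∀ n : ℕ, 1 ≤ n →
      ∑ m ∈ Finset.Icc 1 n, (∫ u, |h (x ^ m * u)| ∂(prodLaw ζ m)) * compWeight θ n m ≤ C) :
    TendstoInDistribution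
      (fun (n : ℕ) (ω : Ω n) => cycleSum h x (σ n ω) (fun m k => T n m k ω) / √(Real.log n)
          - θ * M₁ * √(Real.log n))
      atTop (fun y : ℝ => y) P (gaussianReal 0 (θ * M₂).toNNReal) := by
  have hmeas : ∀ n, Measurable fun ω => cycleSum h x (σ n ω) (fun m k => T n m k ω) :=
    fun n => measurable_cycleSum hh (hσ n) (hT n)
  have hν : ∀ m, IsProbabilityMeasure (valueLaw ζ h x m) :=
    fun m => isProbabilityMeasure_valueLaw ζ hh x m
  have hmap : ∀ m (F : ℝ → ℝ), Measurable F →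
      ∫ y, F y ∂(valueLaw ζ h x m) = ∫ u, F (h (x ^ m * u)) ∂(prodLaw ζ m) := by
    intro m F hF
    rw [valueLaw, integral_map (by fun_prop) hF.aestronglyMeasurable]
  refine ⟨fun n => ((hmeas n).div_const _ |>.sub_const _).aemeasurable, by fun_prop, ?_⟩
  refine ProbabilityMeasure.tendsto_iff_tendsto_charFun.2 fun t => ?_
  have hkey := tendsto_cycleIndex_charFun hθ (valueLaw ζ h x) (fun m => by
      rw [valueLaw, integrable_map_measure (by fun_prop) (by fun_prop)]
      exact hint m) (M₁ := M₁) (M₂ := M₂) (C := C)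
    (fun n => by simpa only [hmap _ _ measurable_id'] using h1 n)
    (fun n => by simpa only [hmap _ (fun y => y ^ 2) (by fun_prop)] using h2 n)
    (fun n hn => by simpa only [hmap _ (fun y => |y| ^ 3) (by fun_prop)] using h3 n hn)
    (fun n hn => by simpa only [hmap _ (fun y => |y|) (by fun_prop)] using h4 n hn) t
  have hlim : charFun ((gaussianReal 0 (θ * M₂).toNNReal).map fun y : ℝ => y) t =
      Complex.exp (-(θ * M₂ * t ^ 2 / 2 : ℝ)) := by
    rw [Measure.map_id', charFun_gaussianReal, Real.coe_toNNReal _ (by positivity)]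
    congr 1
    push_cast
    ring
  simp only [ProbabilityMeasure.coe_mk]
  rw [hlim]
  refine hkey.congr fun n => ?_
  rw [← charFun_cycleSum hθ hh (hσ n) (hσ_law n) (hT n) (hT_law n) (hT_indep n) (hσT_indep n),
    charFun_apply_real, charFun_apply_real, integral_map (hmeas n).aemeasurable (by fun_prop),
    integral_map (((hmeas n).div_const _ |>.sub_const _).aemeasurable) (by fun_prop),
    ← integral_const_mul]
  refine integral_congr_ae (Eventually.of_forall fun ω => ?_)
  simp only
  rw [← Complex.exp_add]
  congr 1
  push_cast
  ring

/-! ### Zeros of analytic functions of one real variable -/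

section Analytic

variable {E : Type*} [NormedAddCommGroup E] [NormedSpace ℝ E] {g : ℝ → E}

/-- The order of vanishing at `t₀` is finite by the identity theorem, and the remaining analytic
factor is bounded away from `0` near `t₀`. -/
theorem exists_mul_pow_le_norm (hg : AnalyticOnNhd ℝ g Set.univ) (hg0 : g ≠ 0) (t₀ : ℝ) :
    ∃ N : ℕ, ∃ c > 0, ∀ᶠ t in 𝓝 t₀, c * |t - t₀| ^ N ≤ ‖g t‖ := by
  have h1 : ¬ ∀ᶠ t in 𝓝 t₀, g t = 0 := fun h => hg0 <| funext fun t =>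
    hg.eqOn_zero_of_preconnected_of_eventuallyEq_zero isPreconnected_univ (Set.mem_univ t₀) h
      (Set.mem_univ t)
  obtain ⟨N, k, hk, hk0, hgk⟩ :=
    (hg t₀ (Set.mem_univ _)).exists_eventuallyEq_pow_smul_nonzero_iff.2 h1
  have hpos : 0 < ‖k t₀‖ := norm_pos_iff.2 hk0
  refine ⟨N, ‖k t₀‖ / 2, by positivity, ?_⟩
  have h2 : ∀ᶠ t in 𝓝 t₀, ‖k t₀‖ / 2 < ‖k t‖ :=
    hk.continuousAt.norm.eventually_const_lt (by linarith)
  filter_upwards [hgk, h2] with t h3 h4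
  rw [h3, norm_smul, norm_pow, Real.norm_eq_abs, mul_comm]
  exact mul_le_mul_of_nonneg_left h4.le (by positivity)

theorem intervalIntegrable_abs_rpow {r : ℝ} (hr : -1 < r) (a : ℝ) :
    IntervalIntegrable (fun u : ℝ => |u| ^ r) volume (-a) a := by
  have h1 : ∀ b : ℝ, 0 ≤ b → IntervalIntegrable (fun u : ℝ => |u| ^ r) volume 0 b := by
    intro b hb
    refine (intervalIntegral.intervalIntegrable_rpow' (a := 0) (b := b) hr).congr ?_
    intro u hu
    rw [Set.uIoc_of_le hb] at hu
    simp only [abs_of_pos hu.1]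
  have h2 : ∀ b : ℝ, 0 ≤ b → IntervalIntegrable (fun u : ℝ => |u| ^ r) volume 0 (-b) := by
    intro b hb
    have := (IntervalIntegrable.iff_comp_neg).1 (h1 b hb)
    simpa using this
  have h3 : ∀ b : ℝ, IntervalIntegrable (fun u : ℝ => |u| ^ r) volume 0 b := by
    intro b
    rcases le_total 0 b with h | h
    · exact h1 b h
    · simpa using h2 (-b) (by linarith)
  exact (h3 (-a)).symm.trans (h3 a)

theorem rpow_neg_le_one_add {y a b : ℝ} (hy : 0 ≤ y) (ha : 0 < a) (hab : a ≤ b) :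
    y ^ (-a) ≤ 1 + y ^ (-b) := by
  rcases hy.eq_or_lt with rfl | hy
  · rw [Real.zero_rpow (by linarith), Real.zero_rpow (by linarith)]
    norm_num
  · rcases le_total 1 y with h | h
    · have h1 := Real.rpow_le_one_of_one_le_of_nonpos h (by linarith : -a ≤ 0)
      have h2 := Real.rpow_nonneg hy.le (-b)
      linarith
    · have h1 := Real.rpow_le_rpow_of_exponent_ge hy h (by linarith : -b ≤ -a)
      linarith

/-- A nonzero analytic function vanishes on a null set, and a negative power of its norm is locally
integrable. -/
theorem exists_integrableOn_norm_rpow_neg (hg : AnalyticOnNhd ℝ g Set.univ) (hg0 : g ≠ 0) :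
    ∃ c : ℝ, 0 < c ∧ c ≤ 1 ∧ IntegrableOn (fun t => ‖g t‖ ^ (-c)) (Set.Icc 0 1) ∧
      volume (Set.Icc (0 : ℝ) 1 ∩ {t | g t = 0}) = 0 := by
  have hgc : Continuous g := continuous_iff_continuousAt.2 fun t =>
    (hg t (Set.mem_univ t)).continuousAt
  have hmeas : ∀ c : ℝ, Measurable fun t => ‖g t‖ ^ (-c) := fun c =>
    hgc.norm.measurable.pow_const _
  suffices H : volume (Set.Icc (0 : ℝ) 1) < ⊤ ∧ ∃ c : ℝ, 0 < c ∧ c ≤ 1 ∧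
      IntegrableOn (fun t => ‖g t‖ ^ (-c)) (Set.Icc 0 1) ∧
      volume (Set.Icc (0 : ℝ) 1 ∩ {t | g t = 0}) = 0 from H.2
  refine isCompact_Icc.induction_on (p := fun s => volume s < ⊤ ∧ ∃ c : ℝ, 0 < c ∧ c ≤ 1 ∧
      IntegrableOn (fun t => ‖g t‖ ^ (-c)) s ∧ volume (s ∩ {t | g t = 0}) = 0) ?_ ?_ ?_ ?_
  · exact ⟨by simp, 1, by norm_num, le_rfl, by simp, by simp⟩
  · rintro s t hst ⟨h0, c, h1, h2, h3, h4⟩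
    exact ⟨(measure_mono hst).trans_lt h0, c, h1, h2, h3.mono_set hst,
      measure_mono_null (Set.inter_subset_inter_left _ hst) h4⟩
  · have hmono : ∀ (s : Set ℝ) (a b : ℝ), volume s < ⊤ → 0 < a → a ≤ b →
        IntegrableOn (fun t => ‖g t‖ ^ (-b)) s → IntegrableOn (fun t => ‖g t‖ ^ (-a)) s := by
      intro s a b hs ha hab h
      refine Integrable.mono' ((integrableOn_const (C := (1 : ℝ)) hs.ne).add h)
        (hmeas a).aestronglyMeasurable (Eventually.of_forall fun t => ?_)
      rw [Real.norm_of_nonneg (Real.rpow_nonneg (norm_nonneg _) _)]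
      exact rpow_neg_le_one_add (norm_nonneg _) ha hab
    rintro s t ⟨h0, c, h1, h2, h3, h4⟩ ⟨h0', c', h1', h2', h3', h4'⟩
    refine ⟨measure_union_lt_top h0 h0', min c c', lt_min h1 h1', (min_le_left _ _).trans h2,
      (hmono s _ c h0 (lt_min h1 h1') (min_le_left _ _) h3).union
        (hmono t _ c' h0' (lt_min h1 h1') (min_le_right _ _) h3'), ?_⟩
    rw [Set.union_inter_distrib_right]
    exact measure_union_null h4 h4'
  · intro t₀ _
    obtain ⟨N, c₀, hc₀, hev⟩ := exists_mul_pow_le_norm hg hg0 t₀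
    obtain ⟨ε, hε, hball⟩ := Metric.eventually_nhds_iff.1 hev
    refine ⟨Set.Ioo (t₀ - ε) (t₀ + ε), mem_nhdsWithin_of_mem_nhds (Ioo_mem_nhds (by linarith)
      (by linarith)), by simp, ?_⟩
    have hin : ∀ t ∈ Set.Ioo (t₀ - ε) (t₀ + ε), c₀ * |t - t₀| ^ N ≤ ‖g t‖ := fun t ht =>
      hball (by rw [Real.dist_eq, abs_lt]; constructor <;> linarith [ht.1, ht.2])
    have hnull : volume (Set.Ioo (t₀ - ε) (t₀ + ε) ∩ {t | g t = 0}) = 0 := by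
      refine measure_mono_null (t := {t₀}) ?_ (by simp)
      rintro t ⟨ht, ht0⟩
      have h1 := hin t ht
      rw [Set.mem_ofPred_eq] at ht0
      rw [ht0, norm_zero] at h1
      by_contra h
      have : 0 < |t - t₀| := abs_pos.2 (sub_ne_zero.2 h)
      have : 0 < c₀ * |t - t₀| ^ N := by positivity
      linarith
    -- This makes `N * c < 1`, so `|t - t₀| ^ (-(N * c))` is integrable near `t₀`.
    set c : ℝ := 1 / (2 * (N + 1)) with hc
    have hcpos : 0 < c := by positivity
    refine ⟨c, hcpos, ?_, ?_, hnull⟩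
    · rw [hc, div_le_one (by positivity)]
      have : (0 : ℝ) ≤ N := Nat.cast_nonneg N
      linarith
    · have hr : -1 < -(N * c : ℝ) := by
        rw [neg_lt_neg_iff, hc, mul_one_div, div_lt_one (by positivity)]
        have : (0 : ℝ) ≤ N := Nat.cast_nonneg N
        linarith
      have h1 := (intervalIntegrable_abs_rpow hr ε).comp_sub_right t₀
      have h2 : IntegrableOn (fun t => |t - t₀| ^ (-(N * c : ℝ))) (Set.Ioo (t₀ - ε) (t₀ + ε)) := by
        have := (intervalIntegrable_iff_integrableOn_Ioo_of_le (by linarith)).1 h1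
        rwa [neg_add_eq_sub, add_comm ε t₀] at this
      refine Integrable.mono' (h2.const_mul (c₀ ^ (-c))) (hmeas c).aestronglyMeasurable ?_
      have hae : ∀ᵐ t ∂(volume.restrict (Set.Ioo (t₀ - ε) (t₀ + ε))), t ≠ t₀ :=
        ae_restrict_of_ae (by simp [ae_iff])
      filter_upwards [ae_restrict_mem measurableSet_Ioo, hae] with t ht hne
      have h3 : 0 < |t - t₀| := abs_pos.2 (sub_ne_zero.2 hne)
      rw [Real.norm_of_nonneg (Real.rpow_nonneg (norm_nonneg _) _)]
      calc ‖g t‖ ^ (-c) ≤ (c₀ * |t - t₀| ^ N) ^ (-c) :=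
            Real.rpow_le_rpow_of_nonpos (by positivity) (hin t ht) (by linarith)
        _ = c₀ ^ (-c) * |t - t₀| ^ (-(N * c : ℝ)) := by
            rw [Real.mul_rpow hc₀.le (by positivity), ← Real.rpow_natCast, ← Real.rpow_mul h3.le]
            congr 2
            ring

end Analytic

/-! ### The angular coordinate -/

theorem continuous_e : Continuous e := by
  unfold e
  fun_prop

theorem e_add (s t : ℝ) : e (s + t) = e s * e t := by
  rw [e, e, e, mul_add, Circle.exp_add]

theorem e_intCast (j : ℤ) : e j = 1 := by
  rw [e, mul_comm, Circle.exp_int_mul_two_pi]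

theorem e_add_intCast (t : ℝ) (j : ℤ) : e (t + j) = e t := by
  rw [e_add, e_intCast, mul_one]

theorem e_nat_mul (m : ℕ) (t : ℝ) : e (m * t) = e t ^ m := by
  induction m with
  | zero => simp [e]
  | succ m ih => rw [Nat.cast_succ, add_one_mul, e_add, ih, pow_succ]

theorem coe_e (t : ℝ) : (e t : ℂ) = Complex.exp (2 * Real.pi * Complex.I * t) := by
  rw [e, Circle.coe_exp]
  congr 1
  push_cast
  ring

theorem exists_e_eq (u : Circle) : ∃ t ∈ Set.Ico (0 : ℝ) 1, e t = u := by
  obtain ⟨s, hs⟩ : ∃ s, Circle.exp s = u := ⟨_, Circle.exp_arg u⟩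
  refine ⟨Int.fract (s / (2 * Real.pi)), ⟨Int.fract_nonneg _, Int.fract_lt_one _⟩, ?_⟩
  rw [← e_add_intCast _ ⌊s / (2 * Real.pi)⌋, Int.fract_add_floor, e, mul_div_cancel₀ _ (by positivity),
    hs]

theorem e_eq_one_iff (t : ℝ) : e t = 1 ↔ ∃ j : ℤ, t = j := by
  rw [e, Circle.exp_eq_one]
  refine exists_congr fun j => ?_
  have : (2 * Real.pi) ≠ 0 := by positivity
  constructor
  · intro h
    apply mul_left_cancel₀ this
    rw [h]; ring
  · rintro rfl; ring

/-- A function on the circle in the angular coordinate. -/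
theorem analyticOnNhd_comp_e {f : Circle → ℂ} (hf : IsRealAnalytic f) :
    AnalyticOnNhd ℝ (fun t => f (e t)) Set.univ := by
  have h1 : AnalyticOnNhd ℝ (fun t : ℝ => 2 * Real.pi * t) Set.univ :=
    analyticOnNhd_const.mul analyticOnNhd_id
  exact AnalyticOnNhd.comp (g := fun t : ℝ => f (Circle.exp t)) hf h1 (Set.mapsTo_univ _ _)

theorem comp_e_ne_zero {f : Circle → ℂ} (hf0 : f ≠ 0) : (fun t => f (e t)) ≠ 0 := by
  intro h
  refine hf0 (funext fun u => ?_)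
  obtain ⟨t, _, rfl⟩ := exists_e_eq u
  exact congrFun h t

theorem continuous_of_isRealAnalytic {f : Circle → ℂ} (hf : IsRealAnalytic f) : Continuous f := by
  have h1 : Continuous fun t : ℝ => f (Circle.exp t) := continuous_iff_continuousAt.2 fun t =>
    (hf t (Set.mem_univ t)).continuousAt
  exact (Circle.isCoveringMap_exp.isQuotientMap fun u => ⟨_, Circle.exp_arg u⟩).continuous_iff.2 h1

/-- Lower bound for `f` along the orbit of an angle of finite type, when the zeros of `f` are roots
of unity. -/
theorem exists_le_norm_orbit {f : Circle → ℂ} (hf : IsRealAnalytic f) (hf0 : f ≠ 0)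
    (hroots : ∀ u : Circle, f u = 0 → ∃ m : ℕ, 0 < m ∧ u ^ m = 1) {φ : ℝ} (hφ : IsFiniteType φ)
    {ρ : ℕ} (hρ : 0 < ρ) (k : ℕ) :
    ∃ c > 0, ∃ A : ℝ, 0 ≤ A ∧ ∀ m : ℕ, 1 ≤ m →
      c * (m : ℝ) ^ (-A) ≤ ‖f (e (m * φ + (k : ℝ) / ρ))‖ := by
  obtain ⟨-, K, hK, γ, hγ, hfin⟩ := hφ
  have hg := analyticOnNhd_comp_e hf
  have hg0 := comp_e_ne_zero hf0
  have hgc : Continuous fun t => f (e t) := (continuous_of_isRealAnalytic hf).comp continuous_e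
  have hρ' : (0 : ℝ) < ρ := by exact_mod_cast hρ
  -- The integer translate brings the angle into `[0, 1]`; the bound is then proved locally and
  -- glued by compactness.
  suffices H : ∃ c > 0, ∃ A : ℝ, 0 ≤ A ∧ ∀ m : ℕ, 1 ≤ m → ∀ j : ℤ,
      m * φ + (k : ℝ) / ρ - j ∈ Set.Icc (0 : ℝ) 1 →
      c * (m : ℝ) ^ (-A) ≤ ‖f (e (m * φ + (k : ℝ) / ρ - j))‖ by
    obtain ⟨c, hc, A, hA, h⟩ := H
    refine ⟨c, hc, A, hA, fun m hm => ?_⟩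
    have h1 := h m hm ⌊m * φ + (k : ℝ) / ρ⌋
      ⟨Int.fract_nonneg (m * φ + (k : ℝ) / ρ), (Int.fract_lt_one _).le⟩
    rwa [← e_add_intCast _ ⌊m * φ + (k : ℝ) / ρ⌋, sub_add_cancel] at h1
  refine isCompact_Icc.induction_on (p := fun s => ∃ c > 0, ∃ A : ℝ, 0 ≤ A ∧ ∀ m : ℕ, 1 ≤ m →
      ∀ j : ℤ, m * φ + (k : ℝ) / ρ - j ∈ s →
      c * (m : ℝ) ^ (-A) ≤ ‖f (e (m * φ + (k : ℝ) / ρ - j))‖) ?_ ?_ ?_ ?_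
  · exact ⟨1, by norm_num, 0, le_rfl, fun _ _ _ h => absurd h (by simp)⟩
  · rintro s t hst ⟨c, hc, A, hA, h⟩
    exact ⟨c, hc, A, hA, fun m hm j hj => h m hm j (hst hj)⟩
  · rintro s t ⟨c, hc, A, hA, h⟩ ⟨c', hc', A', hA', h'⟩
    refine ⟨min c c', lt_min hc hc', max A A', hA.trans (le_max_left _ _), fun m hm j hj => ?_⟩
    have hm' : (1 : ℝ) ≤ m := by exact_mod_cast hm
    rcases hj with hj | hj
    · refine le_trans (mul_le_mul (min_le_left _ _) ?_ (by positivity) hc.le) (h m hm j hj)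
      exact Real.rpow_le_rpow_of_exponent_le hm' (neg_le_neg (le_max_left _ _))
    · refine le_trans (mul_le_mul (min_le_right _ _) ?_ (by positivity) hc'.le) (h' m hm j hj)
      exact Real.rpow_le_rpow_of_exponent_le hm' (neg_le_neg (le_max_right _ _))
  · intro t₀ _
    by_cases ht₀ : f (e t₀) = 0
    · obtain ⟨b, hb, hroot⟩ := hroots _ ht₀
      rw [← e_nat_mul, e_eq_one_iff] at hroot
      obtain ⟨a, ha⟩ := hroot
      obtain ⟨N, c₀, hc₀, hev⟩ := exists_mul_pow_le_norm hg hg0 t₀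
      refine ⟨_, mem_nhdsWithin_of_mem_nhds hev, ?_⟩
      have hb' : (0 : ℝ) < b := by exact_mod_cast hb
      set D : ℝ := b * ρ with hD
      have hD0 : 0 < D := by positivity
      refine ⟨c₀ * (K * D ^ (-γ) / D) ^ N, by positivity, γ * N, by positivity, fun m hm j hj => ?_⟩
      have hm0 : (0 : ℝ) < m := by exact_mod_cast hm
      refine le_trans ?_ hj
      rw [mul_assoc]
      refine mul_le_mul_of_nonneg_left ?_ hc₀.le
      have h1 : (m : ℝ) ^ (-(γ * N)) = ((m : ℝ) ^ (-γ)) ^ N := by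
        rw [← Real.rpow_natCast, ← Real.rpow_mul hm0.le]; congr 1; ring
      rw [h1, ← mul_pow]
      refine pow_le_pow_left₀ (by positivity) ?_ N
      -- The zero `t₀` has denominator `b` and the shift has denominator `ρ`. After multiplication
      -- by `b ρ`, the distance to `t₀` becomes the distance of `b ρ m φ` to an integer, which
      -- finite type bounds below.
      have h2 := hfin ((b * ρ * m : ℕ) : ℤ) (by positivity)
      have h3 : (((b * ρ * m : ℕ) : ℤ) : ℝ) = D * m := by push_cast; rfl
      rw [h3, abs_of_nonneg (by positivity)] at h2
      have h4 := round_le (D * m * φ) (ρ * a - b * k + b * ρ * j : ℤ)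
      have h5 : D * m * φ - ((ρ * a - b * k + b * ρ * j : ℤ) : ℝ) =
          D * (m * φ + (k : ℝ) / ρ - j - t₀) := by
        push_cast
        rw [← ha, hD]
        field_simp
        ring
      rw [h5, abs_mul, abs_of_pos hD0] at h4
      have h6 : K * D ^ (-γ) / D * (m : ℝ) ^ (-γ) = K / (D * m) ^ γ / D := by
        rw [Real.mul_rpow hD0.le hm0.le, Real.rpow_neg hD0.le, Real.rpow_neg hm0.le]
        field_simp
      rw [h6, div_le_iff₀ hD0, mul_comm _ D]
      exact h2.trans h4
    · have hpos : 0 < ‖f (e t₀)‖ := norm_pos_iff.2 ht₀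
      have hev : ∀ᶠ t in 𝓝 t₀, ‖f (e t₀)‖ / 2 < ‖f (e t)‖ :=
        hgc.norm.continuousAt.eventually_const_lt (by linarith)
      refine ⟨_, mem_nhdsWithin_of_mem_nhds hev, ‖f (e t₀)‖ / 2, by positivity, 0, le_rfl,
        fun m hm j hj => ?_⟩
      rw [neg_zero, Real.rpow_zero, mul_one]
      exact le_of_lt hj

/-! ### Periodic functions with mild singularities -/

/-- The function `h` is `1`-periodic and is approximated by Lipschitz functions `G η`, which agree
with it where the control function `ψ` is at least `η`. -/
structure IsTame (h ψ : ℝ → ℝ) (G : ℝ → ℝ → ℝ) : Prop where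
  periodic : Function.Periodic h 1
  measurable : Measurable h
  control_periodic : Function.Periodic ψ 1
  control_nonneg : ∀ t, 0 ≤ ψ t
  control_lipschitz : ∃ Λ, 0 ≤ Λ ∧ ∀ s t, |ψ s - ψ t| ≤ Λ * |s - t|
  control_integrable : ∃ c : ℝ, 0 < c ∧ c ≤ 1 ∧ IntegrableOn (fun t => ψ t ^ (-c)) (Set.Icc 0 1) ∧
    volume (Set.Icc (0 : ℝ) 1 ∩ {t | ψ t = 0}) = 0
  bound : ∀ ε : ℝ, 0 < ε → ∃ C : ℝ, 0 ≤ C ∧ ∀ t, ψ t ≠ 0 → |h t| ≤ C * ψ t ^ (-ε)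
  approx_periodic : ∀ η, Function.Periodic (G η) 1
  approx_lipschitz : ∃ (C : ℝ) (κ : ℕ), 0 ≤ C ∧
    ∀ η, 0 < η → η ≤ 1 → ∀ s t, |G η s - G η t| ≤ C / η ^ κ * |s - t|
  approx_eq : ∀ η, 0 < η → η ≤ 1 → ∀ t, η ≤ ψ t → G η t = h t
  approx_bound : ∀ ε : ℝ, 0 < ε → ∃ C : ℝ, 0 ≤ C ∧ ∀ η : ℝ, 0 < η → η ≤ 1 → ∀ t, |G η t| ≤ C * η ^ (-ε)

theorem apply_fract_of_periodic {β : Type*} {g : ℝ → β} (h : Function.Periodic g 1) (t : ℝ) :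
    g (Int.fract t) = g t := by
  have := h.sub_zsmul_eq (x := t) ⌊t⌋
  rw [zsmul_one] at this
  exact this

theorem exists_lipschitz_of_periodic {g : ℝ → ℂ} (hg : AnalyticOnNhd ℝ g Set.univ)
    (hper : Function.Periodic g 1) : ∃ Λ, 0 ≤ Λ ∧ ∀ s t, ‖g s - g t‖ ≤ Λ * |s - t| := by
  have hdiff : Differentiable ℝ g := fun t => (hg t (Set.mem_univ t)).differentiableAt
  have hdc : Continuous (deriv g) := continuous_iff_continuousAt.2 fun t =>
    (hg.deriv t (Set.mem_univ t)).continuousAt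
  obtain ⟨Λ, hΛ⟩ := isCompact_Icc.exists_bound_of_continuousOn (s := Set.Icc (0 : ℝ) 1)
    hdc.continuousOn
  have hdper : Function.Periodic (deriv g) 1 := fun t => by
    rw [← deriv_comp_add_const]
    congr 1
    exact funext hper
  have hall : ∀ t, ‖deriv g t‖ ≤ Λ := fun t => by
    have h1 : deriv g (Int.fract t) = deriv g t := apply_fract_of_periodic hdper t
    rw [← h1]
    exact hΛ _ ⟨Int.fract_nonneg t, (Int.fract_lt_one t).le⟩
  refine ⟨Λ, (norm_nonneg _).trans (hall 0), fun s t => ?_⟩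
  have := convex_univ.norm_image_sub_le_of_norm_deriv_le (𝕜 := ℝ) (fun t _ => hdiff t)
    (fun t _ => hall t) (Set.mem_univ t) (Set.mem_univ s)
  simpa using this

theorem exists_bound_of_periodic {g : ℝ → ℂ} (hg : Continuous g)
    (hper : Function.Periodic g 1) : ∃ B, 1 ≤ B ∧ ∀ t, ‖g t‖ ≤ B := by
  obtain ⟨B, hB⟩ := isCompact_Icc.exists_bound_of_continuousOn (s := Set.Icc (0 : ℝ) 1)
    hg.continuousOn
  refine ⟨max B 1, le_max_right _ _, fun t => ?_⟩
  have h1 : g (Int.fract t) = g t := apply_fract_of_periodic hper t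
  rw [← h1]
  exact (hB _ ⟨Int.fract_nonneg t, (Int.fract_lt_one t).le⟩).trans (le_max_left _ _)

/-! ### Tameness of the logarithm of the modulus and of the argument -/

theorem abs_log_sub_log_le {a b η : ℝ} (hη : 0 < η) (ha : η ≤ a) (hb : η ≤ b) :
    |Real.log a - Real.log b| ≤ |a - b| / η := by
  have key : ∀ a b : ℝ, η ≤ a → η ≤ b → Real.log a - Real.log b ≤ |a - b| / η := by
    intro a b ha hb
    have ha0 : 0 < a := hη.trans_le ha
    have hb0 : 0 < b := hη.trans_le hb
    rw [← Real.log_div ha0.ne' hb0.ne']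
    refine (Real.log_le_sub_one_of_pos (by positivity)).trans ?_
    rw [div_sub_one hb0.ne']
    calc (a - b) / b ≤ |a - b| / b := div_le_div_of_nonneg_right (le_abs_self _) hb0.le
      _ ≤ |a - b| / η := div_le_div_of_nonneg_left (abs_nonneg _) hη hb
  rw [abs_sub_le_iff]
  refine ⟨key a b ha hb, ?_⟩
  rw [abs_sub_comm]
  exact key b a hb ha

/-- Below `1` the function `|log y| y^ε` is at most `1 / ε`; between `1` and `B` one has `log y ≤
y^ε / ε`, and the second factor `y^ε` accounts for the exponent `2 ε` of `B`. -/
theorem abs_log_le_mul_rpow_neg {B ε : ℝ} (hB : 1 ≤ B) (hε : 0 < ε) {y : ℝ} (hy : 0 < y)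
    (hyB : y ≤ B) : |Real.log y| ≤ B ^ (2 * ε) / ε * y ^ (-ε) := by
  have hB1 : 1 ≤ B ^ (2 * ε) := Real.one_le_rpow hB (by positivity)
  have hyε : 0 < y ^ ε := by positivity
  rw [Real.rpow_neg hy.le, ← div_eq_mul_inv, le_div_iff₀ hyε]
  rcases le_total y 1 with h | h
  · have h1 := (Real.abs_log_mul_self_rpow_lt y ε hy h hε).le
    rw [abs_mul, abs_of_pos hyε] at h1
    exact h1.trans (div_le_div_of_nonneg_right hB1 hε.le)
  · rw [abs_of_nonneg (Real.log_nonneg h)]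
    have h1 := Real.log_le_rpow_div hy.le hε
    have h2 : y ^ ε * y ^ ε ≤ B ^ (2 * ε) := by
      rw [← Real.rpow_add hy, ← two_mul]
      exact Real.rpow_le_rpow hy.le hyB (by positivity)
    calc Real.log y * y ^ ε ≤ y ^ ε / ε * y ^ ε := mul_le_mul_of_nonneg_right h1 hyε.le
      _ = y ^ ε * y ^ ε / ε := by ring
      _ ≤ _ := div_le_div_of_nonneg_right h2 hε.le

theorem le_mul_rpow_neg {B ε y : ℝ} (hε : 0 < ε) (hy : 0 < y) (hyB : y ≤ B) :
    1 ≤ B ^ ε * y ^ (-ε) := by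
  rw [Real.rpow_neg hy.le, ← div_eq_mul_inv, one_le_div (by positivity)]
  exact Real.rpow_le_rpow hy.le hyB hε.le

/-- The control is the modulus itself, and the approximation replaces it by its maximum with `η`.
The only singularities are the zeros of `g`, of finite order by analyticity. -/
theorem isTame_log {g : ℝ → ℂ} (hg : AnalyticOnNhd ℝ g Set.univ) (hper : Function.Periodic g 1)
    (hg0 : g ≠ 0) :
    IsTame (fun t => Real.log ‖g t‖) (fun t => ‖g t‖) (fun η t => Real.log (max ‖g t‖ η)) := by
  have hgc : Continuous g := continuous_iff_continuousAt.2 fun t =>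
    (hg t (Set.mem_univ t)).continuousAt
  obtain ⟨Λ, hΛ, hlip⟩ := exists_lipschitz_of_periodic hg hper
  obtain ⟨B, hB, hBg⟩ := exists_bound_of_periodic hgc hper
  refine ⟨fun t => by simp only [hper t], Real.measurable_log.comp hgc.norm.measurable,
    fun t => by simp only [hper t], fun t => norm_nonneg _,
    ⟨Λ, hΛ, fun s t => (abs_norm_sub_norm_le _ _).trans (hlip s t)⟩, ?_, ?_,
    fun η t => by simp only [hper t], ⟨Λ, 1, hΛ, ?_⟩, ?_, ?_⟩
  · obtain ⟨c, h1, h2, h3, h4⟩ := exists_integrableOn_norm_rpow_neg hg hg0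
    exact ⟨c, h1, h2, h3, by simpa using h4⟩
  · intro ε hε
    refine ⟨B ^ (2 * ε) / ε, by positivity, fun t ht => ?_⟩
    exact abs_log_le_mul_rpow_neg hB hε ((norm_nonneg _).lt_of_ne' ht) (hBg t)
  · intro η hη hη1 s t
    refine (abs_log_sub_log_le hη (le_max_right _ _) (le_max_right _ _)).trans ?_
    have h1 : |max ‖g s‖ η - max ‖g t‖ η| ≤ Λ * |s - t| :=
      (abs_max_sub_max_le_abs _ _ _).trans ((abs_norm_sub_norm_le _ _).trans (hlip s t))
    calc _ ≤ Λ * |s - t| / η := div_le_div_of_nonneg_right h1 hη.le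
      _ = Λ / η ^ 1 * |s - t| := by ring
  · intro η _ _ t ht
    simp only [max_eq_left ht]
  · intro ε hε
    refine ⟨B ^ (2 * ε) / ε, by positivity, fun η hη hη1 t => ?_⟩
    refine (abs_log_le_mul_rpow_neg hB hε (hη.trans_le (le_max_right _ _))
      (max_le (hBg t) (hη1.trans hB))).trans ?_
    refine mul_le_mul_of_nonneg_left ?_ (by positivity)
    exact Real.rpow_le_rpow_of_nonpos hη (le_max_right _ _) (by linarith)

/-- A formula in terms of `re / im`, smooth on the half plane, including across the imaginary axis;
a truncation of `im` then makes it Lipschitz. -/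
theorem arg_of_im_pos' {w : ℂ} (hw : 0 < w.im) :
    w.arg = Real.pi / 2 - Real.arctan (w.re / w.im) := by
  set α := Real.arctan (w.re / w.im) with hα
  have h1 := Real.neg_pi_div_two_lt_arctan (w.re / w.im)
  have h2 := Real.arctan_lt_pi_div_two (w.re / w.im)
  have hcos : 0 < Real.cos α := Real.cos_arctan_pos _
  have htan : Real.tan α = w.re / w.im := Real.tan_arctan _
  have hr : 0 < w.im / Real.cos α := by positivity
  have key := Complex.arg_mul_cos_add_sin_mul_I hr (θ := Real.pi / 2 - α)
    ⟨by linarith [Real.pi_pos], by linarith⟩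
  rw [← key]
  congr 1
  have hsin : w.im / Real.cos α * Real.sin α = w.re := by
    rw [Real.tan_eq_sin_div_cos] at htan
    field_simp at htan ⊢
    linarith
  rw [← Complex.ofReal_cos, ← Complex.ofReal_sin, Real.cos_pi_div_two_sub, Real.sin_pi_div_two_sub]
  apply Complex.ext
  · simp only [Complex.add_re, Complex.ofReal_re, Complex.mul_re,
      Complex.I_re, Complex.I_im, Complex.ofReal_im, mul_zero, zero_mul, sub_zero, add_zero]
    exact hsin.symm
  · simp only [Complex.add_im, Complex.ofReal_re, Complex.mul_im,
      Complex.I_re, Complex.I_im, Complex.ofReal_im, mul_zero, mul_one, zero_add, zero_mul, add_zero]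
    field_simp

theorem arg_of_im_neg' {w : ℂ} (hw : w.im < 0) :
    w.arg = -(Real.pi / 2) - Real.arctan (w.re / w.im) := by
  have h1 : 0 < ((starRingEnd ℂ) w).im := by simpa using hw
  have h2 := arg_of_im_pos' h1
  have h3 : w.arg ≠ Real.pi := by
    rw [Ne, Complex.arg_eq_pi_iff]
    exact fun h => hw.ne h.2
  rw [Complex.arg_conj, if_neg h3, Complex.conj_re, Complex.conj_im, div_neg, Real.arctan_neg] at h2
  linarith

theorem abs_arctan_sub_arctan_le (a b : ℝ) : |Real.arctan a - Real.arctan b| ≤ |a - b| := by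
  have := convex_univ.norm_image_sub_le_of_norm_deriv_le (𝕜 := ℝ) (f := Real.arctan) (C := 1)
    (fun t _ => Real.differentiableAt_arctan t) (fun t _ => by
      rw [Real.deriv_arctan, Real.norm_of_nonneg (by positivity), div_le_one (by positivity)]
      nlinarith [sq_nonneg t]) (Set.mem_univ b) (Set.mem_univ a)
  simpa using this

/-- The function `y ↦ 1 / y`, made Lipschitz by truncation at scale `η`. -/
noncomputable def truncInv (η y : ℝ) : ℝ := y / (max |y| η) ^ 2

theorem truncInv_of_le {η y : ℝ} (hη : 0 < η) (h : η ≤ |y|) : truncInv η y = 1 / y := by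
  have : y ≠ 0 := abs_pos.1 (hη.trans_le h)
  rw [truncInv, max_eq_left h, sq_abs]
  field_simp

theorem abs_truncInv_le {η : ℝ} (hη : 0 < η) (y : ℝ) : |truncInv η y| ≤ 1 / η := by
  have h1 : η ≤ max |y| η := le_max_right _ _
  have h2 : |y| ≤ max |y| η := le_max_left _ _
  have h3 : 0 < max |y| η := hη.trans_le h1
  rw [truncInv, abs_div, abs_of_nonneg (by positivity : 0 ≤ max |y| η ^ 2), div_le_div_iff₀
    (by positivity) hη]
  nlinarith [abs_nonneg y]

theorem abs_truncInv_sub_le {η : ℝ} (hη : 0 < η) (a b : ℝ) :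
    |truncInv η a - truncInv η b| ≤ 3 * |a - b| / η ^ 2 := by
  unfold truncInv
  set A := max |a| η with hA
  set D := max |b| η with hD
  have hA1 : η ≤ A := le_max_right _ _
  have hD1 : η ≤ D := le_max_right _ _
  have hA0 : 0 < A := hη.trans_le hA1
  have hD0 : 0 < D := hη.trans_le hD1
  have hDb : |b| ≤ D := le_max_left _ _
  have hDA : |D - A| ≤ |a - b| := by
    rw [abs_sub_comm]
    exact (abs_max_sub_max_le_abs _ _ _).trans (abs_abs_sub_abs_le a b)
  -- The factor `b / D` is at most `1` in modulus, so the bound does not depend on the size of `b`.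
  have h1 : a / A ^ 2 - b / D ^ 2 =
      (a - b) * (1 / A ^ 2) + b / D * ((D - A) * (1 / A ^ 2 + 1 / (A * D))) := by
    field_simp
    ring
  have h2 : 1 / A ^ 2 ≤ 1 / η ^ 2 := by gcongr
  have h3 : 1 / (A * D) ≤ 1 / η ^ 2 := by
    rw [pow_two]
    gcongr
  have h4 : |b / D| ≤ 1 := by
    rw [abs_div, abs_of_pos hD0, div_le_one hD0]; exact hDb
  rw [h1]
  refine (abs_add_le _ _).trans ?_
  have h5 : |(a - b) * (1 / A ^ 2)| ≤ |a - b| * (1 / η ^ 2) := by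
    rw [abs_mul, abs_of_nonneg (by positivity : 0 ≤ 1 / A ^ 2)]
    exact mul_le_mul_of_nonneg_left h2 (abs_nonneg _)
  have h6 : |b / D * ((D - A) * (1 / A ^ 2 + 1 / (A * D)))| ≤ 1 * (|a - b| * (2 * (1 / η ^ 2))) := by
    rw [abs_mul, abs_mul, abs_of_nonneg (by positivity : 0 ≤ 1 / A ^ 2 + 1 / (A * D))]
    refine mul_le_mul h4 (mul_le_mul hDA (by linarith) (by positivity) (abs_nonneg _))
      (by positivity) zero_le_one
  calc _ ≤ |a - b| * (1 / η ^ 2) + 1 * (|a - b| * (2 * (1 / η ^ 2))) := add_le_add h5 h6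
    _ = _ := by ring

/-- The sign function, made Lipschitz by truncation at scale `η`. -/
noncomputable def truncSign (η y : ℝ) : ℝ := max (min (y / η) 1) (-1)

theorem truncSign_of_le {η y : ℝ} (hη : 0 < η) (h : η ≤ y) : truncSign η y = 1 := by
  have : 1 ≤ y / η := by rwa [one_le_div hη]
  rw [truncSign, min_eq_right this, max_eq_left (by norm_num)]

theorem truncSign_of_le_neg {η y : ℝ} (hη : 0 < η) (h : y ≤ -η) : truncSign η y = -1 := by
  have : y / η ≤ -1 := by rw [div_le_iff₀ hη]; linarith
  rw [truncSign, max_eq_right (min_le_of_left_le this)]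

theorem abs_truncSign_le (η y : ℝ) : |truncSign η y| ≤ 1 :=
  abs_le.2 ⟨le_max_right _ _, max_le (min_le_right _ _) (by norm_num)⟩

theorem abs_truncSign_sub_le {η : ℝ} (hη : 0 < η) (a b : ℝ) :
    |truncSign η a - truncSign η b| ≤ |a - b| / η := by
  refine (abs_max_sub_max_le_abs _ _ _).trans ((abs_min_sub_min_le_max _ _ _ _).trans ?_)
  rw [sub_self, abs_zero, max_eq_left (abs_nonneg _), ← sub_div, abs_div, abs_of_pos hη]

/-- The argument is bounded, so only its jumps matter. They are controlled by a real analytic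
function `r` that is not identically zero, for which the real or the imaginary part of `g` will be
taken. -/
theorem isTame_arg_aux {g : ℝ → ℂ} {r : ℝ → ℝ} {G : ℝ → ℝ → ℝ}
    (hg : AnalyticOnNhd ℝ g Set.univ) (hper : Function.Periodic g 1)
    (hr : AnalyticOnNhd ℝ r Set.univ) (hr0 : r ≠ 0) (hrper : Function.Periodic r 1)
    (hrlip : ∀ s t, |r s - r t| ≤ ‖g s - g t‖) (hrg : ∀ t, |r t| ≤ ‖g t‖)
    (hGper : ∀ η, Function.Periodic (G η) 1)
    (hGlip : ∃ C, 0 ≤ C ∧ ∀ η, 0 < η → η ≤ 1 → ∀ s t, |G η s - G η t| ≤ C / η ^ 2 * ‖g s - g t‖)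
    (hGeq : ∀ η, 0 < η → η ≤ 1 → ∀ t, η ≤ |r t| → G η t = (g t).arg)
    (hGb : ∀ η, 0 < η → η ≤ 1 → ∀ t, |G η t| ≤ Real.pi) :
    IsTame (fun t => (g t).arg) (fun t => |r t|) G := by
  have hgc : Continuous g := continuous_iff_continuousAt.2 fun t =>
    (hg t (Set.mem_univ t)).continuousAt
  obtain ⟨Λ, hΛ, hlip⟩ := exists_lipschitz_of_periodic hg hper
  obtain ⟨B, hB, hBg⟩ := exists_bound_of_periodic hgc hper
  refine ⟨fun t => by simp only [hper t], Complex.measurable_arg.comp hgc.measurable,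
    fun t => by simp only [hrper t], fun t => abs_nonneg _, ⟨Λ, hΛ, fun s t =>
      (abs_abs_sub_abs_le _ _).trans ((hrlip s t).trans (hlip s t))⟩, ?_, ?_, hGper, ?_, hGeq, ?_⟩
  · obtain ⟨c, h1, h2, h3, h4⟩ := exists_integrableOn_norm_rpow_neg hr hr0
    exact ⟨c, h1, h2, h3, by simpa using h4⟩
  · intro ε hε
    refine ⟨Real.pi * B ^ ε, by positivity, fun t ht => (Complex.abs_arg_le_pi _).trans ?_⟩
    rw [mul_assoc]
    exact le_mul_of_one_le_right Real.pi_pos.le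
      (le_mul_rpow_neg hε ((abs_nonneg _).lt_of_ne' ht) ((hrg t).trans (hBg t)))
  · obtain ⟨C, hC, h⟩ := hGlip
    refine ⟨C * Λ, 2, by positivity, fun η hη hη1 s t => (h η hη hη1 s t).trans ?_⟩
    calc C / η ^ 2 * ‖g s - g t‖ ≤ C / η ^ 2 * (Λ * |s - t|) :=
          mul_le_mul_of_nonneg_left (hlip s t) (by positivity)
      _ = _ := by ring
  · intro ε hε
    refine ⟨Real.pi, Real.pi_pos.le, fun η hη hη1 t => (hGb η hη hη1 t).trans ?_⟩
    exact le_mul_of_one_le_right Real.pi_pos.le (Real.one_le_rpow_of_pos_of_le_one_of_nonpos hη hη1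
      (by linarith))

/-- Off the real line the argument is `(π / 2) sign (im) - arctan (re / im)`, and truncating the
sign and the inverse gives Lipschitz approximations. If `g` is real valued this degenerates, and the
argument is `(π / 2) (1 - sign (re))`. -/
theorem exists_isTame_arg {g : ℝ → ℂ} (hg : AnalyticOnNhd ℝ g Set.univ)
    (hper : Function.Periodic g 1) (hg0 : g ≠ 0) :
    ∃ ψ G, IsTame (fun t => (g t).arg) ψ G := by
  have hgc : Continuous g := continuous_iff_continuousAt.2 fun t =>
    (hg t (Set.mem_univ t)).continuousAt
  obtain ⟨B, hB, hBg⟩ := exists_bound_of_periodic hgc hper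
  have hre : AnalyticOnNhd ℝ (fun t => (g t).re) Set.univ := fun t ht =>
    (Complex.reCLM.analyticAt _).comp (hg t ht)
  have him : AnalyticOnNhd ℝ (fun t => (g t).im) Set.univ := fun t ht =>
    (Complex.imCLM.analyticAt _).comp (hg t ht)
  have hrelip : ∀ s t, |(g s).re - (g t).re| ≤ ‖g s - g t‖ := fun s t => by
    rw [← Complex.sub_re]; exact Complex.abs_re_le_norm _
  have himlip : ∀ s t, |(g s).im - (g t).im| ≤ ‖g s - g t‖ := fun s t => by
    rw [← Complex.sub_im]; exact Complex.abs_im_le_norm _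
  by_cases h0 : (fun t => (g t).im) = 0
  · have hreal : ∀ t, (g t).im = 0 := fun t => congrFun h0 t
    refine ⟨fun t => |(g t).re|, fun η t => Real.pi / 2 * (1 - truncSign η (g t).re),
      isTame_arg_aux hg hper hre ?_ (fun t => by simp only [hper t]) hrelip
        (fun t => Complex.abs_re_le_norm _) (fun η t => by simp only [hper t])
        ⟨Real.pi / 2, by positivity, ?_⟩ ?_ ?_⟩
    · intro h
      exact hg0 (funext fun t => Complex.ext (congrFun h t) (hreal t))
    · intro η hη hη1 s t
      have h1 := abs_truncSign_sub_le hη (g t).re (g s).re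
      have h2 : Real.pi / 2 * (1 - truncSign η (g s).re) - Real.pi / 2 * (1 - truncSign η (g t).re) =
          Real.pi / 2 * (truncSign η (g t).re - truncSign η (g s).re) := by ring
      rw [h2, abs_mul, abs_of_nonneg (by positivity)]
      calc Real.pi / 2 * |truncSign η (g t).re - truncSign η (g s).re|
          ≤ Real.pi / 2 * (‖g s - g t‖ / η) := by
            refine mul_le_mul_of_nonneg_left (h1.trans ?_) (by positivity)
            refine div_le_div_of_nonneg_right ?_ hη.le
            rw [abs_sub_comm]
            exact hrelip s t
        _ = Real.pi / 2 / η * ‖g s - g t‖ := by ring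
        _ ≤ _ := mul_le_mul_of_nonneg_right
          (div_le_div_of_nonneg_left (by positivity) (by positivity) (by nlinarith)) (norm_nonneg _)
    · intro η hη hη1 t ht
      rcases le_total 0 (g t).re with h | h
      · rw [abs_of_nonneg h] at ht
        rw [truncSign_of_le hη ht, Complex.arg_eq_zero_iff.2 ⟨h, hreal t⟩]
        ring
      · rw [abs_of_nonpos h] at ht
        rw [truncSign_of_le_neg hη (by linarith),
          Complex.arg_eq_pi_iff.2 ⟨by linarith, hreal t⟩]
        ring
    · intro η _ _ t
      have h1 := abs_le.1 (abs_truncSign_le η (g t).re)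
      rw [abs_of_nonneg (mul_nonneg (by positivity) (by linarith [h1.2]))]
      nlinarith [Real.pi_pos]
  · refine ⟨fun t => |(g t).im|, fun η t => Real.pi / 2 * truncSign η (g t).im -
      Real.arctan ((g t).re * truncInv η (g t).im),
      isTame_arg_aux hg hper him h0 (fun t => by simp only [hper t]) himlip
        (fun t => Complex.abs_im_le_norm _) (fun η t => by simp only [hper t])
        ⟨Real.pi / 2 + 1 + 3 * B, by positivity, ?_⟩ ?_ ?_⟩
    · intro η hη hη1 s t
      set N := ‖g s - g t‖ with hN
      have hηη : 1 / η ≤ 1 / η ^ 2 := by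
        apply one_div_le_one_div_of_le (by positivity)
        nlinarith
      have hN0 : 0 ≤ N := norm_nonneg _
      have h1 : |truncSign η (g s).im - truncSign η (g t).im| ≤ N * (1 / η ^ 2) :=
        (abs_truncSign_sub_le hη _ _).trans (by
          rw [div_eq_mul_one_div]
          exact mul_le_mul (himlip s t) hηη (by positivity) hN0)
      have h2 : |(g s).re * truncInv η (g s).im - (g t).re * truncInv η (g t).im| ≤
          N * (1 / η ^ 2) + B * (3 * N * (1 / η ^ 2)) := by
        have h3 : (g s).re * truncInv η (g s).im - (g t).re * truncInv η (g t).im =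
            ((g s).re - (g t).re) * truncInv η (g s).im +
              (g t).re * (truncInv η (g s).im - truncInv η (g t).im) := by ring
        rw [h3]
        refine (abs_add_le _ _).trans (add_le_add ?_ ?_)
        · rw [abs_mul]
          exact mul_le_mul (hrelip s t) ((abs_truncInv_le hη _).trans hηη) (abs_nonneg _) hN0
        · rw [abs_mul]
          refine mul_le_mul ((Complex.abs_re_le_norm _).trans (hBg t)) ?_ (abs_nonneg _)
            (by linarith)
          refine (abs_truncInv_sub_le hη _ _).trans ?_
          rw [div_eq_mul_one_div]
          refine mul_le_mul_of_nonneg_right ?_ (by positivity)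
          linarith [himlip s t]
      have h4 := (abs_arctan_sub_arctan_le ((g s).re * truncInv η (g s).im)
        ((g t).re * truncInv η (g t).im)).trans h2
      have h5 : Real.pi / 2 * truncSign η (g s).im - Real.arctan ((g s).re * truncInv η (g s).im) -
          (Real.pi / 2 * truncSign η (g t).im - Real.arctan ((g t).re * truncInv η (g t).im)) =
          Real.pi / 2 * (truncSign η (g s).im - truncSign η (g t).im) -
            (Real.arctan ((g s).re * truncInv η (g s).im) -
              Real.arctan ((g t).re * truncInv η (g t).im)) := by ring
      rw [h5]
      refine (abs_sub _ _).trans ?_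
      rw [abs_mul, abs_of_nonneg (by positivity : 0 ≤ Real.pi / 2)]
      have h6 := mul_le_mul_of_nonneg_left h1 (by positivity : 0 ≤ Real.pi / 2)
      calc _ ≤ Real.pi / 2 * (N * (1 / η ^ 2)) + (N * (1 / η ^ 2) + B * (3 * N * (1 / η ^ 2))) :=
            add_le_add h6 h4
        _ = _ := by ring
    · intro η hη hη1 t ht
      rw [truncInv_of_le hη ht, mul_one_div]
      rcases le_total 0 (g t).im with h | h
      · rw [abs_of_nonneg h] at ht
        rw [truncSign_of_le hη ht, arg_of_im_pos' (by linarith)]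
        ring
      · rw [abs_of_nonpos h] at ht
        rw [truncSign_of_le_neg hη (by linarith), arg_of_im_neg' (by linarith)]
        ring
    · intro η _ _ t
      have h1 := abs_le.1 (abs_truncSign_le η (g t).im)
      have h2 := Real.neg_pi_div_two_lt_arctan ((g t).re * truncInv η (g t).im)
      have h3 := Real.arctan_lt_pi_div_two ((g t).re * truncInv η (g t).im)
      rw [abs_le]
      constructor <;> nlinarith [Real.pi_pos]

/-! ### Closure properties and integrability of tame functions -/

namespace IsTame

variable {h h' ψ : ℝ → ℝ} {G G' : ℝ → ℝ → ℝ}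

theorem abs (H : IsTame h ψ G) : IsTame (fun t => |h t|) ψ (fun η t => |G η t|) where
  periodic t := by simp only [H.periodic t]
  measurable := H.measurable.abs
  control_periodic := H.control_periodic
  control_nonneg := H.control_nonneg
  control_lipschitz := H.control_lipschitz
  control_integrable := H.control_integrable
  bound := by simpa using H.bound
  approx_periodic η t := by simp only [H.approx_periodic η t]
  approx_lipschitz := by
    obtain ⟨C, κ, hC, h⟩ := H.approx_lipschitz
    exact ⟨C, κ, hC, fun η hη hη1 s t => (abs_abs_sub_abs_le _ _).trans (h η hη hη1 s t)⟩
  approx_eq η hη hη1 t ht := by rw [H.approx_eq η hη hη1 t ht]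
  approx_bound := by simpa using H.approx_bound

/-- Growth below every negative power of the control is stable under products, by halving `ε`. This
is why the bounds in `IsTame` are required for every `ε`. -/
theorem mul (H : IsTame h ψ G) (H' : IsTame h' ψ G') :
    IsTame (fun t => h t * h' t) ψ (fun η t => G η t * G' η t) where
  periodic t := by simp only [H.periodic t, H'.periodic t]
  measurable := H.measurable.mul H'.measurable
  control_periodic := H.control_periodic
  control_nonneg := H.control_nonneg
  control_lipschitz := H.control_lipschitz
  control_integrable := H.control_integrable
  bound ε hε := by
    obtain ⟨C, hC, hb⟩ := H.bound (ε / 2) (half_pos hε)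
    obtain ⟨C', hC', hb'⟩ := H'.bound (ε / 2) (half_pos hε)
    refine ⟨C * C', by positivity, fun t ht => ?_⟩
    have hpos := (H.control_nonneg t).lt_of_ne' ht
    have h1 : ψ t ^ (-ε) = ψ t ^ (-(ε / 2)) * ψ t ^ (-(ε / 2)) := by
      rw [← Real.rpow_add hpos]; congr 1; ring
    calc |h t * h' t| = |h t| * |h' t| := abs_mul _ _
      _ ≤ (C * ψ t ^ (-(ε / 2))) * (C' * ψ t ^ (-(ε / 2))) :=
        mul_le_mul (hb t ht) (hb' t ht) (abs_nonneg _) (by positivity)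
      _ = _ := by rw [h1]; ring
  approx_periodic η t := by simp only [H.approx_periodic η t, H'.approx_periodic η t]
  approx_lipschitz := by
    obtain ⟨C, κ, hC, hl⟩ := H.approx_lipschitz
    obtain ⟨C', κ', hC', hl'⟩ := H'.approx_lipschitz
    obtain ⟨B, hB, hb⟩ := H.approx_bound 1 one_pos
    obtain ⟨B', hB', hb'⟩ := H'.approx_bound 1 one_pos
    -- The extra `1` comes from bounding one approximation by a multiple of `η⁻¹` in the product
    -- rule.
    refine ⟨B * C' + B' * C, κ + κ' + 1, by positivity, fun η hη hη1 s t => ?_⟩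
    have h1 := hb η hη hη1 s
    have h2 := hb' η hη hη1 t
    rw [Real.rpow_neg_one] at h1 h2
    have h3 : G η s * G' η s - G η t * G' η t =
        G η s * (G' η s - G' η t) + G' η t * (G η s - G η t) := by ring
    have hp : ∀ i j : ℕ, i ≤ j → 1 / η ^ i ≤ 1 / η ^ j := fun i j hij =>
      one_div_le_one_div_of_le (by positivity) (pow_le_pow_of_le_one hη.le hη1 hij)
    rw [h3]
    refine (abs_add_le _ _).trans ?_
    rw [abs_mul, abs_mul]
    have h4 : |G η s| * |G' η s - G' η t| ≤ (B * η⁻¹) * (C' / η ^ κ' * |s - t|) :=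
      mul_le_mul h1 (hl' η hη hη1 s t) (abs_nonneg _) (by positivity)
    have h5 : |G' η t| * |G η s - G η t| ≤ (B' * η⁻¹) * (C / η ^ κ * |s - t|) :=
      mul_le_mul h2 (hl η hη hη1 s t) (abs_nonneg _) (by positivity)
    have e1 : (B * η⁻¹) * (C' / η ^ κ' * |s - t|) = B * C' * |s - t| * (1 / η ^ (κ' + 1)) := by
      field_simp
      ring
    have e2 : (B' * η⁻¹) * (C / η ^ κ * |s - t|) = B' * C * |s - t| * (1 / η ^ (κ + 1)) := by
      field_simp
      ring
    rw [e1] at h4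
    rw [e2] at h5
    calc _ ≤ B * C' * |s - t| * (1 / η ^ (κ' + 1)) + B' * C * |s - t| * (1 / η ^ (κ + 1)) :=
          add_le_add h4 h5
      _ ≤ B * C' * |s - t| * (1 / η ^ (κ + κ' + 1)) + B' * C * |s - t| * (1 / η ^ (κ + κ' + 1)) :=
          add_le_add
            (mul_le_mul_of_nonneg_left (hp _ _ (by omega)) (by positivity))
            (mul_le_mul_of_nonneg_left (hp _ _ (by omega)) (by positivity))
      _ = _ := by ring
  approx_eq η hη hη1 t ht := by simp only [H.approx_eq η hη hη1 t ht, H'.approx_eq η hη hη1 t ht]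
  approx_bound ε hε := by
    obtain ⟨C, hC, hb⟩ := H.approx_bound (ε / 2) (half_pos hε)
    obtain ⟨C', hC', hb'⟩ := H'.approx_bound (ε / 2) (half_pos hε)
    refine ⟨C * C', by positivity, fun η hη hη1 t => ?_⟩
    have h1 : η ^ (-ε) = η ^ (-(ε / 2)) * η ^ (-(ε / 2)) := by
      rw [← Real.rpow_add hη]; congr 1; ring
    calc |G η t * G' η t| = |G η t| * |G' η t| := abs_mul _ _
      _ ≤ (C * η ^ (-(ε / 2))) * (C' * η ^ (-(ε / 2))) :=
        mul_le_mul (hb η hη hη1 t) (hb' η hη hη1 t) (abs_nonneg _) (by positivity)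
      _ = _ := by rw [h1]; ring

theorem sq (H : IsTame h ψ G) : ∃ G', IsTame (fun t => h t ^ 2) ψ G' :=
  ⟨_, by simpa only [pow_two] using H.mul H⟩

theorem abs_pow_three (H : IsTame h ψ G) : ∃ G', IsTame (fun t => |h t| ^ 3) ψ G' :=
  ⟨_, by simpa only [pow_succ, pow_zero, one_mul] using (H.abs.mul H.abs).mul H.abs⟩

theorem ae_ne_zero (H : IsTame h ψ G) : ∀ᵐ t ∂volume.restrict (Set.Icc (0 : ℝ) 1), ψ t ≠ 0 := by
  obtain ⟨c, -, -, -, h0⟩ := H.control_integrable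
  rw [ae_restrict_iff' measurableSet_Icc]
  refine measure_mono_null (fun t ht => ?_) h0
  simp only [Set.mem_compl_iff, Set.mem_ofPred_eq, Classical.not_imp, not_not] at ht
  exact ht

theorem integrableOn (H : IsTame h ψ G) : IntegrableOn h (Set.Icc 0 1) := by
  obtain ⟨c, hc, -, hint, -⟩ := H.control_integrable
  obtain ⟨C, hC, hb⟩ := H.bound c hc
  refine (hint.const_mul C).mono' H.measurable.aestronglyMeasurable ?_
  filter_upwards [H.ae_ne_zero] with t ht
  exact hb t ht

theorem intervalIntegrable (H : IsTame h ψ G) : IntervalIntegrable h volume 0 1 :=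
  (intervalIntegrable_iff_integrableOn_Icc_of_le zero_le_one).2 H.integrableOn

end IsTame

/-! ### Equidistribution of rotations by an angle of finite type -/

/-- Multiplication by `p` permutes the residues modulo `q`, and `g` depends only on its argument
modulo `1`. -/
theorem sum_range_rotation {β : Type*} [AddCommMonoid β] {g : ℝ → β} (hg : Function.Periodic g 1)
    {q : ℕ} (hq : 0 < q) {p : ℤ} (hpq : IsCoprime p (q : ℤ)) (b : ℝ) :
    ∑ i ∈ Finset.range q, g (b + i * ((p : ℝ) / q)) = ∑ i ∈ Finset.range q, g (b + (i : ℝ) / q) := by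
  have hqR : (q : ℝ) ≠ 0 := by positivity
  have hqZ : (0 : ℤ) < q := by exact_mod_cast hq
  let τ : ℕ → ℕ := fun i => ((i * p) % (q : ℤ)).toNat
  have hτ : ∀ i, (τ i : ℤ) = (i * p) % (q : ℤ) := fun i =>
    Int.toNat_of_nonneg (Int.emod_nonneg _ hqZ.ne')
  have hmaps : ∀ i ∈ Finset.range q, τ i ∈ Finset.range q := fun i _ => by
    rw [Finset.mem_range]
    have := Int.emod_lt_of_pos (i * p) hqZ
    rw [← hτ] at this
    exact_mod_cast this
  have hinj : Set.InjOn τ (Finset.range q) := by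
    intro i hi j hj hij
    have h1 : ((i : ℤ) * p) % (q : ℤ) = (j * p) % (q : ℤ) := by rw [← hτ, ← hτ, hij]
    have h2 : (q : ℤ) ∣ (i - j) * p := by
      rw [sub_mul]; exact Int.ModEq.dvd (Int.ModEq.symm h1)
    have h3 : (q : ℤ) ∣ i - j := hpq.symm.dvd_of_dvd_mul_right h2
    have hi' : (i : ℤ) < q := by exact_mod_cast Finset.mem_range.1 hi
    have hj' : (j : ℤ) < q := by exact_mod_cast Finset.mem_range.1 hj
    have h4 : (i : ℤ) - j = 0 := Int.eq_zero_of_abs_lt_dvd h3 (by rw [abs_lt]; omega)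
    omega
  have himage : (Finset.range q).image τ = Finset.range q :=
    Finset.eq_of_subset_of_card_le (Finset.image_subset_iff.2 hmaps)
      (Finset.card_image_of_injOn hinj).ge
  conv_rhs => rw [← himage, Finset.sum_image hinj]
  refine Finset.sum_congr rfl fun i _ => ?_
  have h1 : ((i : ℤ) * p : ℤ) = q * ((i * p) / (q : ℤ)) + τ i := by
    rw [hτ]; exact (Int.mul_ediv_add_emod _ _).symm
  have h2 : (i : ℝ) * p = q * (((i * p) / (q : ℤ) : ℤ) : ℝ) + τ i := by exact_mod_cast h1
  have h3 : b + i * ((p : ℝ) / q) =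
      b + (τ i : ℝ) / q + (((i * p) / (q : ℤ) : ℤ) : ℝ) * 1 := by
    field_simp
    rw [h2]
    ring
  rw [h3]
  exact (hg.int_mul _) _

theorem continuous_of_abs_sub_le {g : ℝ → ℝ} {Λ : ℝ} (hΛ : 0 ≤ Λ)
    (hlip : ∀ s t, |g s - g t| ≤ Λ * |s - t|) : Continuous g := by
  have : LipschitzWith Λ.toNNReal g := LipschitzWith.of_dist_le_mul fun s t => by
    rw [Real.dist_eq, Real.dist_eq, Real.coe_toNNReal _ hΛ]; exact hlip s t
  exact this.continuous

/-- Replacing `φ` by `p / q` moves each of the `q` points by at most `1 / q`. They then form an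
equally spaced grid, whose Riemann sum is again off by `Λ / q` per cell. -/
theorem abs_sum_rotation_block_le {g : ℝ → ℝ} (hg : Function.Periodic g 1) {Λ : ℝ} (hΛ : 0 ≤ Λ)
    (hlip : ∀ s t, |g s - g t| ≤ Λ * |s - t|) {q : ℕ} (hq : 0 < q) {p : ℤ}
    (hpq : IsCoprime p (q : ℤ)) {φ : ℝ} (hφ : |φ - p / q| ≤ 1 / (q : ℝ) ^ 2) (b : ℝ) :
    |∑ i ∈ Finset.range q, g (b + i * φ) - q * ∫ t in (0 : ℝ)..1, g t| ≤ 2 * Λ := by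
  have hqR : (0 : ℝ) < q := by exact_mod_cast hq
  have hcont : Continuous g := continuous_of_abs_sub_le hΛ hlip
  have hI : ∀ a c, IntervalIntegrable g volume a c := fun a c => hcont.intervalIntegrable a c
  have h1 : ∀ i ∈ Finset.range q, |g (b + i * φ) - g (b + i * ((p : ℝ) / q))| ≤ Λ / q := by
    intro i hi
    have hi' : (i : ℝ) ≤ q := by exact_mod_cast (Finset.mem_range.1 hi).le
    refine (hlip _ _).trans ?_
    have : b + i * φ - (b + i * ((p : ℝ) / q)) = i * (φ - p / q) := by ring
    rw [this, abs_mul, Nat.abs_cast]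
    calc Λ * (i * |φ - p / q|) ≤ Λ * (q * (1 / (q : ℝ) ^ 2)) := by gcongr
      _ = Λ / q := by field_simp
  have h2 : ∫ t in (0 : ℝ)..1, g t =
      ∑ i ∈ Finset.range q, ∫ t in (b + (i : ℝ) / q)..(b + ((i + 1 : ℕ) : ℝ) / q), g t := by
    rw [intervalIntegral.sum_integral_adjacent_intervals (a := fun i : ℕ => b + (i : ℝ) / q)
      (fun i _ => hI _ _)]
    have := hg.intervalIntegral_add_eq 0 b
    simp only [zero_add] at this
    rw [this]
    simp [hqR.ne']
  have h3 : ∀ i ∈ Finset.range q, |g (b + (i : ℝ) / q) -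
      q * ∫ t in (b + (i : ℝ) / q)..(b + ((i + 1 : ℕ) : ℝ) / q), g t| ≤ Λ / q := by
    intro i _
    set a := b + (i : ℝ) / q with ha
    have hac : b + ((i + 1 : ℕ) : ℝ) / q = a + 1 / q := by rw [ha]; push_cast; ring
    rw [hac]
    have h4 : g a - q * ∫ t in a..(a + 1 / q), g t = q * ∫ t in a..(a + 1 / q), (g a - g t) := by
      rw [intervalIntegral.integral_sub (by simp) (hI _ _), intervalIntegral.integral_const]
      simp only [add_sub_cancel_left, smul_eq_mul]
      field_simp
    have h5 : |∫ t in a..(a + 1 / q), (g a - g t)| ≤ Λ / q * |a + 1 / q - a| := by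
      rw [← Real.norm_eq_abs]
      refine intervalIntegral.norm_integral_le_of_norm_le_const fun t ht => ?_
      rw [Set.uIoc_of_le (by have : (0 : ℝ) ≤ 1 / q := by positivity
                             linarith)] at ht
      rw [Real.norm_eq_abs]
      refine (hlip a t).trans ?_
      rw [div_eq_mul_one_div]
      refine mul_le_mul_of_nonneg_left ?_ hΛ
      rw [abs_le]
      constructor <;> linarith [ht.1, ht.2]
    rw [h4, abs_mul, Nat.abs_cast]
    rw [add_sub_cancel_left, abs_of_nonneg (by positivity : (0 : ℝ) ≤ 1 / q)] at h5
    calc (q : ℝ) * |∫ t in a..(a + 1 / q), (g a - g t)| ≤ q * (Λ / q * (1 / q)) := by gcongr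
      _ = Λ / q := by field_simp
  have h6 : ∑ i ∈ Finset.range q, g (b + i * φ) - q * ∫ t in (0 : ℝ)..1, g t =
      ∑ i ∈ Finset.range q, (g (b + i * φ) - g (b + i * ((p : ℝ) / q))) +
      ∑ i ∈ Finset.range q, (g (b + (i : ℝ) / q) -
        q * ∫ t in (b + (i : ℝ) / q)..(b + ((i + 1 : ℕ) : ℝ) / q), g t) := by
    rw [Finset.sum_sub_distrib, Finset.sum_sub_distrib, sum_range_rotation hg hq hpq, h2,
      Finset.mul_sum]
    ring
  have h7 : ∑ _i ∈ Finset.range q, Λ / q = Λ := by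
    rw [Finset.sum_const, Finset.card_range, nsmul_eq_mul]; field_simp
  rw [h6, two_mul]
  refine (abs_add_le _ _).trans (add_le_add ?_ ?_)
  · exact (Finset.abs_sum_le_sum_abs _ _).trans ((Finset.sum_le_sum h1).trans h7.le)
  · exact (Finset.abs_sum_le_sum_abs _ _).trans ((Finset.sum_le_sum h3).trans h7.le)

theorem abs_integral_le_of_bound {g : ℝ → ℝ} {B : ℝ} (hB : ∀ t, |g t| ≤ B) :
    |∫ t in (0 : ℝ)..1, g t| ≤ B := by
  have := intervalIntegral.norm_integral_le_of_norm_le_const (a := (0 : ℝ)) (b := 1) (f := g)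
    (C := B) fun t _ => hB t
  simpa using this

/-- The sum is cut into `M / q` full blocks and a remainder of fewer than `q` terms, which is
bounded trivially. -/
theorem abs_sum_rotation_le {g : ℝ → ℝ} (hg : Function.Periodic g 1) {Λ B : ℝ} (hΛ : 0 ≤ Λ)
    (hlip : ∀ s t, |g s - g t| ≤ Λ * |s - t|) (hB : ∀ t, |g t| ≤ B) {q : ℕ} (hq : 0 < q) {p : ℤ}
    (hpq : IsCoprime p (q : ℤ)) {φ : ℝ} (hφ : |φ - p / q| ≤ 1 / (q : ℝ) ^ 2) (M : ℕ) (b : ℝ) :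
    |∑ i ∈ Finset.range M, g (b + i * φ) - M * ∫ t in (0 : ℝ)..1, g t| ≤
      2 * Λ * (M / q) + 2 * B * q := by
  have hqR : (0 : ℝ) < q := by exact_mod_cast hq
  have hB0 : 0 ≤ B := (abs_nonneg _).trans (hB 0)
  set I := ∫ t in (0 : ℝ)..1, g t with hI
  have hIB : |I| ≤ B := abs_integral_le_of_bound hB
  have hblocks : ∀ k : ℕ,
      |∑ i ∈ Finset.range (q * k), g (b + i * φ) - (q * k : ℕ) * I| ≤ 2 * Λ * k := by
    intro k
    induction k with
    | zero => simp
    | succ k ih =>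
      rw [mul_add, mul_one, Finset.sum_range_add]
      have h1 := abs_sum_rotation_block_le hg hΛ hlip hq hpq hφ (b + (q * k : ℕ) * φ)
      have h2 : ∀ i : ℕ, b + ((q * k + i : ℕ) : ℝ) * φ = b + (q * k : ℕ) * φ + i * φ := fun i => by
        push_cast; ring
      simp only [h2]
      have h3 : ∀ u v : ℝ, u + v - ((q * k + q : ℕ) : ℝ) * I = (u - (q * k : ℕ) * I) + (v - q * I) :=
        fun u v => by push_cast; ring
      rw [h3]
      refine (abs_add_le _ _).trans ((add_le_add ih h1).trans ?_)
      push_cast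
      linarith
  have hM : M = q * (M / q) + M % q := (Nat.div_add_mod M q).symm
  have h1 : |∑ i ∈ Finset.range (M % q), (g (b + ((q * (M / q) + i : ℕ) : ℝ) * φ) - I)| ≤
      2 * B * q := by
    refine (Finset.abs_sum_le_sum_abs _ _).trans ?_
    have : ∀ i ∈ Finset.range (M % q), |g (b + ((q * (M / q) + i : ℕ) : ℝ) * φ) - I| ≤ 2 * B :=
      fun i _ => (abs_sub _ _).trans (by linarith [hB (b + ((q * (M / q) + i : ℕ) : ℝ) * φ)])
    refine (Finset.sum_le_card_nsmul _ _ _ this).trans ?_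
    rw [Finset.card_range, nsmul_eq_mul, mul_comm]
    have h4 : ((M % q : ℕ) : ℝ) ≤ q := by exact_mod_cast (Nat.mod_lt M hq).le
    exact mul_le_mul_of_nonneg_left h4 (by positivity)
  have h2 : ∑ i ∈ Finset.range M, g (b + i * φ) - M * I =
      (∑ i ∈ Finset.range (q * (M / q)), g (b + i * φ) - (q * (M / q) : ℕ) * I) +
      ∑ i ∈ Finset.range (M % q), (g (b + ((q * (M / q) + i : ℕ) : ℝ) * φ) - I) := by
    conv_lhs => rw [hM]
    rw [Finset.sum_range_add, Finset.sum_sub_distrib]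
    simp only [Finset.sum_const, Finset.card_range, nsmul_eq_mul]
    push_cast
    ring
  rw [h2]
  refine (abs_add_le _ _).trans (add_le_add ((hblocks _).trans ?_) h1)
  exact mul_le_mul_of_nonneg_left Nat.cast_div_le (by positivity)

/-- Dirichlet's theorem at height about `√M` gives `q = O(√M)`, and finite type forbids a small `q`:
since `q φ` is within `1 / √M` of an integer, `q ^ γ ≥ K √M`. Hence `b = 1 / (2 γ)`. -/
theorem exists_rational_approximation {φ : ℝ} (hφ : IsFiniteType φ) :
    ∃ b C : ℝ, 0 < b ∧ b ≤ 1 / 2 ∧ 0 ≤ C ∧ ∀ M : ℕ, 1 ≤ M → ∃ (q : ℕ) (p : ℤ), 0 < q ∧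
      IsCoprime p (q : ℤ) ∧ |φ - p / q| ≤ 1 / (q : ℝ) ^ 2 ∧ 1 / (q : ℝ) ≤ C * (M : ℝ) ^ (-b) ∧
      (q : ℝ) ≤ C * (M : ℝ) ^ (1 - b) := by
  obtain ⟨-, K, hK, γ, hγ, hq⟩ := hφ
  have hγ0 : 0 < γ := by linarith
  refine ⟨1 / (2 * γ), max (K ^ (-(1 / γ))) 2, by positivity, ?_, by positivity, fun M hM => ?_⟩
  · exact one_div_le_one_div_of_le (by norm_num) (by linarith)
  have hMR : (1 : ℝ) ≤ M := by exact_mod_cast hM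
  set s := (M : ℝ) ^ (1 / 2 : ℝ) with hs
  have hs1 : 1 ≤ s := Real.one_le_rpow hMR (by norm_num)
  have hN : 0 < ⌈s⌉₊ := Nat.ceil_pos.2 (by linarith)
  obtain ⟨r, hr, hrN⟩ := Real.exists_rat_abs_sub_le_and_den_le φ hN
  have hd : (0 : ℝ) < r.den := by exact_mod_cast r.den_pos
  have hsN : s ≤ ⌈s⌉₊ := Nat.le_ceil s
  have hrNR : (r.den : ℝ) ≤ ⌈s⌉₊ := by exact_mod_cast hrN
  refine ⟨r.den, r.num, r.den_pos, ?_, ?_, ?_, ?_⟩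
  · rw [Int.isCoprime_iff_nat_coprime]
    simpa using r.reduced
  · rw [← Rat.cast_def]
    refine hr.trans (one_div_le_one_div_of_le (by positivity) ?_)
    nlinarith
  · have h1 := hq r.den (by exact_mod_cast r.den_pos.ne')
    have h2 : |((r.den : ℤ) : ℝ) * φ - (round (((r.den : ℤ) : ℝ) * φ) : ℝ)| ≤ 1 / s := by
      refine (round_le _ r.num).trans ?_
      have h3 : ((r.den : ℤ) : ℝ) * φ - r.num = r.den * (φ - r) := by
        rw [Rat.cast_def r]; push_cast; field_simp
      rw [h3, abs_mul, Nat.abs_cast]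
      calc (r.den : ℝ) * |φ - r| ≤ r.den * (1 / ((⌈s⌉₊ + 1) * r.den)) :=
            mul_le_mul_of_nonneg_left hr hd.le
        _ = 1 / (⌈s⌉₊ + 1) := by field_simp
        _ ≤ 1 / s := one_div_le_one_div_of_le (by linarith) (by linarith)
    have h3 := h1.trans h2
    rw [Int.cast_natCast, Nat.abs_cast] at h3
    have h4 : K * s ≤ (r.den : ℝ) ^ γ := by
      rw [div_le_div_iff₀ (by positivity) (by positivity)] at h3
      linarith
    have h5 : (K * s) ^ (1 / γ) ≤ r.den := by
      have := Real.rpow_le_rpow (by positivity) h4 (by positivity : 0 ≤ 1 / γ)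
      rwa [← Real.rpow_mul hd.le, mul_one_div_cancel hγ0.ne', Real.rpow_one] at this
    have h6 : 1 / (r.den : ℝ) ≤ K ^ (-(1 / γ)) * (M : ℝ) ^ (-(1 / (2 * γ))) := by
      refine (one_div_le_one_div_of_le (by positivity) h5).trans (le_of_eq ?_)
      rw [Real.mul_rpow hK.le (by positivity), hs, ← Real.rpow_mul (by positivity),
        Real.rpow_neg hK.le, Real.rpow_neg (by positivity), one_div, mul_inv]
      congr 3
      field_simp
    exact h6.trans (mul_le_mul_of_nonneg_right (le_max_left _ _) (by positivity))
  · have h1 : (r.den : ℝ) ≤ 2 * s := by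
      have := (Nat.ceil_lt_add_one (by linarith : 0 ≤ s)).le
      linarith
    have h2 : s ≤ (M : ℝ) ^ (1 - 1 / (2 * γ)) := by
      refine Real.rpow_le_rpow_of_exponent_le hMR ?_
      have : 1 / (2 * γ) ≤ 1 / 2 := one_div_le_one_div_of_le (by norm_num) (by linarith)
      linarith
    calc (r.den : ℝ) ≤ 2 * s := h1
      _ ≤ 2 * (M : ℝ) ^ (1 - 1 / (2 * γ)) := by linarith
      _ ≤ _ := mul_le_mul_of_nonneg_right (le_max_right _ _) (by positivity)

/-- Quantitative equidistribution for Lipschitz functions, uniform in the function. -/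
theorem exists_equidistribution_lipschitz {φ : ℝ} (hφ : IsFiniteType φ) :
    ∃ b C : ℝ, 0 < b ∧ b ≤ 1 / 2 ∧ 0 ≤ C ∧ ∀ (g : ℝ → ℝ) (Λ B : ℝ), Function.Periodic g 1 → 0 ≤ Λ →
      (∀ s t, |g s - g t| ≤ Λ * |s - t|) → (∀ t, |g t| ≤ B) → ∀ (β : ℝ) (M : ℕ), 1 ≤ M →
      |∑ m ∈ Finset.Icc 1 M, g (m * φ + β) - M * ∫ t in (0 : ℝ)..1, g t| ≤
        C * (Λ + B) * (M : ℝ) ^ (1 - b) := by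
  obtain ⟨b, C, hb, hb2, hC, H⟩ := exists_rational_approximation hφ
  refine ⟨b, 2 * C, hb, hb2, by positivity, fun g Λ B hg hΛ hlip hB β M hM => ?_⟩
  have hB0 : 0 ≤ B := (abs_nonneg _).trans (hB 0)
  obtain ⟨q, p, hq, hpq, hφq, h1, h2⟩ := H M hM
  have hMR : (0 : ℝ) < M := by exact_mod_cast hM
  have h3 : ∑ m ∈ Finset.Icc 1 M, g (m * φ + β) = ∑ i ∈ Finset.range M, g (φ + β + i * φ) := by
    have := Finset.sum_Ico_add' (fun m : ℕ => g (m * φ + β)) 0 M 1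
    rw [Finset.range_eq_Ico]
    refine this.symm.trans (Finset.sum_congr rfl fun i _ => ?_)
    congr 1
    push_cast
    ring
  rw [h3]
  refine (abs_sum_rotation_le hg hΛ hlip hB hq hpq hφq M _).trans ?_
  have h4 : (M : ℝ) / q ≤ C * (M : ℝ) ^ (1 - b) := by
    rw [div_eq_mul_one_div]
    calc (M : ℝ) * (1 / q) ≤ M * (C * (M : ℝ) ^ (-b)) := by gcongr
      _ = C * ((M : ℝ) ^ (1 : ℝ) * (M : ℝ) ^ (-b)) := by rw [Real.rpow_one]; ring
      _ = _ := by rw [← Real.rpow_add hMR]; rfl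
  calc 2 * Λ * (M / q) + 2 * B * q
      ≤ 2 * Λ * (C * (M : ℝ) ^ (1 - b)) + 2 * B * (C * (M : ℝ) ^ (1 - b)) := by gcongr
    _ = _ := by ring

/-! ### Cutting out the singularities of a tame function -/

/-- A Lipschitz cutoff equal to `1` where `ψ ≤ η` and to `0` where `ψ ≥ 2η`. -/
noncomputable def cutoff (ψ : ℝ → ℝ) (η t : ℝ) : ℝ := max 0 (min 1 (2 - ψ t / η))

theorem cutoff_nonneg (ψ : ℝ → ℝ) (η t : ℝ) : 0 ≤ cutoff ψ η t := le_max_left _ _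

theorem cutoff_le_one (ψ : ℝ → ℝ) (η t : ℝ) : cutoff ψ η t ≤ 1 :=
  max_le zero_le_one (min_le_left _ _)

theorem cutoff_eq_one {ψ : ℝ → ℝ} {η t : ℝ} (hη : 0 < η) (h : ψ t ≤ η) : cutoff ψ η t = 1 := by
  have : ψ t / η ≤ 1 := (div_le_one hη).2 h
  rw [cutoff, min_eq_left (by linarith), max_eq_right zero_le_one]

/-- Markov's inequality: the cutoff vanishes unless `ψ t < 2 η`, where the right side is at least
`1`. -/
theorem cutoff_le_mul_rpow {ψ : ℝ → ℝ} {η t c : ℝ} (hη : 0 < η) (ht : 0 < ψ t) (hc : 0 < c) :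
    cutoff ψ η t ≤ (2 * η) ^ c * ψ t ^ (-c) := by
  rcases le_or_gt (2 * η) (ψ t) with h | h
  · have : 2 ≤ ψ t / η := (le_div_iff₀ hη).2 h
    rw [cutoff, max_eq_left ((min_le_right _ _).trans (by linarith))]
    positivity
  · refine (cutoff_le_one _ _ _).trans ?_
    rw [Real.rpow_neg ht.le, ← div_eq_mul_inv, one_le_div (by positivity)]
    exact Real.rpow_le_rpow ht.le h.le hc.le

theorem abs_cutoff_sub_le {ψ : ℝ → ℝ} {η Λ : ℝ} (hη : 0 < η)
    (hψ : ∀ s t, |ψ s - ψ t| ≤ Λ * |s - t|) (s t : ℝ) :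
    |cutoff ψ η s - cutoff ψ η t| ≤ Λ / η * |s - t| := by
  have h1 : |cutoff ψ η s - cutoff ψ η t| ≤ |(2 - ψ s / η) - (2 - ψ t / η)| := by
    rw [cutoff, cutoff, max_comm 0, max_comm 0, min_comm 1, min_comm 1]
    exact (abs_max_sub_max_le_abs _ _ _).trans (abs_inf_sub_inf_le_abs _ _ _)
  have h2 : (2 - ψ s / η) - (2 - ψ t / η) = -((ψ s - ψ t) / η) := by ring
  rw [h2, abs_neg, abs_div, abs_of_pos hη] at h1
  calc _ ≤ |ψ s - ψ t| / η := h1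
    _ ≤ Λ * |s - t| / η := div_le_div_of_nonneg_right (hψ s t) hη.le
    _ = _ := by ring

theorem intervalIntegral_eq_integral_Icc (f : ℝ → ℝ) :
    ∫ t in (0 : ℝ)..1, f t = ∫ t in Set.Icc (0 : ℝ) 1, f t := by
  rw [intervalIntegral.integral_of_le zero_le_one, integral_Icc_eq_integral_Ioc]

namespace IsTame

variable {h ψ : ℝ → ℝ} {G : ℝ → ℝ → ℝ}

theorem abs_sub_approx_le (H : IsTame h ψ G) {η : ℝ} (hη : 0 < η) (hη1 : η ≤ 1) (t : ℝ) :
    |h t - G η t| ≤ (|h t| + |G η t|) * cutoff ψ η t := by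
  rcases le_total η (ψ t) with ht | ht
  · rw [H.approx_eq η hη hη1 t ht, sub_self, abs_zero]
    exact mul_nonneg (by positivity) (cutoff_nonneg _ _ _)
  · rw [cutoff_eq_one hη ht, mul_one]
    exact abs_sub _ _

/-- The difference lives on the support of the cutoff. Half of the integrable power of `ψ` pays for
the growth of `h` and the other half yields `η ^ (c / 2)`; for the approximation, `η ^ c` from the
cutoff outweighs `η ^ (-(c / 2))`. -/
theorem exists_abs_integral_sub_approx_le (H : IsTame h ψ G) {c : ℝ} (hc : 0 < c) (hc1 : c ≤ 1)
    (hint : IntegrableOn (fun t => ψ t ^ (-c)) (Set.Icc 0 1)) :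
    ∃ K, 0 ≤ K ∧ ∀ η, 0 < η → η ≤ 1 →
      |(∫ t in (0 : ℝ)..1, h t) - ∫ t in (0 : ℝ)..1, G η t| ≤ K * η ^ (c / 2) := by
  obtain ⟨C, hC, hb⟩ := H.bound (c / 2) (by positivity)
  obtain ⟨C', hC', hb'⟩ := H.approx_bound (c / 2) (by positivity)
  obtain ⟨L, κ, hL, hlip⟩ := H.approx_lipschitz
  have hJ : 0 ≤ ∫ t in Set.Icc (0 : ℝ) 1, ψ t ^ (-c) :=
    integral_nonneg fun t => Real.rpow_nonneg (H.control_nonneg t) _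
  refine ⟨2 * (C + C') * ∫ t in Set.Icc (0 : ℝ) 1, ψ t ^ (-c), by positivity,
    fun η hη hη1 => ?_⟩
  have hG : Continuous (G η) := continuous_of_abs_sub_le (by positivity) (hlip η hη hη1)
  rw [intervalIntegral_eq_integral_Icc, intervalIntegral_eq_integral_Icc,
    ← integral_sub H.integrableOn (hG.integrableOn_Icc)]
  have h1 : ∀ᵐ t ∂volume.restrict (Set.Icc (0 : ℝ) 1),
      ‖h t - G η t‖ ≤ 2 * (C + C') * η ^ (c / 2) * ψ t ^ (-c) := by
    filter_upwards [H.ae_ne_zero] with t ht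
    have hpos := (H.control_nonneg t).lt_of_ne' ht
    refine (H.abs_sub_approx_le hη hη1 t).trans ?_
    rw [add_mul]
    have h2 : ∀ r : ℝ, 0 < r → r ≤ 1 → (2 * η) ^ r ≤ 2 * η ^ r := fun r hr hr1 => by
      rw [Real.mul_rpow (by norm_num) hη.le]
      refine mul_le_mul_of_nonneg_right ?_ (by positivity)
      calc (2 : ℝ) ^ r ≤ 2 ^ (1 : ℝ) := Real.rpow_le_rpow_of_exponent_le (by norm_num) hr1
        _ = 2 := Real.rpow_one 2
    have h3 : |h t| * cutoff ψ η t ≤ C * ψ t ^ (-(c / 2)) * (2 * η ^ (c / 2) * ψ t ^ (-(c / 2))) := by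
      refine mul_le_mul (hb t ht) ((cutoff_le_mul_rpow hη hpos (half_pos hc)).trans ?_)
        (cutoff_nonneg _ _ _) (by positivity)
      exact mul_le_mul_of_nonneg_right (h2 (c / 2) (half_pos hc) (by linarith))
        (Real.rpow_nonneg hpos.le _)
    have h4 : |G η t| * cutoff ψ η t ≤ C' * η ^ (-(c / 2)) * (2 * η ^ c * ψ t ^ (-c)) := by
      refine mul_le_mul (hb' η hη hη1 t) ((cutoff_le_mul_rpow hη hpos hc).trans ?_)
        (cutoff_nonneg _ _ _) (by positivity)
      exact mul_le_mul_of_nonneg_right (h2 c hc hc1) (Real.rpow_nonneg hpos.le _)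
    have h5 : ψ t ^ (-c) = ψ t ^ (-(c / 2)) * ψ t ^ (-(c / 2)) := by
      rw [← Real.rpow_add hpos]; congr 1; ring
    have h6 : η ^ (c / 2) = η ^ (-(c / 2)) * η ^ c := by
      rw [← Real.rpow_add hη]; congr 1; ring
    calc _ ≤ C * ψ t ^ (-(c / 2)) * (2 * η ^ (c / 2) * ψ t ^ (-(c / 2))) +
          C' * η ^ (-(c / 2)) * (2 * η ^ c * ψ t ^ (-c)) := add_le_add h3 h4
      _ = 2 * C * η ^ (c / 2) * (ψ t ^ (-(c / 2)) * ψ t ^ (-(c / 2))) +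
          2 * C' * (η ^ (-(c / 2)) * η ^ c) * ψ t ^ (-c) := by ring
      _ = _ := by rw [← h5, ← h6]; ring
  have h2 := norm_integral_le_of_norm_le (hint.const_mul (2 * (C + C') * η ^ (c / 2))) h1
  rw [integral_const_mul] at h2
  refine h2.trans (le_of_eq (by ring))

theorem integral_cutoff_le (H : IsTame h ψ G) {c : ℝ} (hc : 0 < c) (hc1 : c ≤ 1)
    (hint : IntegrableOn (fun t => ψ t ^ (-c)) (Set.Icc 0 1)) {η : ℝ} (hη : 0 < η) :
    ∫ t in (0 : ℝ)..1, cutoff ψ η t ≤ 2 * (∫ t in Set.Icc (0 : ℝ) 1, ψ t ^ (-c)) * η ^ c := by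
  have h1 : ∀ᵐ t ∂volume.restrict (Set.Icc (0 : ℝ) 1),
      cutoff ψ η t ≤ (2 * η) ^ c * ψ t ^ (-c) := by
    filter_upwards [H.ae_ne_zero] with t ht
    exact cutoff_le_mul_rpow hη ((H.control_nonneg t).lt_of_ne' ht) hc
  rw [intervalIntegral_eq_integral_Icc]
  refine (integral_mono_of_nonneg (Eventually.of_forall fun t => cutoff_nonneg _ _ _)
    (hint.const_mul _) h1).trans ?_
  rw [integral_const_mul, Real.mul_rpow (by norm_num) hη.le]
  have h2 : (2 : ℝ) ^ c ≤ 2 := by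
    calc (2 : ℝ) ^ c ≤ 2 ^ (1 : ℝ) := Real.rpow_le_rpow_of_exponent_le (by norm_num) hc1
      _ = 2 := Real.rpow_one 2
  have hJ : 0 ≤ ∫ t in Set.Icc (0 : ℝ) 1, ψ t ^ (-c) :=
    integral_nonneg fun t => Real.rpow_nonneg (H.control_nonneg t) _
  calc _ ≤ 2 * η ^ c * ∫ t in Set.Icc (0 : ℝ) 1, ψ t ^ (-c) := by gcongr
    _ = _ := by ring

/-- Quantitative equidistribution of `m φ + β` for a tame function which grows slower than any
power along the orbit. -/
theorem exists_equidistribution (H : IsTame h ψ G) {φ : ℝ} (hφ : IsFiniteType φ) (β : ℝ)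
    (horbit : ∀ ε : ℝ, 0 < ε → ∃ C : ℝ, 0 ≤ C ∧ ∀ m : ℕ, 1 ≤ m → |h (m * φ + β)| ≤ C * (m : ℝ) ^ ε) :
    ∃ C δ : ℝ, 0 ≤ C ∧ 0 < δ ∧ δ < 1 ∧ ∀ M : ℕ, 1 ≤ M →
      |∑ m ∈ Finset.Icc 1 M, (h (m * φ + β) - ∫ t in (0 : ℝ)..1, h t)| ≤ C * (M : ℝ) ^ (1 - δ) := by
  obtain ⟨b, E, hb, hb2, hE, hequi⟩ := exists_equidistribution_lipschitz hφ
  obtain ⟨c, hc, hc1, hint, -⟩ := H.control_integrable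
  obtain ⟨L, κ, hL, hlip⟩ := H.approx_lipschitz
  obtain ⟨Λ, hΛ, hψ⟩ := H.control_lipschitz
  obtain ⟨B₁, hB₁, hG₁⟩ := H.approx_bound 1 one_pos
  obtain ⟨B₂, hB₂, hG₂⟩ := H.approx_bound (c / 2) (by positivity)
  obtain ⟨K₂, hK₂, hI⟩ := H.exists_abs_integral_sub_approx_le hc hc1 hint
  set J := ∫ t in Set.Icc (0 : ℝ) 1, ψ t ^ (-c) with hJdef
  have hJ : 0 ≤ J := integral_nonneg fun t => Real.rpow_nonneg (H.control_nonneg t) _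
  -- With `η = M ^ (-a)` the Lipschitz saving `M ^ (1 - b)` equals `M η ^ (κ + 2)`, which absorbs
  -- the Lipschitz constant `L / η ^ κ` with two powers of `η` to spare.
  set a : ℝ := b / (κ + 2) with ha
  have ha0 : 0 < a := by positivity
  have hab : a ≤ b := div_le_self hb.le (by linarith [(Nat.cast_nonneg κ : (0 : ℝ) ≤ κ)])
  -- The exponent is chosen so that the growth of `h` along the orbit up to time `M` is `η ^ (-(c /
  -- 2))`, the same as the bound on the approximation.
  obtain ⟨B₀, hB₀, hh⟩ := horbit (a * (c / 2)) (by positivity)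
  set K₁ := 2 * J + E * (Λ + 1) with hK₁
  have hK₁0 : 0 ≤ K₁ := by positivity
  refine ⟨(B₀ + B₂) * K₁ + E * (L + B₁) + K₂, a * (c / 2), by positivity, by positivity,
    by nlinarith, fun M hM => ?_⟩
  have hMR : (1 : ℝ) ≤ M := by exact_mod_cast hM
  have hM0 : (0 : ℝ) < M := by linarith
  set η : ℝ := (M : ℝ) ^ (-a) with hηdef
  have hη : 0 < η := by positivity
  have hη1 : η ≤ 1 := Real.rpow_le_one_of_one_le_of_nonpos hMR (by linarith)
  have hηc : ∀ r : ℝ, 0 < r → r ≤ 1 → η ≤ η ^ r := fun r _ hr => by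
    calc η = η ^ (1 : ℝ) := (Real.rpow_one η).symm
      _ ≤ η ^ r := Real.rpow_le_rpow_of_exponent_ge hη hη1 hr
  have hMb : (M : ℝ) ^ (1 - b) = M * η ^ (κ + 2) := by
    rw [sub_eq_add_neg, Real.rpow_add hM0, Real.rpow_one, hηdef, ← Real.rpow_natCast,
      ← Real.rpow_mul hM0.le]
    congr 2
    rw [ha]; push_cast; field_simp
  have hMδ : (M : ℝ) ^ (1 - a * (c / 2)) = M * η ^ (c / 2) := by
    rw [sub_eq_add_neg, Real.rpow_add hM0, Real.rpow_one, hηdef, ← Real.rpow_mul hM0.le]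
    congr 2
    ring
  have hMε : (M : ℝ) ^ (a * (c / 2)) = η ^ (-(c / 2)) := by
    rw [hηdef, ← Real.rpow_mul hM0.le]
    congr 1
    ring
  have hpow : ∀ i j : ℕ, i ≤ j → η ^ j ≤ η ^ i := fun i j hij => pow_le_pow_of_le_one hη.le hη1 hij
  have hsumG : |∑ m ∈ Finset.Icc 1 M, G η (m * φ + β) - M * ∫ t in (0 : ℝ)..1, G η t| ≤
      E * (L + B₁) * (M * η) := by
    refine (hequi (G η) (L / η ^ κ) (B₁ * η ^ (-1 : ℝ)) (H.approx_periodic η) (by positivity)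
      (hlip η hη hη1) (hG₁ η hη hη1) β M hM).trans ?_
    rw [hMb, Real.rpow_neg_one]
    have e1 : E * (L / η ^ κ + B₁ * η⁻¹) * (M * η ^ (κ + 2)) =
        E * M * (L * η ^ 2 + B₁ * η ^ (κ + 1)) := by
      field_simp
      ring
    rw [e1]
    have h1 : η ^ 2 ≤ η := by simpa using hpow 1 2 (by norm_num)
    have h2 : η ^ (κ + 1) ≤ η := by simpa using hpow 1 (κ + 1) (by omega)
    calc E * M * (L * η ^ 2 + B₁ * η ^ (κ + 1)) ≤ E * M * (L * η + B₁ * η) := by gcongr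
      _ = _ := by ring
  -- The number of visits near the singularities is controlled by equidistribution of the Lipschitz
  -- cutoff, whose integral is `O(η ^ c)`.
  have hsumχ : ∑ m ∈ Finset.Icc 1 M, cutoff ψ η (m * φ + β) ≤ K₁ * (M * η ^ c) := by
    have h0 := hequi (cutoff ψ η) (Λ / η) 1
      (fun t => by simp only [cutoff, H.control_periodic t]) (by positivity)
      (abs_cutoff_sub_le hη hψ)
      (fun t => by rw [abs_of_nonneg (cutoff_nonneg _ _ _)]; exact cutoff_le_one _ _ _) β M hM
    rw [hMb] at h0
    have e1 : E * (Λ / η + 1) * (M * η ^ (κ + 2)) = E * M * (Λ * η ^ (κ + 1) + η ^ (κ + 2)) := by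
      field_simp
      ring
    rw [e1] at h0
    have h1 : η ^ (κ + 2) ≤ η ^ c := (hpow 1 (κ + 2) (by omega)).trans
      (by rw [pow_one]; exact hηc c hc hc1)
    have h2 : η ^ (κ + 1) ≤ η ^ c := (hpow 1 (κ + 1) (by omega)).trans
      (by rw [pow_one]; exact hηc c hc hc1)
    have h3 : E * M * (Λ * η ^ (κ + 1) + η ^ (κ + 2)) ≤ E * M * (Λ * η ^ c + η ^ c) := by gcongr
    have h4 := mul_le_mul_of_nonneg_left (H.integral_cutoff_le hc hc1 hint hη) hM0.le
    have h5 := (abs_le.1 h0).2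
    rw [hK₁]
    linarith
  have hdiff : |∑ m ∈ Finset.Icc 1 M, (h (m * φ + β) - G η (m * φ + β))| ≤
      (B₀ + B₂) * K₁ * (M * η ^ (c / 2)) := by
    have h1 : ∀ m ∈ Finset.Icc 1 M, |h (m * φ + β) - G η (m * φ + β)| ≤
        (B₀ + B₂) * η ^ (-(c / 2)) * cutoff ψ η (m * φ + β) := by
      intro m hm
      obtain ⟨hm1, hmM⟩ := Finset.mem_Icc.1 hm
      refine (H.abs_sub_approx_le hη hη1 _).trans
        (mul_le_mul_of_nonneg_right ?_ (cutoff_nonneg _ _ _))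
      rw [add_mul]
      refine add_le_add ((hh m hm1).trans (mul_le_mul_of_nonneg_left ?_ hB₀)) (hG₂ η hη hη1 _)
      rw [← hMε]
      exact Real.rpow_le_rpow (Nat.cast_nonneg _) (by exact_mod_cast hmM) (by positivity)
    refine (Finset.abs_sum_le_sum_abs _ _).trans ((Finset.sum_le_sum h1).trans ?_)
    rw [← Finset.mul_sum]
    refine (mul_le_mul_of_nonneg_left hsumχ (by positivity)).trans (le_of_eq ?_)
    have h2 : η ^ (c / 2) = η ^ (-(c / 2)) * η ^ c := by
      rw [← Real.rpow_add hη]; congr 1; ring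
    rw [h2]
    ring
  have hsplit : ∑ m ∈ Finset.Icc 1 M, (h (m * φ + β) - ∫ t in (0 : ℝ)..1, h t) =
      ∑ m ∈ Finset.Icc 1 M, (h (m * φ + β) - G η (m * φ + β)) +
      (∑ m ∈ Finset.Icc 1 M, G η (m * φ + β) - M * ∫ t in (0 : ℝ)..1, G η t) -
      M * ((∫ t in (0 : ℝ)..1, h t) - ∫ t in (0 : ℝ)..1, G η t) := by
    simp only [Finset.sum_sub_distrib, Finset.sum_const, Nat.card_Icc, nsmul_eq_mul]
    push_cast [Nat.add_sub_cancel]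
    ring
  have hlast : |M * ((∫ t in (0 : ℝ)..1, h t) - ∫ t in (0 : ℝ)..1, G η t)| ≤
      K₂ * (M * η ^ (c / 2)) := by
    rw [abs_mul, Nat.abs_cast]
    calc _ ≤ M * (K₂ * η ^ (c / 2)) := mul_le_mul_of_nonneg_left (hI η hη hη1) hM0.le
      _ = _ := by ring
  have hsumG' : E * (L + B₁) * (M * η) ≤ E * (L + B₁) * (M * η ^ (c / 2)) := by
    have := hηc (c / 2) (by positivity) (by linarith)
    gcongr
  rw [hsplit, hMδ]
  refine (abs_sub _ _).trans ?_
  have := abs_add_le (∑ m ∈ Finset.Icc 1 M, (h (m * φ + β) - G η (m * φ + β)))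
    (∑ m ∈ Finset.Icc 1 M, G η (m * φ + β) - M * ∫ t in (0 : ℝ)..1, G η t)
  linarith

end IsTame

/-! ### The central limit theorem under power-saving equidistribution -/

/-- The averages of `E F (x^m T_m)`, with `T_m` a product of `m` independent variables of law `ζ`,
converge to the integral of `F` over the circle with a power saving. -/
def IsEquidistributed (ζ : Measure Circle) (x : Circle) (F : Circle → ℝ) : Prop :=
  ∃ C δ : ℝ, 0 ≤ C ∧ 0 < δ ∧ δ < 1 ∧ ∀ M : ℕ, 1 ≤ M →
    |∑ m ∈ Finset.Icc 1 M, (∫ u, F (x ^ m * u) ∂(prodLaw ζ m) - ∫ t in (0 : ℝ)..1, F (e t))| ≤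
      C * (M : ℝ) ^ (1 - δ)

theorem IsEquidistributed.exists_abs_sum_div_le {ζ : Measure Circle} {x : Circle} {F : Circle → ℝ}
    (hF : IsEquidistributed ζ x F) : ∃ K, ∀ n : ℕ, |∑ m ∈ Finset.Icc 1 n,
      (∫ u, F (x ^ m * u) ∂(prodLaw ζ m) - ∫ t in (0 : ℝ)..1, F (e t)) / m| ≤ K := by
  obtain ⟨C, δ, -, hδ, -, h⟩ := hF
  exact EwensCLT.exists_abs_sum_div_le hδ h

theorem integrable_prodLaw_zero (ζ : Measure Circle) [IsProbabilityMeasure ζ] {F : Circle → ℝ}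
    (hF : Measurable F) : Integrable F (prodLaw ζ 0) := by
  rw [prodLaw, integrable_map_measure hF.aestronglyMeasurable (by fun_prop)]
  have : (F ∘ fun u : Fin 0 → Circle => ∏ j, u j) = fun _ => F 1 := by
    funext u; simp
  rw [this]
  exact integrable_const _

/-- A power saving for `h` and `h²` bounds the centered sums against `1 / m`. The one for `|h|³` is
needed only for an `O(1 + log n)` bound, and the one for `|h|`, with the logarithmic growth, feeds
`exists_sum_mul_compWeight_le`. -/
theorem tendstoInDistribution_cycleSum_of_isEquidistributed {θ : ℝ} (hθ : 0 < θ) {h : Circle → ℝ}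
    (hh : Measurable h) {x : Circle} {ζ : Measure Circle} [IsProbabilityMeasure ζ]
    {Ω : ℕ → Type*} [∀ n, MeasurableSpace (Ω n)]
    (P : (n : ℕ) → Measure (Ω n)) [∀ n, IsProbabilityMeasure (P n)]
    (σ : (n : ℕ) → Ω n → Equiv.Perm (Fin n)) (hσ : ∀ n, Measurable (σ n))
    (hσ_law : ∀ n, (P n).map (σ n) = ewensMeasure θ n)
    (T : (n : ℕ) → ℕ → ℕ → Ω n → Circle) (hT : ∀ n m k, Measurable (T n m k))
    (hT_law : ∀ n m k, (P n).map (T n m k) = prodLaw ζ m)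
    (hT_indep : ∀ n, iIndepFun (fun (p : ℕ × ℕ) => T n p.1 p.2) (P n))
    (hσT_indep : ∀ n, IndepFun (σ n) (fun ω (p : ℕ × ℕ) => T n p.1 p.2 ω) (P n))
    (hint : ∀ m, 1 ≤ m → Integrable (fun u => |h (x ^ m * u)| ^ 3) (prodLaw ζ m))
    (h1 : IsEquidistributed ζ x h) (h2 : IsEquidistributed ζ x (fun u => h u ^ 2))
    (h3 : IsEquidistributed ζ x (fun u => |h u| ^ 3)) (h4 : IsEquidistributed ζ x (fun u => |h u|))
    (h5 : ∃ C, ∀ m : ℕ, 1 ≤ m → ∫ u, |h (x ^ m * u)| ∂(prodLaw ζ m) ≤ C * (1 + Real.log m)) :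
    TendstoInDistribution
      (fun (n : ℕ) (ω : Ω n) => cycleSum h x (σ n ω) (fun m k => T n m k ω) / √(Real.log n)
          - θ * (∫ t in (0 : ℝ)..1, h (e t)) * √(Real.log n))
      atTop (fun y : ℝ => y) P
      (gaussianReal 0 (θ * ∫ t in (0 : ℝ)..1, h (e t) ^ 2).toNNReal) := by
  obtain ⟨K₁, hK₁⟩ := h1.exists_abs_sum_div_le
  obtain ⟨K₂, hK₂⟩ := h2.exists_abs_sum_div_le
  obtain ⟨K₃, hK₃⟩ := h3.exists_abs_sum_div_le
  obtain ⟨C₄, δ, hC₄, hδ, hδ1, h4⟩ := h4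
  obtain ⟨C₅, h5⟩ := h5
  set A := ∫ t in (0 : ℝ)..1, |h (e t)| ^ 3 with hA
  have hA0 : 0 ≤ A := intervalIntegral.integral_nonneg zero_le_one fun t _ => by positivity
  have hlog : ∀ n : ℕ, 1 ≤ n → 0 ≤ Real.log n := fun n hn => Real.log_nonneg (by exact_mod_cast hn)
  obtain ⟨K₄, hK₄⟩ := exists_sum_mul_compWeight_le hθ (C := max C₄ C₅) hδ hδ1
    (H := fun m => ∫ u, |h (x ^ m * u)| ∂(prodLaw ζ m)) (fun m => integral_nonneg fun u => abs_nonneg _)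
    (fun m hm => (h5 m hm).trans (mul_le_mul_of_nonneg_right (le_max_right _ _)
      (by linarith [hlog m hm])))
    (fun M hM => (h4 M hM).trans (mul_le_mul_of_nonneg_right (le_max_left _ _) (by positivity)))
  set C := |K₁| + |K₂| + (|K₃| + 2 * A) + |K₄| with hC
  have e1 := abs_nonneg K₁
  have e2 := abs_nonneg K₂
  have e3 := abs_nonneg K₃
  have e4 := abs_nonneg K₄
  refine tendstoInDistribution_cycleSum hθ hh P σ hσ hσ_law T hT hT_law hT_indep hσT_indep (C := C)
    (intervalIntegral.integral_nonneg zero_le_one fun t _ => by positivity) (fun m => ?_)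
    (fun n => (hK₁ n).trans ?_) (fun n => (hK₂ n).trans ?_) (fun n hn => ?_)
    (fun n hn => (hK₄ n hn).trans ?_)
  -- The index `0` corresponds to no cycle; its law is the point mass at the empty product.
  · rcases Nat.eq_zero_or_pos m with rfl | hm
    · exact integrable_prodLaw_zero ζ (F := fun u => |h (x ^ 0 * u)| ^ 3) (by fun_prop)
    · exact hint m hm
  · linarith [le_abs_self K₁]
  · linarith [le_abs_self K₂]
  · have h6 := (abs_le.1 (hK₃ n)).2
    have h7 := (abs_le.1 (abs_sum_inv_sub_log_le hn)).2
    have h8 : ∑ m ∈ Finset.Icc 1 n, (∫ u, |h (x ^ m * u)| ^ 3 ∂(prodLaw ζ m)) / m =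
        ∑ m ∈ Finset.Icc 1 n, (∫ u, |h (x ^ m * u)| ^ 3 ∂(prodLaw ζ m) - A) / m +
        A * ∑ m ∈ Finset.Icc 1 n, 1 / (m : ℝ) := by
      rw [Finset.mul_sum, ← Finset.sum_add_distrib]
      exact Finset.sum_congr rfl fun m _ => by ring
    rw [h8]
    have h9 := mul_le_mul_of_nonneg_left h7 hA0
    have h10 := hlog n hn
    have h11 : 0 ≤ |K₁| + |K₂| + |K₃| + A + |K₄| := by linarith
    have h12 := mul_nonneg h11 h10
    rw [hC]
    nlinarith [le_abs_self K₃]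
  · linarith [le_abs_self K₄]

/-! ### The uniform law and laws with a Fourier density -/

theorem lintegral_uniformLaw {F : Circle → ENNReal} (hF : Measurable F) :
    ∫⁻ u, F u ∂uniformLaw = ∫⁻ t in Set.Icc (0 : ℝ) 1, F (e t) :=
  lintegral_map hF continuous_e.measurable

instance isProbabilityMeasure_uniformLaw : IsProbabilityMeasure uniformLaw := by
  have : IsProbabilityMeasure (volume.restrict (Set.Icc (0 : ℝ) 1)) := ⟨by simp⟩
  exact Measure.isProbabilityMeasure_map continuous_e.measurable.aemeasurable

theorem integral_uniformLaw {E : Type*} [NormedAddCommGroup E] [NormedSpace ℝ E] {F : Circle → E}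
    (hF : AEStronglyMeasurable F uniformLaw) :
    ∫ u, F u ∂uniformLaw = ∫ t in Set.Icc (0 : ℝ) 1, F (e t) :=
  integral_map continuous_e.measurable.aemeasurable hF

theorem toCircle_eq_e (t : ℝ) : AddCircle.toCircle (t : AddCircle (1 : ℝ)) = e t := by
  rw [AddCircle.toCircle_apply_mk, e, div_one]

theorem lintegral_uniformLaw_eq_addCircle {F : Circle → ENNReal} (hF : Measurable F) :
    ∫⁻ u, F u ∂uniformLaw = ∫⁻ b : UnitAddCircle, F (AddCircle.toCircle b) := by
  rw [lintegral_uniformLaw hF, ← UnitAddCircle.lintegral_preimage 0, zero_add,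
    restrict_Ioc_eq_restrict_Icc]
  simp only [toCircle_eq_e]

/-- Invariance is transported from the Haar measure of `UnitAddCircle`. It lets the shift by `x^m`
be dropped from integrals against the uniform law. -/
instance isMulLeftInvariant_uniformLaw : uniformLaw.IsMulLeftInvariant where
  map_mul_left_eq_self g := by
    refine Measure.ext_of_lintegral _ fun F hF => ?_
    obtain ⟨s, -, rfl⟩ := exists_e_eq g
    rw [lintegral_map hF (by fun_prop), lintegral_uniformLaw_eq_addCircle (by fun_prop),
      lintegral_uniformLaw_eq_addCircle hF, ← toCircle_eq_e]
    simp only [← AddCircle.toCircle_add]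
    exact lintegral_add_left_eq_self (fun b : UnitAddCircle => F (AddCircle.toCircle b)) _

theorem lintegral_prodLaw_succ (ζ : Measure Circle) [IsProbabilityMeasure ζ] (m : ℕ)
    {F : Circle → ENNReal} (hF : Measurable F) :
    ∫⁻ u, F u ∂prodLaw ζ (m + 1) = ∫⁻ v, ∫⁻ u, F (u * v) ∂ζ ∂prodLaw ζ m := by
  have h1 := (measurePreserving_piFinSuccAbove (fun _ : Fin (m + 1) => ζ) 0)
  rw [prodLaw, prodLaw, lintegral_map hF (by fun_prop), lintegral_map (by fun_prop) (by fun_prop)]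
  have h2 : ∀ w : Fin (m + 1) → Circle, F (∏ j, w j) =
      (fun p : Circle × (Fin m → Circle) => F (p.1 * ∏ j, p.2 j))
        (MeasurableEquiv.piFinSuccAbove (fun _ => Circle) 0 w) := fun w => by
    simp [Fin.prod_univ_succ, MeasurableEquiv.piFinSuccAbove, Fin.insertNthEquiv, Fin.tail]
  simp only [h2]
  rw [h1.lintegral_comp (f := fun p : Circle × (Fin m → Circle) => F (p.1 * ∏ j, p.2 j))
    (by fun_prop), lintegral_prod_symm _ (by fun_prop)]

theorem continuous_coe_zpow (j : ℤ) : Continuous fun u : Circle => (u : ℂ) ^ j := by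
  have : (fun u : Circle => (u : ℂ) ^ j) = fun u : Circle => ((u ^ j : Circle) : ℂ) := by
    funext u; simp
  rw [this]
  exact continuous_induced_dom.comp (continuous_zpow j)

theorem integral_zpow_prodLaw (ζ : Measure Circle) [IsProbabilityMeasure ζ] (m : ℕ) (j : ℤ) :
    ∫ u, ((u : ℂ) ^ j) ∂prodLaw ζ m = (∫ u, ((u : ℂ) ^ j) ∂ζ) ^ m := by
  have hmeas := (continuous_coe_zpow j).measurable
  rw [prodLaw, integral_map (by fun_prop) hmeas.aestronglyMeasurable]
  have := integral_fintype_prod_eq_pow (ι := Fin m) (μ := ζ) (fun u : Circle => (u : ℂ) ^ j)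
  rw [Fintype.card_fin] at this
  rw [← this]
  refine integral_congr_ae (Eventually.of_forall fun w => ?_)
  beta_reduce
  rw [Finset.prod_zpow]
  exact congrArg (· ^ j) (map_prod Circle.coeHom w Finset.univ)

theorem integral_zpow_uniformLaw (j : ℤ) :
    ∫ u, ((u : ℂ) ^ j) ∂uniformLaw = if j = 0 then 1 else 0 := by
  split_ifs with h
  · simp [h]
  have hmeas := (continuous_coe_zpow j).measurable
  rw [integral_uniformLaw hmeas.aestronglyMeasurable, integral_Icc_eq_integral_Ioc,
    ← intervalIntegral.integral_of_le zero_le_one]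
  have h1 : ∀ t : ℝ, (e t : ℂ) ^ j = Complex.exp ((j * (2 * Real.pi * Complex.I)) * t) := fun t => by
    rw [coe_e, ← Complex.exp_int_mul]; congr 1; ring
  have h2 : (j : ℂ) * (2 * Real.pi * Complex.I) ≠ 0 := by
    refine mul_ne_zero (by exact_mod_cast h) ?_
    exact Complex.two_pi_I_ne_zero
  simp only [h1]
  rw [integral_exp_mul_complex h2]
  simp [Complex.exp_int_mul_two_pi_mul_I]

/-- `γ` is the real continuous density with absolutely summable Fourier coefficients `c` of the law
`ζ` with respect to the uniform law. -/
structure HasFourierDensity (ζ : Measure Circle) (γ : Circle → ℝ) (c : ℤ → ℂ) : Prop where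
  nonneg : ∀ u, 0 ≤ γ u
  hasSum : ∀ u : Circle, HasSum (fun j : ℤ => c j * (u : ℂ) ^ j) (γ u : ℂ)
  summable : Summable fun j => ‖c j‖
  eq_withDensity : ζ = uniformLaw.withDensity fun u => ENNReal.ofReal (γ u)

namespace HasFourierDensity

variable {ζ : Measure Circle} {γ : Circle → ℝ} {c : ℤ → ℂ}

theorem norm_term (c : ℤ → ℂ) (u : Circle) (j : ℤ) : ‖c j * (u : ℂ) ^ j‖ = ‖c j‖ := by
  rw [norm_mul, norm_zpow, Circle.norm_coe, one_zpow, mul_one]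

theorem continuous_of_hasSum (hγ : ∀ u : Circle, HasSum (fun j : ℤ => c j * (u : ℂ) ^ j) (γ u : ℂ))
    (hc : Summable fun j => ‖c j‖) : Continuous γ := by
  have h1 : Continuous fun u : Circle => ∑' j : ℤ, c j * (u : ℂ) ^ j :=
    continuous_tsum (fun j => continuous_const.mul (continuous_coe_zpow j)) hc
      fun j u => (norm_term c u j).le
  have h2 : γ = fun u : Circle => (∑' j : ℤ, c j * (u : ℂ) ^ j).re := by
    funext u; rw [(hγ u).tsum_eq, Complex.ofReal_re]
  rw [h2]
  exact Complex.continuous_re.comp h1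

theorem continuous (H : HasFourierDensity ζ γ c) : Continuous γ :=
  continuous_of_hasSum H.hasSum H.summable

theorem le_tsum (H : HasFourierDensity ζ γ c) (u : Circle) : γ u ≤ ∑' j, ‖c j‖ := by
  have h1 : ‖(γ u : ℂ)‖ ≤ ∑' j, ‖c j‖ := by
    rw [← (H.hasSum u).tsum_eq]
    exact tsum_of_norm_bounded H.summable.hasSum fun j => (norm_term c u j).le
  rw [Complex.norm_real, Real.norm_eq_abs, abs_of_nonneg (H.nonneg u)] at h1
  exact h1

theorem integrable_term (μ : Measure Circle) [IsFiniteMeasure μ] (a : ℂ) (j : ℤ) :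
    Integrable (fun u : Circle => a * (u : ℂ) ^ j) μ := by
  refine Integrable.of_bound (C := ‖a‖)
    (continuous_const.mul (continuous_coe_zpow j)).measurable.aestronglyMeasurable
    (Eventually.of_forall fun u => ?_)
  rw [norm_mul, norm_zpow, Circle.norm_coe, one_zpow, mul_one]

/-- Termwise integration of `γ (v u⁻¹) u^k` against a probability measure. -/
theorem hasSum_integral (H : HasFourierDensity ζ γ c) (μ : Measure Circle) [IsProbabilityMeasure μ]
    (v : Circle) (k : ℤ) :
    HasSum (fun j : ℤ => c j * (v : ℂ) ^ j * ∫ u, ((u : ℂ) ^ (k - j)) ∂μ)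
      (∫ u, (γ (v * u⁻¹) : ℂ) * (u : ℂ) ^ k ∂μ) := by
  have h1 : ∀ (u : Circle) (j : ℤ), c j * ((v * u⁻¹ : Circle) : ℂ) ^ j * (u : ℂ) ^ k =
      c j * (v : ℂ) ^ j * (u : ℂ) ^ (k - j) := fun u j => by
    rw [Circle.coe_mul, Circle.coe_inv, mul_zpow, inv_zpow, zpow_sub₀ (Circle.coe_ne_zero u)]
    ring
  have h2 : ∀ u : Circle, (γ (v * u⁻¹) : ℂ) * (u : ℂ) ^ k =
      ∑' j : ℤ, c j * (v : ℂ) ^ j * (u : ℂ) ^ (k - j) := fun u => by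
    rw [← ((H.hasSum (v * u⁻¹)).mul_right ((u : ℂ) ^ k)).tsum_eq]
    exact tsum_congr fun j => h1 u j
  have h3 : Summable fun j : ℤ => ∫ u, ‖c j * (v : ℂ) ^ j * (u : ℂ) ^ (k - j)‖ ∂μ := by
    refine H.summable.congr fun j => ?_
    simp only [norm_mul, norm_zpow, Circle.norm_coe, one_zpow, mul_one, integral_const,
      probReal_univ, smul_eq_mul, one_mul]
  have h4 := hasSum_integral_of_summable_integral_norm
    (fun j => integrable_term μ (c j * (v : ℂ) ^ j) (k - j)) h3
  simp only [integral_const_mul] at h4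
  simp only [h2]
  exact h4

/-- Termwise integration and orthogonality: the coefficients in the density are the moments of `ζ`,
so for a product of independent variables they become powers. -/
theorem integral_zpow_neg (H : HasFourierDensity ζ γ c) (j : ℤ) :
    ∫ u, ((u : ℂ) ^ (-j)) ∂ζ = c j := by
  rw [H.eq_withDensity, integral_withDensity_eq_integral_toReal_smul
    H.continuous.measurable.ennreal_ofReal (by simp)]
  have h1 : ∀ u : Circle, (ENNReal.ofReal (γ u)).toReal • (u : ℂ) ^ (-j) =
      ∑' i : ℤ, c i * (u : ℂ) ^ (i - j) := fun u => by
    rw [ENNReal.toReal_ofReal (H.nonneg u), Complex.real_smul,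
      ← ((H.hasSum u).mul_right ((u : ℂ) ^ (-j))).tsum_eq]
    refine tsum_congr fun i => ?_
    rw [sub_eq_add_neg, zpow_add₀ (Circle.coe_ne_zero u), mul_assoc]
  have h3 : Summable fun i : ℤ => ∫ u : Circle, ‖c i * (u : ℂ) ^ (i - j)‖ ∂uniformLaw := by
    refine H.summable.congr fun i => ?_
    simp only [norm_mul, norm_zpow, Circle.norm_coe, one_zpow, mul_one, integral_const,
      probReal_univ, smul_eq_mul, one_mul]
  have h4 := hasSum_integral_of_summable_integral_norm
    (fun i => integrable_term uniformLaw (c i) (i - j)) h3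
  simp only [integral_const_mul, integral_zpow_uniformLaw] at h4
  simp only [h1]
  rw [← h4.tsum_eq, tsum_eq_single j (fun i hi => by rw [if_neg (sub_ne_zero.2 hi), mul_zero])]
  simp

/-- Summability leaves only finitely many coefficients of norm at least `1 / 2`, so the pointwise
bound becomes uniform. -/
theorem exists_lt_one (H : HasFourierDensity ζ γ c) (hc : ∀ j, j ≠ 0 → ‖c j‖ < 1) :
    ∃ r : ℝ, 0 ≤ r ∧ r < 1 ∧ ∀ j, j ≠ 0 → ‖c j‖ ≤ r := by
  have h1 : ∀ᶠ j in cofinite, ‖c j‖ < 1 / 2 :=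
    (H.summable.tendsto_cofinite_zero).eventually_lt_const (by norm_num)
  have h2 : {j : ℤ | ¬ ‖c j‖ < 1 / 2}.Finite := h1
  set S := h2.toFinset.erase 0 with hS
  have h3 : ∃ r : ℝ, 1 / 2 ≤ r ∧ r < 1 ∧ ∀ j ∈ S, ‖c j‖ ≤ r := by
    have : ∀ S : Finset ℤ, (∀ j ∈ S, ‖c j‖ < 1) →
        ∃ r : ℝ, 1 / 2 ≤ r ∧ r < 1 ∧ ∀ j ∈ S, ‖c j‖ ≤ r := by
      intro S
      induction S using Finset.induction_on with
      | empty => exact fun _ => ⟨1 / 2, le_rfl, by norm_num, by simp⟩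
      | insert a S _ ih =>
        intro h
        obtain ⟨r, hr, hr1, hrS⟩ := ih fun j hj => h j (Finset.mem_insert_of_mem hj)
        refine ⟨max r ‖c a‖, hr.trans (le_max_left _ _),
          max_lt hr1 (h a (Finset.mem_insert_self _ _)), fun j hj => ?_⟩
        rcases Finset.mem_insert.1 hj with rfl | hj
        · exact le_max_right _ _
        · exact (hrS j hj).trans (le_max_left _ _)
    exact this S fun j hj => hc j (Finset.ne_of_mem_erase hj)
  obtain ⟨r, hr, hr1, hrS⟩ := h3
  refine ⟨r, by linarith, hr1, fun j hj => ?_⟩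
  by_cases hj2 : ‖c j‖ < 1 / 2
  · linarith
  · exact hrS j (Finset.mem_erase.2 ⟨hj, h2.mem_toFinset.2 hj2⟩)

variable [IsProbabilityMeasure ζ]

theorem coeff_zero (H : HasFourierDensity ζ γ c) : c 0 = 1 := by
  rw [← H.integral_zpow_neg 0]
  simp

/-- The density of the product of `m + 1` independent variables. -/
noncomputable def prodDensity (ζ : Measure Circle) (γ : Circle → ℝ) (m : ℕ) (v : Circle) : ℝ :=
  ∫ u, γ (v * u⁻¹) ∂prodLaw ζ m

/-- One factor supplies the density, the other `m` are convolved with it; translation invariance of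
the uniform law and Tonelli's theorem do the rest. -/
theorem prodLaw_succ (H : HasFourierDensity ζ γ c) (m : ℕ) :
    prodLaw ζ (m + 1) = uniformLaw.withDensity fun v => ENNReal.ofReal (prodDensity ζ γ m v) := by
  have hγ := H.continuous.measurable
  have hD : ∀ v, ENNReal.ofReal (prodDensity ζ γ m v) =
      ∫⁻ u, ENNReal.ofReal (γ (v * u⁻¹)) ∂prodLaw ζ m := fun v => by
    refine ofReal_integral_eq_lintegral_ofReal ?_ (Eventually.of_forall fun u => H.nonneg _)
    refine Integrable.of_bound (C := ∑' j, ‖c j‖)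
      (hγ.comp (by fun_prop)).aestronglyMeasurable (Eventually.of_forall fun u => ?_)
    rw [Real.norm_eq_abs, abs_of_nonneg (H.nonneg _)]
    exact H.le_tsum _
  have hmeas : Measurable fun v => ∫⁻ u, ENNReal.ofReal (γ (v * u⁻¹)) ∂prodLaw ζ m :=
    Measurable.lintegral_prod_right' (f := fun p : Circle × Circle => ENNReal.ofReal (γ (p.1 * p.2⁻¹)))
      (by fun_prop)
  refine Measure.ext_of_lintegral _ fun F hF => ?_
  simp only [hD]
  rw [lintegral_prodLaw_succ ζ m hF, lintegral_withDensity_eq_lintegral_mul _ hmeas hF]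
  have h1 : ∀ v : Circle, ∫⁻ u, F (u * v) ∂ζ =
      ∫⁻ u, ENNReal.ofReal (γ (u * v⁻¹)) * F u ∂uniformLaw := fun v => by
    rw [H.eq_withDensity, lintegral_withDensity_eq_lintegral_mul _ (by fun_prop) (by fun_prop)]
    rw [← lintegral_mul_left_eq_self (fun u => ENNReal.ofReal (γ (u * v⁻¹)) * F u) v]
    refine lintegral_congr fun u => ?_
    simp only [Pi.mul_apply]
    rw [mul_comm v u, mul_inv_cancel_right]
  simp only [h1]
  rw [lintegral_lintegral_swap (by fun_prop)]
  refine lintegral_congr fun v => ?_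
  rw [Pi.mul_apply, lintegral_mul_const _ (by fun_prop)]

/-- The Fourier series of the density is `∑ c_j ^ (m + 1) v ^ j`. The term `j = 0` is `1`, and every
other term is at most `‖c_j‖ r ^ m`. -/
theorem abs_prodDensity_sub_one_le (H : HasFourierDensity ζ γ c) {r : ℝ} (hr : 0 ≤ r)
    (hc : ∀ j, j ≠ 0 → ‖c j‖ ≤ r) (m : ℕ) (v : Circle) :
    |prodDensity ζ γ m v - 1| ≤ (∑' j, ‖c j‖) * r ^ m := by
  have h1 := H.hasSum_integral (prodLaw ζ m) v 0
  simp only [zero_sub, integral_zpow_prodLaw, H.integral_zpow_neg, zpow_zero, mul_one] at h1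
  have h2 : ∫ u, (γ (v * u⁻¹) : ℂ) ∂prodLaw ζ m = (prodDensity ζ γ m v : ℂ) := integral_ofReal
  rw [h2] at h1
  have h3 : HasSum (fun j : ℤ => if j = 0 then (1 : ℂ) else 0) 1 := by
    simpa using hasSum_ite_eq (0 : ℤ) (1 : ℂ)
  have h4 := h1.sub h3
  have h5 : ‖(prodDensity ζ γ m v : ℂ) - 1‖ ≤ (∑' j, ‖c j‖) * r ^ m := by
    rw [← h4.tsum_eq]
    refine tsum_of_norm_bounded (H.summable.hasSum.mul_right (r ^ m)) fun j => ?_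
    split_ifs with hj
    · subst hj
      simp only [H.coeff_zero, zpow_zero, one_pow, mul_one, sub_self, norm_zero, norm_one, one_mul]
      positivity
    · rw [sub_zero, norm_mul, norm_term, norm_pow]
      exact mul_le_mul_of_nonneg_left (pow_le_pow_left₀ (norm_nonneg _) (hc j hj) m) (norm_nonneg _)
  rwa [← Complex.ofReal_one, ← Complex.ofReal_sub, Complex.norm_real] at h5

theorem integrable_prodLaw_succ (H : HasFourierDensity ζ γ c) {r : ℝ} (hr : 0 ≤ r)
    (hc : ∀ j, j ≠ 0 → ‖c j‖ ≤ r) (m : ℕ) {F : Circle → ℝ} (hF : Integrable F uniformLaw) :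
    Integrable F (prodLaw ζ (m + 1)) ∧
    |∫ u, F u ∂prodLaw ζ (m + 1) - ∫ u, F u ∂uniformLaw| ≤
      (∑' j, ‖c j‖) * r ^ m * ∫ u, |F u| ∂uniformLaw := by
  have hγ := H.continuous.measurable
  have hDm : Measurable (prodDensity ζ γ m) := by
    have : StronglyMeasurable fun v => ∫ u, γ (v * u⁻¹) ∂prodLaw ζ m :=
      StronglyMeasurable.integral_prod_right' (f := fun p : Circle × Circle => γ (p.1 * p.2⁻¹))
        (by fun_prop : Measurable fun p : Circle × Circle => γ (p.1 * p.2⁻¹)).stronglyMeasurable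
    exact this.measurable
  have hD0 : ∀ v, 0 ≤ prodDensity ζ γ m v := fun v => integral_nonneg fun u => H.nonneg _
  have hsub : Integrable (fun v => (prodDensity ζ γ m v - 1) * F v) uniformLaw :=
    hF.bdd_mul (hDm.sub_const 1).aestronglyMeasurable
      (Eventually.of_forall fun v => H.abs_prodDensity_sub_one_le hr hc m v)
  have hint : Integrable (fun v => prodDensity ζ γ m v * F v) uniformLaw := by
    refine (hsub.add hF).congr (Eventually.of_forall fun v => ?_)
    simp only [Pi.add_apply]
    ring
  have hre : ∀ v, (ENNReal.ofReal (prodDensity ζ γ m v)).toReal • F v = prodDensity ζ γ m v * F v :=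
    fun v => by rw [ENNReal.toReal_ofReal (hD0 v), smul_eq_mul]
  rw [H.prodLaw_succ m]
  constructor
  · rw [integrable_withDensity_iff_integrable_smul' hDm.ennreal_ofReal (by simp)]
    simpa only [hre] using hint
  · rw [integral_withDensity_eq_integral_toReal_smul hDm.ennreal_ofReal (by simp)]
    simp only [hre]
    rw [← integral_sub hint hF, ← integral_const_mul]
    rw [← Real.norm_eq_abs]
    refine (norm_integral_le_of_norm_le (hF.abs.const_mul _) (Eventually.of_forall fun v => ?_))
    have : prodDensity ζ γ m v * F v - F v = (prodDensity ζ γ m v - 1) * F v := by ring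
    rw [this, norm_mul]
    exact mul_le_mul_of_nonneg_right (H.abs_prodDensity_sub_one_le hr hc m v) (abs_nonneg _)

end HasFourierDensity

theorem hasFourierDensity_uniformLaw :
    HasFourierDensity uniformLaw (fun _ => 1) (fun j => if j = 0 then 1 else 0) where
  nonneg _ := zero_le_one
  hasSum u := by
    have h1 := hasSum_ite_eq (0 : ℤ) (1 : ℂ)
    have h2 : (fun j : ℤ => (if j = 0 then (1 : ℂ) else 0) * (u : ℂ) ^ j) =
        fun j : ℤ => if j = 0 then (1 : ℂ) else 0 := by
      funext j
      split_ifs with hj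
      · rw [hj, zpow_zero, mul_one]
      · rw [zero_mul]
    rw [h2, Complex.ofReal_one]
    exact h1
  summable := by
    refine summable_of_ne_finset_zero (s := {0}) fun j hj => ?_
    rw [if_neg (by simpa using hj), norm_zero]
  eq_withDensity := by simp

/-- The series itself defines the density as a function on the circle, which agrees with `g` on all
of `[0, 1]`. -/
theorem HasSummableFourierDensity.exists_hasFourierDensity {ζ : Measure Circle}
    (h : HasSummableFourierDensity ζ) :
    ∃ γ c, HasFourierDensity ζ γ c ∧ ∀ j : ℤ, j ≠ 0 → ‖c j‖ < 1 := by
  obtain ⟨g, c, hg, hζ, hsum, hc, hcs⟩ := h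
  have hterm : ∀ (j : ℤ) (φ : ℝ), c j * Complex.exp (2 * Real.pi * Complex.I * j * φ) =
      c j * (e φ : ℂ) ^ j := fun j φ => by
    rw [coe_e, ← Complex.exp_int_mul]
    congr 2
    ring
  simp only [hterm] at hsum
  set γ : Circle → ℝ := fun u => (∑' j : ℤ, c j * (u : ℂ) ^ j).re with hγ
  have hγe : ∀ φ ∈ Set.Icc (0 : ℝ) 1, γ (e φ) = g φ := fun φ hφ => by
    rw [hγ]
    simp only [(hsum φ hφ).tsum_eq, Complex.ofReal_re]
  have hnonneg : ∀ u, 0 ≤ γ u := fun u => by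
    obtain ⟨φ, hφ, rfl⟩ := exists_e_eq u
    have hφ' : φ ∈ Set.Icc (0 : ℝ) 1 := Set.Ico_subset_Icc_self hφ
    rw [hγe φ hφ']
    exact hg φ hφ'
  have hasSum : ∀ u : Circle, HasSum (fun j : ℤ => c j * (u : ℂ) ^ j) (γ u : ℂ) := fun u => by
    obtain ⟨φ, hφ, rfl⟩ := exists_e_eq u
    have hφ' : φ ∈ Set.Icc (0 : ℝ) 1 := Set.Ico_subset_Icc_self hφ
    rw [hγe φ hφ']
    exact hsum φ hφ'
  have hcont : Continuous γ := HasFourierDensity.continuous_of_hasSum hasSum hcs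
  refine ⟨γ, c, ⟨hnonneg, hasSum, hcs, ?_⟩, hc⟩
  have hm := continuous_e.measurable
  have hγm := hcont.measurable
  have h1 : (volume.restrict (Set.Icc (0 : ℝ) 1)).withDensity (fun φ => ENNReal.ofReal (g φ)) =
      (volume.restrict (Set.Icc (0 : ℝ) 1)).withDensity (fun φ => ENNReal.ofReal (γ (e φ))) := by
    refine withDensity_congr_ae ?_
    filter_upwards [ae_restrict_mem measurableSet_Icc] with φ hφ
    rw [hγe φ hφ]
  rw [hζ, h1]
  refine Measure.ext_of_lintegral _ fun F hF => ?_
  rw [lintegral_map hF hm, lintegral_withDensity_eq_lintegral_mul _ (by fun_prop) (by fun_prop),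
    lintegral_withDensity_eq_lintegral_mul _ (by fun_prop) hF, lintegral_uniformLaw (by fun_prop)]
  rfl

theorem sum_Icc_pow_sub_one_le {r : ℝ} (hr : 0 ≤ r) (hr1 : r < 1) (M : ℕ) :
    ∑ m ∈ Finset.Icc 1 M, r ^ (m - 1) ≤ (1 - r)⁻¹ := by
  have h1 : ∑ m ∈ Finset.Icc 1 M, r ^ (m - 1) = ∑ i ∈ Finset.range M, r ^ i := by
    have := Finset.sum_Ico_add' (fun m : ℕ => r ^ (m - 1)) 0 M 1
    rw [Finset.range_eq_Ico]
    exact this.symm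
  rw [h1, ← tsum_geometric_of_lt_one hr hr1]
  exact (summable_geometric_of_lt_one hr hr1).sum_le_tsum _ fun i _ => pow_nonneg hr i

theorem integrable_uniformLaw {F : Circle → ℝ} (hF : Measurable F)
    (hint : IntegrableOn (fun t => F (e t)) (Set.Icc 0 1)) : Integrable F uniformLaw :=
  (integrable_map_measure hF.aestronglyMeasurable continuous_e.measurable.aemeasurable).2 hint

namespace HasFourierDensity

variable {ζ : Measure Circle} {γ : Circle → ℝ} {c : ℤ → ℂ} [IsProbabilityMeasure ζ]

theorem exists_integral_prodLaw_bound (H : HasFourierDensity ζ γ c) (hc : ∀ j, j ≠ 0 → ‖c j‖ < 1)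
    (x : Circle) {F : Circle → ℝ} (hF : Measurable F)
    (hint : IntegrableOn (fun t => F (e t)) (Set.Icc 0 1)) :
    ∃ K r : ℝ, 0 ≤ K ∧ 0 ≤ r ∧ r < 1 ∧ ∀ m : ℕ, 1 ≤ m →
      Integrable (fun u => F (x ^ m * u)) (prodLaw ζ m) ∧
      |∫ u, F (x ^ m * u) ∂prodLaw ζ m - ∫ t in (0 : ℝ)..1, F (e t)| ≤ K * r ^ (m - 1) := by
  obtain ⟨r, hr, hr1, hcr⟩ := H.exists_lt_one hc
  have hFU := integrable_uniformLaw hF hint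
  have h0 : ∫ t in (0 : ℝ)..1, F (e t) = ∫ u, F u ∂uniformLaw := by
    rw [intervalIntegral_eq_integral_Icc, integral_uniformLaw hF.aestronglyMeasurable]
  refine ⟨(∑' j, ‖c j‖) * ∫ u, |F u| ∂uniformLaw, r,
    mul_nonneg (tsum_nonneg fun j => norm_nonneg _) (integral_nonneg fun u => abs_nonneg _),
    hr, hr1, fun m hm => ?_⟩
  obtain ⟨k, rfl⟩ := Nat.exists_eq_add_of_le' hm
  -- Here `k = m - 1`: one of the `m` factors is spent on having a bounded density, whence the
  -- exponent of `r`.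
  have h1 := H.integrable_prodLaw_succ hr hcr k (hFU.comp_mul_left (x ^ (k + 1)))
  refine ⟨h1.1, ?_⟩
  have h2 := h1.2
  rw [integral_mul_left_eq_self (μ := uniformLaw) F, integral_mul_left_eq_self (fun u => |F u|), mul_right_comm] at h2
  rw [h0, Nat.add_sub_cancel]
  exact h2

/-- The deviations are exponentially small, so their sum is bounded; the exponent `1 / 2` is an
arbitrary choice. -/
theorem isEquidistributed (H : HasFourierDensity ζ γ c) (hc : ∀ j, j ≠ 0 → ‖c j‖ < 1)
    (x : Circle) {F : Circle → ℝ} (hF : Measurable F)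
    (hint : IntegrableOn (fun t => F (e t)) (Set.Icc 0 1)) : IsEquidistributed ζ x F := by
  obtain ⟨K, r, hK, hr, hr1, h⟩ := H.exists_integral_prodLaw_bound hc x hF hint
  have hr2 : 0 < (1 - r)⁻¹ := inv_pos.2 (by linarith)
  refine ⟨K * (1 - r)⁻¹, 1 / 2, by positivity, by norm_num, by norm_num, fun M hM => ?_⟩
  have h1 : (1 : ℝ) ≤ (M : ℝ) ^ (1 - 1 / 2 : ℝ) :=
    Real.one_le_rpow (by exact_mod_cast hM) (by norm_num)
  refine (Finset.abs_sum_le_sum_abs _ _).trans ?_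
  refine (Finset.sum_le_sum fun m hm => (h m (Finset.mem_Icc.1 hm).1).2).trans ?_
  rw [← Finset.mul_sum]
  calc K * ∑ m ∈ Finset.Icc 1 M, r ^ (m - 1) ≤ K * (1 - r)⁻¹ :=
        mul_le_mul_of_nonneg_left (sum_Icc_pow_sub_one_le hr hr1 M) hK
    _ ≤ _ := le_mul_of_one_le_right (by positivity) h1

theorem exists_integral_le (H : HasFourierDensity ζ γ c) (hc : ∀ j, j ≠ 0 → ‖c j‖ < 1)
    (x : Circle) {F : Circle → ℝ} (hF : Measurable F)
    (hint : IntegrableOn (fun t => F (e t)) (Set.Icc 0 1)) :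
    ∃ C, ∀ m : ℕ, 1 ≤ m → ∫ u, F (x ^ m * u) ∂(prodLaw ζ m) ≤ C * (1 + Real.log m) := by
  obtain ⟨K, r, hK, hr, hr1, h⟩ := H.exists_integral_prodLaw_bound hc x hF hint
  refine ⟨|∫ t in (0 : ℝ)..1, F (e t)| + K, fun m hm => ?_⟩
  have h1 := (abs_le.1 (h m hm).2).2
  have h2 : K * r ^ (m - 1) ≤ K := mul_le_of_le_one_right hK (pow_le_one₀ hr hr1.le)
  have h3 : 0 ≤ Real.log m := Real.log_nonneg (by exact_mod_cast hm)
  have h4 := le_abs_self (∫ t in (0 : ℝ)..1, F (e t))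
  have h5 := mul_nonneg (add_nonneg (abs_nonneg (∫ t in (0 : ℝ)..1, F (e t))) hK) h3
  linarith

end HasFourierDensity

/-! ### Laws carried by roots of unity -/

theorem sum_range_pow_eq_ite {ρ : ℕ} {w : ℂ} (hw : w ^ ρ = 1) :
    ∑ j ∈ Finset.range ρ, w ^ j = if w = 1 then (ρ : ℂ) else 0 := by
  split_ifs with h
  · simp [h]
  · have := mul_geom_sum w ρ
    rw [hw, sub_self] at this
    exact (mul_eq_zero.1 this).resolve_left (sub_ne_zero.2 h)

theorem sum_Icc_pow_eq_ite {ρ : ℕ} {w : ℂ} (hw : w ^ ρ = 1) :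
    ∑ k ∈ Finset.Icc 1 ρ, w ^ k = if w = 1 then (ρ : ℂ) else 0 := by
  have h1 : ∑ k ∈ Finset.Icc 1 ρ, w ^ k = w * ∑ j ∈ Finset.range ρ, w ^ j := by
    have := Finset.sum_Ico_add' (fun m : ℕ => w ^ m) 0 ρ 1
    rw [Finset.range_eq_Ico, Finset.mul_sum]
    exact this.symm.trans (Finset.sum_congr rfl fun i _ => pow_succ' w i)
  rw [h1, sum_range_pow_eq_ite hw]
  split_ifs with h
  · rw [h, one_mul]
  · rw [mul_zero]

theorem e_div_pow {ρ : ℕ} (hρ : 0 < ρ) (k : ℕ) : e ((k : ℝ) / ρ) ^ ρ = 1 := by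
  rw [← e_nat_mul]
  have : (ρ : ℝ) * ((k : ℝ) / ρ) = ((k : ℤ) : ℝ) := by
    have : (ρ : ℝ) ≠ 0 := by positivity
    push_cast; field_simp
  rw [this, e_intCast]

theorem e_div_injOn {ρ : ℕ} (hρ : 0 < ρ) :
    Set.InjOn (fun k : ℕ => e ((k : ℝ) / ρ)) (Finset.Icc 1 ρ) := by
  intro k hk l hl h
  have hρR : (ρ : ℝ) ≠ 0 := by positivity
  have hk' := Finset.mem_Icc.1 hk
  have hl' := Finset.mem_Icc.1 hl
  have h1 : e (((k : ℝ) - l) / ρ) = 1 := by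
    have h2 : e ((k : ℝ) / ρ) = e (((k : ℝ) - l) / ρ) * e ((l : ℝ) / ρ) := by
      rw [← e_add]; congr 1; ring
    simp only at h
    rw [h] at h2
    exact (right_eq_mul.1 h2)
  obtain ⟨j, hj⟩ := (e_eq_one_iff _).1 h1
  rw [div_eq_iff hρR] at hj
  have h3 : (k : ℤ) - l = j * ρ := by exact_mod_cast hj
  have h4 : (k : ℤ) - l = 0 :=
    Int.eq_zero_of_abs_lt_dvd (m := ρ) ⟨j, by rw [h3, mul_comm]⟩ (by rw [abs_lt]; omega)
  omega

theorem exists_eq_e_div {ρ : ℕ} (hρ : 0 < ρ) {u : Circle} (hu : u ^ ρ = 1) :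
    ∃ k ∈ Finset.Icc 1 ρ, u = e ((k : ℝ) / ρ) := by
  obtain ⟨t, ht, rfl⟩ := exists_e_eq u
  have hρR : (0 : ℝ) < ρ := by exact_mod_cast hρ
  rw [← e_nat_mul] at hu
  obtain ⟨j, hj⟩ := (e_eq_one_iff _).1 hu
  have h0 : 0 ≤ j := by
    have : (0 : ℝ) ≤ j := hj ▸ mul_nonneg hρR.le ht.1
    exact_mod_cast this
  have h1 : j < ρ := by
    have : (j : ℝ) < ρ := by rw [← hj]; nlinarith [ht.2]
    exact_mod_cast this
  lift j to ℕ using h0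
  have h2 : t = (j : ℝ) / ρ := by
    rw [eq_div_iff hρR.ne', mul_comm]; exact_mod_cast hj
  rcases Nat.eq_zero_or_pos j with rfl | hpos
  · refine ⟨ρ, Finset.mem_Icc.2 ⟨hρ, le_rfl⟩, ?_⟩
    have h3 := e_intCast 0
    have h4 := e_intCast 1
    rw [h2, div_self hρR.ne']
    simp only [Nat.cast_zero, zero_div]
    push_cast at h3 h4
    rw [h3, h4]
  · exact ⟨j, Finset.mem_Icc.2 ⟨hpos, by exact_mod_cast h1.le⟩, by rw [h2]⟩

theorem ae_eq_sum_indicator {ρ : ℕ} (hρ : 0 < ρ) {μ : Measure Circle} (hμ : ∀ᵐ u ∂μ, u ^ ρ = 1)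
    {E : Type*} [NormedAddCommGroup E] (F : Circle → E) :
    F =ᵐ[μ] fun u => ∑ k ∈ Finset.Icc 1 ρ,
      Set.indicator {e ((k : ℝ) / ρ)} (fun _ => F (e ((k : ℝ) / ρ))) u := by
  filter_upwards [hμ] with u hu
  obtain ⟨k, hk, rfl⟩ := exists_eq_e_div hρ hu
  rw [Finset.sum_eq_single_of_mem k hk]
  · simp
  · intro l hl hlk
    refine Set.indicator_of_notMem ?_ _
    intro h
    exact hlk (e_div_injOn hρ hl hk h.symm)

/-- The measure is carried by finitely many points, so `F` needs no measurability. -/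
theorem integrable_of_ae_pow_eq_one {ρ : ℕ} (hρ : 0 < ρ) {μ : Measure Circle} [IsFiniteMeasure μ]
    (hμ : ∀ᵐ u ∂μ, u ^ ρ = 1) {E : Type*} [NormedAddCommGroup E] (F : Circle → E) :
    Integrable F μ := by
  refine Integrable.congr ?_ (ae_eq_sum_indicator hρ hμ F).symm
  refine integrable_finsetSum _ fun k _ => ?_
  exact (integrable_const _).indicator (measurableSet_singleton _)

theorem integral_of_ae_pow_eq_one {ρ : ℕ} (hρ : 0 < ρ) {μ : Measure Circle} [IsFiniteMeasure μ]
    (hμ : ∀ᵐ u ∂μ, u ^ ρ = 1) {E : Type*} [NormedAddCommGroup E] [NormedSpace ℝ E] [CompleteSpace E]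
    (F : Circle → E) :
    ∫ u, F u ∂μ = ∑ k ∈ Finset.Icc 1 ρ, μ.real {e ((k : ℝ) / ρ)} • F (e ((k : ℝ) / ρ)) := by
  rw [integral_congr_ae (ae_eq_sum_indicator hρ hμ F), integral_finsetSum _ fun k _ =>
    (integrable_const _).indicator (measurableSet_singleton _)]
  exact Finset.sum_congr rfl fun k _ => integral_indicator_const _ (measurableSet_singleton _)

theorem ae_prodLaw_pow_eq_one {ρ : ℕ} {ζ : Measure Circle} [IsProbabilityMeasure ζ]
    (hζ : ∀ᵐ u ∂ζ, u ^ ρ = 1) (m : ℕ) : ∀ᵐ u ∂prodLaw ζ m, u ^ ρ = 1 := by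
  have hs : MeasurableSet {u : Circle | u ^ ρ = 1} :=
    (isClosed_eq (continuous_pow ρ) continuous_const).measurableSet
  rw [prodLaw, ae_map_iff (by fun_prop) hs]
  have h1 : ∀ᵐ w ∂Measure.pi (fun _ : Fin m => ζ), ∀ j, w j ^ ρ = 1 := by
    rw [eventually_all]
    exact fun j => (measurePreserving_eval (fun _ : Fin m => ζ) j).quasiMeasurePreserving.ae hζ
  filter_upwards [h1] with w hw
  rw [← Finset.prod_pow]
  exact Finset.prod_eq_one fun j _ => hw j

theorem coe_e_div_pow {ρ : ℕ} (hρ : 0 < ρ) (k j : ℕ) :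
    ((e ((k : ℝ) / ρ) : Circle) : ℂ) ^ j = Complex.exp (2 * Real.pi * Complex.I * j * k / ρ) := by
  have : (ρ : ℂ) ≠ 0 := by exact_mod_cast hρ.ne'
  rw [coe_e, ← Complex.exp_nat_mul]
  congr 1
  push_cast
  field_simp

theorem coe_e_div_pow_comm {ρ : ℕ} (hρ : 0 < ρ) (k j : ℕ) :
    ((e ((k : ℝ) / ρ) : Circle) : ℂ) ^ j = ((e ((j : ℝ) / ρ) : Circle) : ℂ) ^ k := by
  rw [coe_e_div_pow hρ, coe_e_div_pow hρ]
  congr 1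
  ring

/-- By orthogonality of the characters modulo `ρ`, the `j`-th moment is the coefficient `c (ρ - j)`;
the reflection keeps the index in the range where the hypothesis applies. -/
theorem norm_integral_pow_lt_one {ρ : ℕ} (hρ : 0 < ρ) {ζ : Measure Circle} [IsProbabilityMeasure ζ]
    (h : IsDiscreteWithFourier ζ ρ) {j : ℕ} (hj : 1 ≤ j) (hjρ : j < ρ) :
    ‖∫ u, ((u : ℂ) ^ j) ∂ζ‖ < 1 := by
  obtain ⟨hae, c, hc, hc1⟩ := h
  have hρC : (ρ : ℂ) ≠ 0 := by exact_mod_cast hρ.ne'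
  have hkey : ∫ u, ((u : ℂ) ^ j) ∂ζ = c (ρ - j) := by
    rw [integral_of_ae_pow_eq_one hρ hae]
    have h1 : ∀ k ∈ Finset.Icc 1 ρ, ζ.real {e ((k : ℝ) / ρ)} • ((e ((k : ℝ) / ρ) : Circle) : ℂ) ^ j =
        ∑ i ∈ Finset.range ρ, 1 / (ρ : ℂ) * c i * (((e (((i + j : ℕ) : ℝ) / ρ) : Circle) : ℂ) ^ k) := by
      intro k hk
      rw [Complex.real_smul, hc k hk, Finset.mul_sum, Finset.sum_mul]
      refine Finset.sum_congr rfl fun i _ => ?_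
      rw [← coe_e_div_pow_comm hρ k (i + j), pow_add, coe_e_div_pow hρ k i]
      ring
    rw [Finset.sum_congr rfl h1, Finset.sum_comm]
    have h2 : ∀ i ∈ Finset.range ρ, ∑ k ∈ Finset.Icc 1 ρ, 1 / (ρ : ℂ) * c i *
        (((e (((i + j : ℕ) : ℝ) / ρ) : Circle) : ℂ) ^ k) = if i = ρ - j then c i else 0 := by
      intro i hi
      have hi' := Finset.mem_range.1 hi
      rw [← Finset.mul_sum, sum_Icc_pow_eq_ite (by
        rw [← Circle.coe_pow, e_div_pow hρ, Circle.coe_one])]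
      have hiff : ((e (((i + j : ℕ) : ℝ) / ρ) : Circle) : ℂ) = 1 ↔ i = ρ - j := by
        rw [Circle.coe_eq_one, e_eq_one_iff]
        have hρR : (ρ : ℝ) ≠ 0 := by positivity
        constructor
        · rintro ⟨l, hl⟩
          rw [div_eq_iff hρR] at hl
          have h3 : ((i + j : ℕ) : ℤ) = l * ρ := by exact_mod_cast hl
          have h4 : (((i + j : ℕ) : ℤ) - ρ) = 0 :=
            Int.eq_zero_of_abs_lt_dvd (m := ρ) ⟨l - 1, by rw [h3]; ring⟩ (by rw [abs_lt]; omega)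
          omega
        · intro h3
          refine ⟨1, ?_⟩
          have h4 : i + j = ρ := by omega
          rw [h4, div_self hρR, Int.cast_one]
      simp only [hiff]
      split_ifs
      · field_simp
      · rw [mul_zero]
    rw [Finset.sum_congr rfl h2, Finset.sum_ite_eq', if_pos (Finset.mem_range.2 (by omega))]
  rw [hkey]
  exact hc1 _ (Finset.mem_range.2 (by omega)) (by omega)

/-- Fourier inversion on the `ρ`-th roots of unity: the trivial character contributes `1 / ρ`, and
the others contribute `m`-th powers of moments of modulus at most `r < 1`. -/
theorem exists_abs_prodLaw_sub_inv_le {ρ : ℕ} (hρ : 0 < ρ) {ζ : Measure Circle}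
    [IsProbabilityMeasure ζ] (h : IsDiscreteWithFourier ζ ρ) :
    ∃ r : ℝ, 0 ≤ r ∧ r < 1 ∧ ∀ m : ℕ, ∀ k ∈ Finset.Icc 1 ρ,
      |(prodLaw ζ m).real {e ((k : ℝ) / ρ)} - 1 / ρ| ≤ r ^ m := by
  have hρC : (ρ : ℂ) ≠ 0 := by exact_mod_cast hρ.ne'
  have hρR : (0 : ℝ) < ρ := by exact_mod_cast hρ
  set χ : ℕ → ℂ := fun j => ∫ u, ((u : ℂ) ^ j) ∂ζ with hχ
  obtain ⟨r, hr, hr1, hrχ⟩ : ∃ r : ℝ, 0 ≤ r ∧ r < 1 ∧ ∀ j ∈ Finset.Ico 1 ρ, ‖χ j‖ ≤ r := by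
    rcases (Finset.Ico 1 ρ).eq_empty_or_nonempty with h0 | h0
    · exact ⟨0, le_rfl, one_pos, by simp [h0]⟩
    · obtain ⟨i, hi, himax⟩ := Finset.exists_max_image _ (fun j => ‖χ j‖) h0
      have hi' := Finset.mem_Ico.1 hi
      exact ⟨‖χ i‖, norm_nonneg _, norm_integral_pow_lt_one hρ h hi'.1 hi'.2, himax⟩
  refine ⟨r, hr, hr1, fun m k hk => ?_⟩
  have hmom : ∀ j : ℕ, χ j ^ m = ∑ l ∈ Finset.Icc 1 ρ,
      (prodLaw ζ m).real {e ((l : ℝ) / ρ)} • ((e ((l : ℝ) / ρ) : Circle) : ℂ) ^ j := fun j => by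
    rw [← integral_of_ae_pow_eq_one hρ (ae_prodLaw_pow_eq_one h.1 m) fun u : Circle => (u : ℂ) ^ j]
    have := integral_zpow_prodLaw ζ m j
    simp only [zpow_natCast] at this
    exact this.symm
  set w : Circle := e ((k : ℝ) / ρ) with hw
  have hinv : ∑ j ∈ Finset.range ρ, ((w⁻¹ : Circle) : ℂ) ^ j * χ j ^ m =
      ρ * ((prodLaw ζ m).real {w} : ℂ) := by
    simp only [hmom, Finset.mul_sum]
    rw [Finset.sum_comm]
    have h1 : ∀ l ∈ Finset.Icc 1 ρ, ∑ j ∈ Finset.range ρ, ((w⁻¹ : Circle) : ℂ) ^ j *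
        (prodLaw ζ m).real {e ((l : ℝ) / ρ)} • ((e ((l : ℝ) / ρ) : Circle) : ℂ) ^ j =
        if l = k then ρ * ((prodLaw ζ m).real {w} : ℂ) else 0 := by
      intro l hl
      have h2 : ∀ j : ℕ, ((w⁻¹ : Circle) : ℂ) ^ j *
          (prodLaw ζ m).real {e ((l : ℝ) / ρ)} • ((e ((l : ℝ) / ρ) : Circle) : ℂ) ^ j =
          ((prodLaw ζ m).real {e ((l : ℝ) / ρ)} : ℂ) *
            ((w⁻¹ * e ((l : ℝ) / ρ) : Circle) : ℂ) ^ j := fun j => by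
        rw [Complex.real_smul, Circle.coe_mul, mul_pow]
        ring
      simp only [h2]
      rw [← Finset.mul_sum, sum_range_pow_eq_ite (by
        rw [← Circle.coe_pow, mul_pow, inv_pow, hw, e_div_pow hρ, e_div_pow hρ]; simp)]
      have hiff : ((w⁻¹ * e ((l : ℝ) / ρ) : Circle) : ℂ) = 1 ↔ l = k := by
        rw [Circle.coe_eq_one, inv_mul_eq_one, hw]
        exact ⟨fun h => (e_div_injOn hρ hk hl h).symm, fun h => by rw [h]⟩
      simp only [hiff]
      split_ifs with hlk
      · rw [hlk, mul_comm]
      · rw [mul_zero]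
    rw [Finset.sum_congr rfl h1, Finset.sum_ite_eq', if_pos hk]
  have h0 : ((w⁻¹ : Circle) : ℂ) ^ 0 * χ 0 ^ m = 1 := by simp [hχ]
  have hsplit := Finset.sum_range_eq_add_Ico (fun j => ((w⁻¹ : Circle) : ℂ) ^ j * χ j ^ m) hρ
  rw [hinv, h0] at hsplit
  have hnorm : ‖∑ j ∈ Finset.Ico 1 ρ, ((w⁻¹ : Circle) : ℂ) ^ j * χ j ^ m‖ ≤ ρ * r ^ m := by
    refine (norm_sum_le_of_le _ (f := fun j => ((w⁻¹ : Circle) : ℂ) ^ j * χ j ^ m)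
      (n := fun _ => r ^ m) fun j hj => ?_).trans ?_
    · rw [norm_mul, norm_pow, Circle.norm_coe, one_pow, one_mul, norm_pow]
      exact pow_le_pow_left₀ (norm_nonneg _) (hrχ j hj) m
    · rw [Finset.sum_const, Nat.card_Ico, nsmul_eq_mul]
      exact mul_le_mul_of_nonneg_right (by exact_mod_cast Nat.sub_le ρ 1) (by positivity)
  have h3 : ((ρ * ((prodLaw ζ m).real {w} - 1 / ρ) : ℝ) : ℂ) =
      ∑ j ∈ Finset.Ico 1 ρ, ((w⁻¹ : Circle) : ℂ) ^ j * χ j ^ m := by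
    rw [Complex.ofReal_mul, Complex.ofReal_sub, Complex.ofReal_div, Complex.ofReal_one,
      Complex.ofReal_natCast, mul_sub, hsplit, mul_one_div_cancel hρC, add_sub_cancel_left]
  rw [← h3, Complex.norm_real, Real.norm_eq_abs, abs_mul, Nat.abs_cast] at hnorm
  exact le_of_mul_le_mul_left hnorm hρR

/-- Up to an exponentially small change of the masses, the expectation is the average over `k` of
`F` at `m φ + k / ρ`, and each `k` gives a shifted orbit of the rotation. -/
theorem isEquidistributed_of_isDiscreteWithFourier {ρ : ℕ} (hρ : 0 < ρ) {ζ : Measure Circle}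
    [IsProbabilityMeasure ζ] (h : IsDiscreteWithFourier ζ ρ) {φ : ℝ} (hφ : IsFiniteType φ)
    {F : Circle → ℝ} {ψ : ℝ → ℝ} {G : ℝ → ℝ → ℝ} (H : IsTame (fun t => F (e t)) ψ G)
    (horbit : ∀ k ∈ Finset.Icc 1 ρ, ∀ ε : ℝ, 0 < ε → ∃ C : ℝ, 0 ≤ C ∧ ∀ m : ℕ, 1 ≤ m →
      |F (e (m * φ + (k : ℝ) / ρ))| ≤ C * (m : ℝ) ^ ε) :
    IsEquidistributed ζ (e φ) F := by
  have hρR : (0 : ℝ) < ρ := by exact_mod_cast hρ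
  have hρ1 : 1 / (ρ : ℝ) ≤ 1 := by
    rw [div_le_one hρR]; exact_mod_cast hρ
  obtain ⟨r, hr, hr1, hP⟩ := exists_abs_prodLaw_sub_inv_le hρ h
  have hequi := fun (k : ℕ) hk => H.exists_equidistribution hφ ((k : ℝ) / ρ) (horbit k hk)
  choose! C δ hC hδ hδ1 hequi using hequi
  -- Linear growth is enough against the factor `r ^ m` in the error of the masses.
  have hB := fun (k : ℕ) hk => horbit k hk 1 one_pos
  choose! B hB0 hB using hB
  simp only [Real.rpow_one] at hB
  -- The smallest saving among the finitely many shifts serves for all of them.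
  obtain ⟨i, hi, himin⟩ := Finset.exists_min_image (Finset.Icc 1 ρ) δ ⟨1, by simp; omega⟩
  have hsum : Summable fun m : ℕ => (m : ℝ) * r ^ m := by
    simpa using summable_pow_mul_geometric_of_norm_lt_one 1
      (by rwa [Real.norm_eq_abs, abs_of_nonneg hr] : ‖r‖ < 1)
  set L := ∑' m : ℕ, (m : ℝ) * r ^ m with hL
  have hL0 : 0 ≤ L := tsum_nonneg fun m => by positivity
  set A := ∫ t in (0 : ℝ)..1, F (e t) with hA
  refine ⟨∑ k ∈ Finset.Icc 1 ρ, (C k + B k * L), δ i,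
    Finset.sum_nonneg fun k hk => add_nonneg (hC k hk) (mul_nonneg (hB0 k hk) hL0),
    hδ i hi, hδ1 i hi, fun M hM => ?_⟩
  have hM1 : (1 : ℝ) ≤ M := by exact_mod_cast hM
  have hpow1 : 1 ≤ (M : ℝ) ^ (1 - δ i) := Real.one_le_rpow hM1 (by linarith [hδ1 i hi])
  have hE : ∀ m ∈ Finset.Icc 1 M, ∫ u, F (e φ ^ m * u) ∂prodLaw ζ m - A =
      ∑ k ∈ Finset.Icc 1 ρ, (1 / (ρ : ℝ) * (F (e (m * φ + (k : ℝ) / ρ)) - A) +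
        ((prodLaw ζ m).real {e ((k : ℝ) / ρ)} - 1 / ρ) * F (e (m * φ + (k : ℝ) / ρ))) := by
    intro m _
    rw [integral_of_ae_pow_eq_one hρ (ae_prodLaw_pow_eq_one h.1 m) fun u => F (e φ ^ m * u)]
    have h1 : A = ∑ k ∈ Finset.Icc 1 ρ, 1 / (ρ : ℝ) * A := by
      rw [Finset.sum_const, Nat.card_Icc, Nat.add_sub_cancel, nsmul_eq_mul]
      field_simp
    nth_rw 1 [h1]
    rw [← Finset.sum_sub_distrib]
    refine Finset.sum_congr rfl fun k _ => ?_
    rw [smul_eq_mul, ← e_nat_mul, ← e_add]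
    ring
  rw [Finset.sum_congr rfl hE, Finset.sum_comm, Finset.sum_mul]
  refine (Finset.abs_sum_le_sum_abs _ _).trans (Finset.sum_le_sum fun k hk => ?_)
  rw [Finset.sum_add_distrib, ← Finset.mul_sum, add_mul]
  refine (abs_add_le _ _).trans (add_le_add ?_ ?_)
  · rw [abs_mul, abs_of_nonneg (by positivity : 0 ≤ 1 / (ρ : ℝ))]
    refine (mul_le_of_le_one_left (abs_nonneg _) hρ1).trans ((hequi k hk M hM).trans ?_)
    exact mul_le_mul_of_nonneg_left
      (Real.rpow_le_rpow_of_exponent_le hM1 (by linarith [himin k hk])) (hC k hk)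
  · refine le_trans ?_ (le_mul_of_one_le_right (mul_nonneg (hB0 k hk) hL0) hpow1)
    refine (Finset.abs_sum_le_sum_abs _ _).trans ?_
    have h2 : ∀ m ∈ Finset.Icc 1 M, |((prodLaw ζ m).real {e ((k : ℝ) / ρ)} - 1 / ρ) *
        F (e (m * φ + (k : ℝ) / ρ))| ≤ B k * ((m : ℝ) * r ^ m) := fun m hm => by
      rw [abs_mul]
      calc _ ≤ r ^ m * (B k * m) := mul_le_mul (hP m k hk) (hB k hk m (Finset.mem_Icc.1 hm).1)
            (abs_nonneg _) (by positivity)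
        _ = _ := by ring
    refine (Finset.sum_le_sum h2).trans ?_
    rw [← Finset.mul_sum]
    exact mul_le_mul_of_nonneg_left (hsum.sum_le_tsum _ fun m _ => by positivity) (hB0 k hk)

/-! ### Admissible laws and the limit theorem for tame functions -/

theorem one_add_log_le_mul_rpow {ε : ℝ} (hε : 0 < ε) {m : ℕ} (hm : 1 ≤ m) :
    1 + Real.log m ≤ (1 + 1 / ε) * (m : ℝ) ^ ε := by
  have h1 := Real.log_le_rpow_div (Nat.cast_nonneg m : (0 : ℝ) ≤ m) hε
  have h2 : 1 ≤ (m : ℝ) ^ ε := Real.one_le_rpow (by exact_mod_cast hm) hε.le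
  calc 1 + Real.log m ≤ (m : ℝ) ^ ε + (m : ℝ) ^ ε / ε := add_le_add h2 h1
    _ = _ := by ring

theorem exists_pow_le_mul_rpow {a : ℕ → ℝ} (ha : ∀ m, 0 ≤ a m) {C : ℝ} (hC : 0 ≤ C)
    (h : ∀ m : ℕ, 1 ≤ m → a m ≤ C * (1 + Real.log m)) {p : ℕ} (hp : 0 < p) {ε : ℝ} (hε : 0 < ε) :
    ∃ C' : ℝ, 0 ≤ C' ∧ ∀ m : ℕ, 1 ≤ m → a m ^ p ≤ C' * (m : ℝ) ^ ε := by
  have hpR : (0 : ℝ) < p := by exact_mod_cast hp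
  have hεp : 0 < ε / p := by positivity
  refine ⟨(C * (1 + 1 / (ε / p))) ^ p, by positivity, fun m hm => ?_⟩
  have h1 : a m ≤ C * (1 + 1 / (ε / p)) * (m : ℝ) ^ (ε / p) := by
    rw [mul_assoc]
    exact (h m hm).trans (mul_le_mul_of_nonneg_left (one_add_log_le_mul_rpow hεp hm) hC)
  refine (pow_le_pow_left₀ (ha m) h1 p).trans (le_of_eq ?_)
  rw [mul_pow, ← Real.rpow_natCast ((m : ℝ) ^ (ε / p)), ← Real.rpow_mul (Nat.cast_nonneg m),
    div_mul_cancel₀ _ hpR.ne']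

/-- The hypotheses on the law `ζ` and the point `x` under which the sums of `h (x^m T_{m,k})` are
treated: a Fourier density, or roots of unity together with logarithmic growth along the orbit. -/
def IsAdmissible (ζ : Measure Circle) (x : Circle) (h : Circle → ℝ) : Prop :=
  (∃ γ c, HasFourierDensity ζ γ c ∧ ∀ j : ℤ, j ≠ 0 → ‖c j‖ < 1) ∨
  ∃ (ρ : ℕ) (φ : ℝ), 0 < ρ ∧ IsDiscreteWithFourier ζ ρ ∧ x = e φ ∧ IsFiniteType φ ∧
    ∀ k ∈ Finset.Icc 1 ρ, ∃ C : ℝ, 0 ≤ C ∧ ∀ m : ℕ, 1 ≤ m →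
      |h (e (m * φ + (k : ℝ) / ρ))| ≤ C * (1 + Real.log m)

/-- Logarithmic growth of `h` along the orbit passes to its powers as growth slower than any power
of `m`, which is what tame equidistribution asks for. -/
theorem IsAdmissible.isEquidistributed {ζ : Measure Circle} [IsProbabilityMeasure ζ] {x : Circle}
    {h : Circle → ℝ} (hadm : IsAdmissible ζ x h) {F : Circle → ℝ} (hF : Measurable F) {p : ℕ}
    (hp : 0 < p) (hFh : ∀ u, |F u| = |h u| ^ p) {ψ : ℝ → ℝ} {G : ℝ → ℝ → ℝ}
    (H : IsTame (fun t => F (e t)) ψ G) : IsEquidistributed ζ x F := by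
  rcases hadm with ⟨γ, c, hγ, hc⟩ | ⟨ρ, φ, hρ, hζ, rfl, hφ, hlog⟩
  · exact hγ.isEquidistributed hc x hF H.integrableOn
  · refine isEquidistributed_of_isDiscreteWithFourier hρ hζ hφ H fun k hk ε hε => ?_
    obtain ⟨C, hC, hb⟩ := hlog k hk
    simp only [hFh]
    exact exists_pow_le_mul_rpow (fun m => abs_nonneg _) hC hb hp hε

theorem IsAdmissible.integrable {ζ : Measure Circle} [IsProbabilityMeasure ζ] {x : Circle}
    {h : Circle → ℝ} (hadm : IsAdmissible ζ x h) {F : Circle → ℝ} (hF : Measurable F)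
    (hint : IntegrableOn (fun t => F (e t)) (Set.Icc 0 1)) {m : ℕ} (hm : 1 ≤ m) :
    Integrable (fun u => F (x ^ m * u)) (prodLaw ζ m) := by
  rcases hadm with ⟨γ, c, hγ, hc⟩ | ⟨ρ, φ, hρ, hζ, rfl, hφ, hlog⟩
  · obtain ⟨K, r, -, -, -, H⟩ := hγ.exists_integral_prodLaw_bound hc x hF hint
    exact (H m hm).1
  · exact integrable_of_ae_pow_eq_one hρ (ae_prodLaw_pow_eq_one hζ.1 m) _

theorem IsAdmissible.exists_integral_abs_le {ζ : Measure Circle} [IsProbabilityMeasure ζ]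
    {x : Circle} {h : Circle → ℝ} (hadm : IsAdmissible ζ x h) (hh : Measurable h)
    (hint : IntegrableOn (fun t => |h (e t)|) (Set.Icc 0 1)) :
    ∃ C, ∀ m : ℕ, 1 ≤ m → ∫ u, |h (x ^ m * u)| ∂(prodLaw ζ m) ≤ C * (1 + Real.log m) := by
  rcases hadm with ⟨γ, c, hγ, hc⟩ | ⟨ρ, φ, hρ, hζ, rfl, hφ, hlog⟩
  · exact hγ.exists_integral_le hc x hh.abs hint
  · choose! C hC hb using hlog
    refine ⟨∑ k ∈ Finset.Icc 1 ρ, C k, fun m hm => ?_⟩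
    rw [integral_of_ae_pow_eq_one hρ (ae_prodLaw_pow_eq_one hζ.1 m) fun u => |h (e φ ^ m * u)|,
      Finset.sum_mul]
    refine Finset.sum_le_sum fun k hk => ?_
    rw [smul_eq_mul, ← e_nat_mul, ← e_add]
    exact (mul_le_of_le_one_left (abs_nonneg _) measureReal_le_one).trans (hb k hk m hm)

theorem tendstoInDistribution_cycleSum_of_isTame {θ : ℝ} (hθ : 0 < θ) {h : Circle → ℝ}
    (hh : Measurable h) {x : Circle} {ζ : Measure Circle} [IsProbabilityMeasure ζ]
    {ψ : ℝ → ℝ} {G : ℝ → ℝ → ℝ} (H : IsTame (fun t => h (e t)) ψ G) (hadm : IsAdmissible ζ x h)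
    {Ω : ℕ → Type*} [∀ n, MeasurableSpace (Ω n)]
    (P : (n : ℕ) → Measure (Ω n)) [∀ n, IsProbabilityMeasure (P n)]
    (σ : (n : ℕ) → Ω n → Equiv.Perm (Fin n)) (hσ : ∀ n, Measurable (σ n))
    (hσ_law : ∀ n, (P n).map (σ n) = ewensMeasure θ n)
    (T : (n : ℕ) → ℕ → ℕ → Ω n → Circle) (hT : ∀ n m k, Measurable (T n m k))
    (hT_law : ∀ n m k, (P n).map (T n m k) = prodLaw ζ m)
    (hT_indep : ∀ n, iIndepFun (fun (p : ℕ × ℕ) => T n p.1 p.2) (P n))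
    (hσT_indep : ∀ n, IndepFun (σ n) (fun ω (p : ℕ × ℕ) => T n p.1 p.2 ω) (P n)) :
    TendstoInDistribution
      (fun (n : ℕ) (ω : Ω n) => cycleSum h x (σ n ω) (fun m k => T n m k ω) / √(Real.log n)
          - θ * (∫ t in (0 : ℝ)..1, h (e t)) * √(Real.log n))
      atTop (fun y : ℝ => y) P
      (gaussianReal 0 (θ * ∫ t in (0 : ℝ)..1, h (e t) ^ 2).toNNReal) := by
  obtain ⟨G₂, H₂⟩ := H.sq
  obtain ⟨G₃, H₃⟩ := H.abs_pow_three
  refine tendstoInDistribution_cycleSum_of_isEquidistributed hθ hh P σ hσ hσ_law T hT hT_law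
    hT_indep hσT_indep (fun m hm => ?_) ?_ ?_ ?_ ?_ ?_
  · exact hadm.integrable (F := fun u => |h u| ^ 3) (by fun_prop) H₃.integrableOn hm
  · exact hadm.isEquidistributed hh one_pos (fun u => (pow_one _).symm) H
  · exact hadm.isEquidistributed (F := fun u => h u ^ 2) (by fun_prop) two_pos
      (fun u => abs_pow _ _) H₂
  · exact hadm.isEquidistributed (F := fun u => |h u| ^ 3) (by fun_prop) three_pos
      (fun u => by rw [abs_of_nonneg (by positivity)]) H₃
  · exact hadm.isEquidistributed (F := fun u => |h u|) (by fun_prop) one_pos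
      (fun u => by rw [abs_abs, pow_one]) H.abs
  · exact hadm.exists_integral_abs_le hh H.abs.integrableOn

/-- The polynomial lower bound along the orbit and the boundedness of `f` are turned into a
logarithmic bound. -/
theorem exists_abs_log_norm_orbit_le {f : Circle → ℂ} (hf : IsRealAnalytic f) (hf0 : f ≠ 0)
    (hroots : ∀ u : Circle, f u = 0 → ∃ m : ℕ, 0 < m ∧ u ^ m = 1) {φ : ℝ} (hφ : IsFiniteType φ)
    {ρ : ℕ} (hρ : 0 < ρ) (k : ℕ) :
    ∃ C : ℝ, 0 ≤ C ∧ ∀ m : ℕ, 1 ≤ m →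
      |Real.log ‖f (e (m * φ + (k : ℝ) / ρ))‖| ≤ C * (1 + Real.log m) := by
  obtain ⟨c, hc, A, hA, hlow⟩ := exists_le_norm_orbit hf hf0 hroots hφ hρ k
  obtain ⟨B, hB, hup⟩ := exists_bound_of_periodic (g := fun t => f (e t))
    ((continuous_of_isRealAnalytic hf).comp continuous_e) fun t => by
      have := e_add_intCast t 1
      push_cast at this
      simp only [this]
  refine ⟨|Real.log c| + A + Real.log B, by have := Real.log_nonneg hB; positivity, fun m hm => ?_⟩
  have hm0 : (0 : ℝ) < m := by exact_mod_cast hm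
  have hlm : 0 ≤ Real.log m := Real.log_nonneg (by exact_mod_cast hm)
  have hlB := Real.log_nonneg hB
  have h1 := hlow m hm
  have hpos : 0 < c * (m : ℝ) ^ (-A) := by positivity
  have h2 := Real.log_le_log hpos h1
  rw [Real.log_mul hc.ne' (by positivity), Real.log_rpow hm0] at h2
  have h3 := Real.log_le_log (hpos.trans_le h1) (hup (m * φ + (k : ℝ) / ρ))
  have h4 := neg_abs_le (Real.log c)
  have h5 := abs_nonneg (Real.log c)
  have h6 : 0 ≤ (|Real.log c| + Real.log B) * Real.log m := by positivity
  have h7 : 0 ≤ A * Real.log m := by positivity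
  rw [abs_le]
  constructor <;> nlinarith

theorem w2_re (f : Circle → ℂ) (x : Circle) {n : ℕ} (s : Equiv.Perm (Fin n)) (T : ℕ → ℕ → Circle) :
    (w2 f x s T).re = cycleSum (fun u => Real.log ‖f u‖) x s T := by
  simp only [w2, cycleSum, Complex.re_sum, Complex.log_re]

theorem w2_im (f : Circle → ℂ) (x : Circle) {n : ℕ} (s : Equiv.Perm (Fin n)) (T : ℕ → ℕ → Circle) :
    (w2 f x s T).im = cycleSum (fun u => (f u).arg) x s T := by
  simp only [w2, cycleSum, Complex.im_sum, Complex.log_im]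

theorem intervalIntegrable_log {f : Circle → ℂ}
    (hR : IntervalIntegrable (fun t => Real.log ‖f (e t)‖) volume 0 1)
    (hI : IntervalIntegrable (fun t => (f (e t)).arg) volume 0 1) :
    IntervalIntegrable (fun t => Complex.log (f (e t))) volume 0 1 := by
  have h1 : IntervalIntegrable (fun t => ((Real.log ‖f (e t)‖ : ℝ) : ℂ) +
      (((f (e t)).arg : ℝ) : ℂ) * Complex.I) volume 0 1 :=
    IntervalIntegrable.add ⟨hR.1.ofReal, hR.2.ofReal⟩
      (IntervalIntegrable.mul_const ⟨hI.1.ofReal, hI.2.ofReal⟩ _)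
  exact h1

theorem mR_eq {f : Circle → ℂ}
    (h : IntervalIntegrable (fun t => Complex.log (f (e t))) volume 0 1) :
    mR f = ∫ t in (0 : ℝ)..1, Real.log ‖f (e t)‖ := by
  have := Complex.reCLM.intervalIntegral_comp_comm h
  simp only [Complex.reCLM_apply, Complex.log_re] at this
  rw [mR, logMean, this]

theorem mI_eq {f : Circle → ℂ}
    (h : IntervalIntegrable (fun t => Complex.log (f (e t))) volume 0 1) :
    mI f = ∫ t in (0 : ℝ)..1, (f (e t)).arg := by
  have := Complex.imCLM.intervalIntegral_comp_comm h
  simp only [Complex.imCLM_apply, Complex.log_im] at this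
  rw [mI, logMean, this]

end EwensCLT

theorem mainTheorem4
    (θ : ℝ) (hθ : 0 < θ)
    (f : Circle → ℂ) (hf : EwensCLT.IsRealAnalytic f) (hf0 : f ≠ 0)
    (x : Circle) (hx : ∀ m : ℤ, m ≠ 0 → x ^ m ≠ 1)
    -- the random variable `z`
    {Ω₀ : Type*} [MeasurableSpace Ω₀] (P₀ : Measure Ω₀) [IsProbabilityMeasure P₀]
    (z : Ω₀ → Circle) (hz : Measurable z)
    (hcases :
      P₀.map z = EwensCLT.uniformLaw ∨
      EwensCLT.HasSummableFourierDensity (P₀.map z) ∨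
      ((∃ ρ : ℕ, 0 < ρ ∧ EwensCLT.IsDiscreteWithFourier (P₀.map z) ρ) ∧
        (∀ u : Circle, f u = 0 → ∃ m : ℕ, 0 < m ∧ u ^ m = 1) ∧
        (∃ φ : ℝ, x = EwensCLT.e φ ∧ EwensCLT.IsFiniteType φ)))
    -- the random permutation `σ n` and the family `T n m k`, for every `n`
    {Ω : ℕ → Type*} [∀ n, MeasurableSpace (Ω n)]
    (P : (n : ℕ) → Measure (Ω n)) [∀ n, IsProbabilityMeasure (P n)]
    (σ : (n : ℕ) → Ω n → Equiv.Perm (Fin n)) (hσ : ∀ n, Measurable (σ n))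
    (hσ_law : ∀ n, (P n).map (σ n) = EwensCLT.ewensMeasure θ n)
    (T : (n : ℕ) → ℕ → ℕ → Ω n → Circle) (hT : ∀ n m k, Measurable (T n m k))
    (hT_law : ∀ n m k, (P n).map (T n m k) = EwensCLT.prodLaw (P₀.map z) m)
    (hT_indep : ∀ n, iIndepFun (fun (p : ℕ × ℕ) => T n p.1 p.2) (P n))
    (hσT_indep : ∀ n, IndepFun (σ n) (fun ω (p : ℕ × ℕ) => T n p.1 p.2 ω) (P n)) :
    -- the integrals defining the means and the variances converge
    IntervalIntegrable (fun φ => Complex.log (f (EwensCLT.e φ))) volume 0 1 ∧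
    IntervalIntegrable (fun φ => (Real.log ‖f (EwensCLT.e φ)‖) ^ 2) volume 0 1 ∧
    IntervalIntegrable (fun φ => (Complex.arg (f (EwensCLT.e φ))) ^ 2) volume 0 1 ∧
    TendstoInDistribution
      (fun (n : ℕ) (ω : Ω n) =>
        (EwensCLT.w2 f x (σ n ω) (fun m k => T n m k ω)).re / √(Real.log n)
          - θ * EwensCLT.mR f * √(Real.log n))
      atTop (fun y : ℝ => y) P (gaussianReal 0 (θ * EwensCLT.VR f).toNNReal) ∧
    TendstoInDistribution
      (fun (n : ℕ) (ω : Ω n) =>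
        (EwensCLT.w2 f x (σ n ω) (fun m k => T n m k ω)).im / √(Real.log n)
          - θ * EwensCLT.mI f * √(Real.log n))
      atTop (fun y : ℝ => y) P (gaussianReal 0 (θ * EwensCLT.VI f).toNNReal) := by
  have hper : Function.Periodic (fun t => f (EwensCLT.e t)) 1 := fun t => by
    have := EwensCLT.e_add_intCast t 1
    push_cast at this
    simp only [this]
  have hg := EwensCLT.analyticOnNhd_comp_e hf
  have hg0 := EwensCLT.comp_e_ne_zero hf0
  have hfm : Measurable f := (EwensCLT.continuous_of_isRealAnalytic hf).measurable
  have hR := EwensCLT.isTame_log hg hper hg0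
  obtain ⟨ψ, G, hI⟩ := EwensCLT.exists_isTame_arg hg hper hg0
  obtain ⟨_, hR2⟩ := hR.sq
  obtain ⟨_, hI2⟩ := hI.sq
  have hlog := EwensCLT.intervalIntegrable_log hR.intervalIntegrable hI.intervalIntegrable
  have hζ : IsProbabilityMeasure (P₀.map z) := Measure.isProbabilityMeasure_map hz.aemeasurable
  -- The three cases collapse to two: the uniform law has a Fourier density whose only nonzero
  -- coefficient is `c 0`. The growth of `h` along the orbit matters only in the discrete case, and
  -- for the argument it is trivial.
  have hadm : ∀ h : Circle → ℝ, (∀ (φ : ℝ) (ρ : ℕ), 0 < ρ → EwensCLT.IsFiniteType φ →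
      (∀ u : Circle, f u = 0 → ∃ m : ℕ, 0 < m ∧ u ^ m = 1) → ∀ k : ℕ,
        ∃ C : ℝ, 0 ≤ C ∧ ∀ m : ℕ, 1 ≤ m →
          |h (EwensCLT.e (m * φ + (k : ℝ) / ρ))| ≤ C * (1 + Real.log m)) →
      EwensCLT.IsAdmissible (P₀.map z) x h := by
    intro h hh
    rcases hcases with hu | hd | ⟨⟨ρ, hρ, hdisc⟩, hroots, φ, hxφ, hφ⟩
    · rw [hu]
      exact Or.inl ⟨_, _, EwensCLT.hasFourierDensity_uniformLaw, fun j hj => by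
        rw [if_neg hj, norm_zero]; exact one_pos⟩
    · exact Or.inl hd.exists_hasFourierDensity
    · exact Or.inr ⟨ρ, φ, hρ, hdisc, hxφ, hφ, fun k _ => hh φ ρ hρ hφ hroots k⟩
  have hadmR := hadm (fun u => Real.log ‖f u‖) fun φ ρ hρ hφ hroots k =>
    EwensCLT.exists_abs_log_norm_orbit_le hf hf0 hroots hφ hρ k
  have hadmI := hadm (fun u => (f u).arg) fun φ ρ _ _ _ k =>
    ⟨Real.pi, Real.pi_pos.le, fun m hm => (Complex.abs_arg_le_pi _).trans
      (le_mul_of_one_le_right Real.pi_pos.le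
        (le_add_of_nonneg_right (Real.log_nonneg (by exact_mod_cast hm))))⟩
  refine ⟨hlog, hR2.intervalIntegrable, hI2.intervalIntegrable, ?_, ?_⟩
  · simp only [EwensCLT.w2_re, EwensCLT.mR_eq hlog, EwensCLT.VR]
    exact EwensCLT.tendstoInDistribution_cycleSum_of_isTame hθ (h := fun u => Real.log ‖f u‖)
      (Real.measurable_log.comp hfm.norm) hR hadmR P σ hσ hσ_law T hT hT_law hT_indep hσT_indep
  · simp only [EwensCLT.w2_im, EwensCLT.mI_eq hlog, EwensCLT.VI]
    exact EwensCLT.tendstoInDistribution_cycleSum_of_isTame hθ (h := fun u => (f u).arg)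
      (Complex.measurable_arg.comp hfm) hI hadmI P σ hσ hσ_law T hT hT_law hT_indep hσT_indep
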